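/- **Setting.** A $\mathbb Z$-graded supermanifold $\mathcal F$ is a (finite-dimensional, real, smooth) supermanifold, i.e. a Hausdorff second countable space with a sheaf of supercommutative algebras locally isomorphic to $C^\infty_{\mathbb R^m}\otimes\Lambda(\mathbb R^n)$, together with an even (Euler) vector field $E$ such that near every point there are coordinates $x^a$ with $E x^a=w_a x^a$, $w_a\in\mathbb Z$. A function, vector field or form $\sigma$ has ghost number $\mathrm{gh}(\sigma)=d$ if $L_E\sigma=d\,\sigma$; morphisms preserve parity and are compatible with the Euler vector fields. $\delta$ is the de Rham differential, $\iota_X$ has total parity $|X|+1$, and $L_X=\iota_X\delta+(-1)^{|X|}\delta\iota_X$, so that $L_Q=\iota_Q\delta-\delta\iota_Q$ and $[L_Q,\iota_Q]=\iota_{[Q,Q]}$ for odd $Q$. Let $k\in\mathbb Z$, $k\neq-1$, and let $\mathcal F$ be a $\mathbb Z$-graded supermanifold with a closed $2$-form $\omega$ of definite parity and $\mathrm{gh}(\omega)=k-1$, a function $S$ with $\mathrm{gh}(S)=k$, an odd vector field $Q$ with $\mathrm{gh}(Q)=1$ and a function $T$ with $\mathrm{gh}(T)=k+1$ such that $$\tfrac12\iota_{[Q,Q]}\omega=-\delta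 T .$$ Put $\underline\alpha:=\iota_Q\omega-\delta S$, $\underline\omega:=\delta\underline\alpha$, $\underline T:=-L_QT$ and $\ker\underline\omega:=\{Y\mid\iota_Y\underline\omega=0\}$. **Theorem.** (a) $\ker\underline\omega$ is involutive: it is closed under the bracket of vector fields. (b) There is a unique function $\underline S$ on $\mathcal F$ with $\mathrm{gh}(\underline S)=k+1$ and $\iota_Q\underline\omega=\delta\underline S$. Assume in addition that $\underline\omega$ has constant rank (at each point the kernel of $\underline\omega$ on tangent vectors is spanned by the values of local vector fields in $\ker\underline\omega$) and that the leaf space $\mathcal F^\partial=\mathcal F/\ker\underline\omega$ is smooth: $\mathcal F^\partial$ is a $\mathbb Z$-graded supermanifold, and the projection $\pi\colon\mathcal F\to\mathcal F^\partial$ is a surjective submersion of graded supermanifolds with connected fibres whose vertical vector fields are exactly those in $\ker\underline\omega$. Then: (c) There is a unique $2$-form $\omega^\partial$ on $\mathcal F^\partial$ with $\underline\omega=\pi^*\omega^\partial$, and it is symplectic. There is a unique vector field $Q^\partial$ on $\mathcal F^\partial$ to which $Q$ projects, and there are unique functions $S^\partial,T^\partial$ on $\mathcal F^\partial$ with $\underline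 S=\pi^*S^\partial$ and $\underline T=\pi^*T^\partial$. Moreover $\mathrm{gh}(\omega^\partial)=k$, $\mathrm{gh}(Q^\partial)=1$, $\mathrm{gh}(S^\partial)=k+1$, $\mathrm{gh}(T^\partial)=k+2$. (d) With $\{f,g\}:=X_f g$, $\iota_{X_f}\omega^\partial=\delta f$, the Poisson bracket induced by $\omega^\partial$, $$\iota_{Q^\partial}\omega^\partial=\delta S^\partial,\qquad \tfrac12\{S^\partial,S^\partial\}=\tfrac12L_{Q^\partial}S^\partial=T^\partial,\qquad \tfrac12\iota_{[Q^\partial,Q^\partial]}\omega^\partial=-\delta T^\partial,$$ $$\tfrac12\iota_Q\iota_Q\omega-T=\pi^*S^\partial,\qquad L_QT=-\pi^*T^\partial .$$ (e) If $\alpha^\partial$ is a $1$-form on $\mathcal F^\partial$ with $\underline\alpha=\pi^*\alpha^\partial$, then $\omega^\partial=\delta\alpha^\partial$ and $$\tfrac12L_QS=T+\pi^*\bigl(S^\partial-\tfrac12\iota_{Q^\partial}\alpha^\partial\bigr).$$ -/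

import Mathlib

open CategoryTheory TopologicalSpace Opposite
open scoped TensorProduct

universe u

noncomputable section

namespace BVBFV

/-! ### Superdomains -/

/-- The sign `(-1)^a` of a parity `a`. -/
def sgn (a : ZMod 2) : ℝ := if a = 0 then 1 else -1

/-- Smooth real functions on an open subset of `ℝ^m`. -/
def Smooth (m : ℕ) (D : Opens (Fin m → ℝ)) : Subalgebra ℝ (D → ℝ) where
  carrier := {f | ∃ g : (Fin m → ℝ) → ℝ, ContDiffOn ℝ (⊤ : ℕ∞) g D ∧ ∀ x : D, f x = g x}
  mul_mem' := by
    rintro f f' ⟨g, hg, h⟩ ⟨g', hg', h'⟩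
    exact ⟨g * g', hg.mul hg', fun x => by simp [h x, h' x]⟩
  add_mem' := by
    rintro f f' ⟨g, hg, h⟩ ⟨g', hg', h'⟩
    exact ⟨g + g', hg.add hg', fun x => by simp [h x, h' x]⟩
  algebraMap_mem' := fun r => ⟨fun _ => r, contDiffOn_const, fun _ => rfl⟩

/-- Pull-back of smooth functions along a coordinate projection `y ↦ y ∘ i`. -/
def Smooth.proj {m m' : ℕ} (i : Fin m' → Fin m) {D : Opens (Fin m → ℝ)} {D' : Opens (Fin m' → ℝ)}
    (h : ∀ y ∈ D, y ∘ i ∈ D') : Smooth m' D' →ₐ[ℝ] Smooth m D where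
  toFun f := ⟨fun y => f.1 ⟨y.1 ∘ i, h y.1 y.2⟩, by
    obtain ⟨g, hg, hfg⟩ := f.2
    refine ⟨fun y => g (y ∘ i), ?_, fun y => hfg _⟩
    refine hg.comp (ContDiff.contDiffOn ?_) (fun y hy => h y hy)
    exact contDiff_pi.2 fun k => contDiff_apply ℝ ℝ (i k)⟩
  map_one' := rfl
  map_mul' _ _ := rfl
  map_zero' := rfl
  map_add' _ _ := rfl
  commutes' _ := rfl

/-- Superfunctions on the superdomain of dimension `m|n` with body `D`:
`C^∞(D) ⊗ Λ(θ₁, …, θₙ)`. -/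
abbrev Model (m n : ℕ) (D : Opens (Fin m → ℝ)) : Type :=
  Smooth m D ⊗[ℝ] ExteriorAlgebra ℝ (Fin n → ℝ)

/-- Pull-back of superfunctions along the projection which keeps the even coordinates
`x (i k)` and the odd coordinates `θ (j l)`. -/
def Model.proj {m n m' n' : ℕ} (i : Fin m' → Fin m) (j : Fin n' → Fin n)
    {D : Opens (Fin m → ℝ)} {D' : Opens (Fin m' → ℝ)} (h : ∀ y ∈ D, y ∘ i ∈ D') :
    Model m' n' D' →ₐ[ℝ] Model m n D :=
  Algebra.TensorProduct.map (Smooth.proj i h)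
    (ExteriorAlgebra.map (Fintype.linearCombination ℝ fun l => Pi.single (j l) (1 : ℝ)))

/-- Restriction of superfunctions to a smaller superdomain. -/
def Model.res {m n : ℕ} {D D' : Opens (Fin m → ℝ)} (h : D ≤ D') :
    Model m n D' →ₐ[ℝ] Model m n D :=
  Algebra.TensorProduct.map (Smooth.proj id fun _ hy => h hy) (AlgHom.id ℝ _)

/-- The parity involution of a superdomain: `θ ↦ -θ`. -/
def Model.inv {m n : ℕ} (D : Opens (Fin m → ℝ)) : Model m n D →ₐ[ℝ] Model m n D :=
  Algebra.TensorProduct.map (AlgHom.id ℝ _) CliffordAlgebra.involute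

/-- The even coordinate `x_k` of a superdomain. -/
def Model.even {m n : ℕ} (D : Opens (Fin m → ℝ)) (k : Fin m) : Model m n D :=
  (⟨fun y => y.1 k, fun y => y k, (contDiff_apply ℝ ℝ k).contDiffOn, fun _ => rfl⟩ :
    Smooth m D) ⊗ₜ[ℝ] 1

/-- The odd coordinate `θ_l` of a superdomain. -/
def Model.odd {m n : ℕ} (D : Opens (Fin m → ℝ)) (l : Fin n) : Model m n D :=
  1 ⊗ₜ[ℝ] ExteriorAlgebra.ι ℝ (Pi.single l (1 : ℝ))

/-! ### Superspaces: sheaves of supercommutative algebras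

The parity is encoded by the involution `f ↦ (-1)^|f| f`. -/

/-- A topological space with a sheaf of supercommutative real algebras. -/
structure SuperSpace where
  carrier : Type u
  [top : TopologicalSpace carrier]
  sheaf : TopCat.Sheaf (AlgCat.{u} ℝ) (TopCat.of carrier)
  inv : sheaf.presheaf ⟶ sheaf.presheaf
  inv_inv : inv ≫ inv = 𝟙 _
  /-- Even functions are central. -/
  even_comm : ∀ (U : Opens carrier) (f g : sheaf.presheaf.obj (op U)),
    (inv.app (op U)).hom f = f → f * g = g * f
  /-- Odd functions supercommute with all functions. -/
  odd_comm : ∀ (U : Opens carrier) (f g : sheaf.presheaf.obj (op U)),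
    (inv.app (op U)).hom f = -f → f * g = (inv.app (op U)).hom g * f

attribute [instance] SuperSpace.top

namespace SuperSpace

/-- Superfunctions on an open subset. -/
abbrev Fun (F : SuperSpace.{u}) (U : Opens F.carrier) : Type u := F.sheaf.presheaf.obj (op U)

/-- Restriction of superfunctions. -/
def res (F : SuperSpace.{u}) {U V : Opens F.carrier} (h : U ≤ V) : F.Fun V →ₐ[ℝ] F.Fun U :=
  (F.sheaf.presheaf.map (homOfLE h).op).hom

/-- The parity involution on superfunctions. -/
def σ (F : SuperSpace.{u}) {U : Opens F.carrier} : F.Fun U →ₐ[ℝ] F.Fun U := (F.inv.app (op U)).hom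

/-- The `a`-th power of the parity involution, `f ↦ (-1)^(a|f|) f`. -/
def tw (F : SuperSpace.{u}) {U : Opens F.carrier} (a : ZMod 2) : F.Fun U →ₐ[ℝ] F.Fun U :=
  if a = 0 then AlgHom.id ℝ _ else F.σ

/-- `f` is homogeneous of parity `a`. -/
def IsPar (F : SuperSpace.{u}) {U : Opens F.carrier} (a : ZMod 2) (f : F.Fun U) : Prop :=
  F.σ f = sgn a • f

/-- `f` takes the value `0` at `x`: it is not invertible near `x`. -/
def VanishesAt (F : SuperSpace.{u}) {U : Opens F.carrier} (f : F.Fun U) (x : F.carrier) : Prop :=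
  ∀ (W : Opens F.carrier) (h : W ≤ U), x ∈ W → ¬ IsUnit (F.res h f)

end SuperSpace

/-- The image in `ℝ^m` of (the part in the domain of `φ` of) an open set. -/
def chartImage {X : Type u} [TopologicalSpace X] {m : ℕ} (φ : OpenPartialHomeomorph X (Fin m → ℝ))
    (W : Opens X) : Opens (Fin m → ℝ) :=
  ⟨φ.target ∩ φ.symm ⁻¹' W, φ.isOpen_inter_preimage_symm W.2⟩

theorem chartImage_mono {X : Type u} [TopologicalSpace X] {m : ℕ}
    (φ : OpenPartialHomeomorph X (Fin m → ℝ)) {W W' : Opens X} (h : W' ≤ W) :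
    chartImage φ W' ≤ chartImage φ W :=
  fun _ hy => ⟨hy.1, h hy.2⟩

/-- A chart: an isomorphism of an open subspace with a superdomain of dimension `m|n`. -/
structure Chart (F : SuperSpace.{u}) (m n : ℕ) where
  body : OpenPartialHomeomorph F.carrier (Fin m → ℝ)
  iso : ∀ W : Opens F.carrier, (W : Set F.carrier) ⊆ body.source →
    (F.Fun W ≃ₐ[ℝ] Model m n (chartImage body W))
  iso_res : ∀ (W W' : Opens F.carrier) (h : W' ≤ W) (hW : (W : Set F.carrier) ⊆ body.source)
    (f : F.Fun W), iso W' (subset_trans h hW) (F.res h f) =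
      Model.res (chartImage_mono body h) (iso W hW f)
  iso_inv : ∀ (W : Opens F.carrier) (hW : (W : Set F.carrier) ⊆ body.source)
    (f : F.Fun W), iso W hW (F.σ f) = Model.inv _ (iso W hW f)

namespace Chart

variable {F : SuperSpace.{u}} {m n : ℕ}

/-- The domain of a chart. -/
def dom (c : Chart F m n) : Opens F.carrier := ⟨c.body.source, c.body.open_source⟩

/-- The even coordinates of a chart. -/
def even (c : Chart F m n) (k : Fin m) : F.Fun c.dom :=
  (c.iso c.dom subset_rfl).symm (Model.even _ k)

/-- The odd coordinates of a chart. -/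
def odd (c : Chart F m n) (l : Fin n) : F.Fun c.dom :=
  (c.iso c.dom subset_rfl).symm (Model.odd _ l)

end Chart

/-! ### Signs -/

theorem parity_cases (a : ZMod 2) : a = 0 ∨ a = 1 := by
  revert a; decide

theorem sgn_zero : sgn 0 = 1 := if_pos rfl

theorem sgn_one : sgn 1 = -1 := if_neg one_ne_zero

theorem one_add_one_parity : (1 + 1 : ZMod 2) = 0 := rfl

theorem sgn_add (a b : ZMod 2) : sgn (a + b) = sgn a * sgn b := by
  rcases parity_cases a with rfl | rfl <;> rcases parity_cases b with rfl | rfl <;>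
    simp [sgn_zero, sgn_one, one_add_one_parity]

theorem sgn_mul_self (a : ZMod 2) : sgn a * sgn a = 1 := by
  rcases parity_cases a with rfl | rfl <;> simp [sgn_zero, sgn_one]

namespace SuperSpace

variable {F : SuperSpace.{u}} {U V : Opens F.carrier}

theorem σ_σ (f : F.Fun U) : F.σ (F.σ f) = f := by
  have h := congrArg (fun t => (t.app (op U)).hom f) F.inv_inv
  exact h

theorem res_σ (h : U ≤ V) (f : F.Fun V) : F.res h (F.σ f) = F.σ (F.res h f) := by
  have h' := congrArg (fun t => t.hom f) (F.inv.naturality (homOfLE h).op)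
  exact h'.symm

theorem res_res {W : Opens F.carrier} (h : U ≤ V) (h' : V ≤ W) (f : F.Fun W) :
    F.res h (F.res h' f) = F.res (h.trans h') f := by
  simp only [SuperSpace.res]
  rw [← AlgHom.comp_apply, ← AlgCat.hom_comp, ← Functor.map_comp]
  rfl

theorem tw_zero (f : F.Fun U) : F.tw 0 f = f := rfl

theorem tw_one (f : F.Fun U) : F.tw 1 f = F.σ f := rfl

theorem mul_comm_of_isPar {a : ZMod 2} {f : F.Fun U} (hf : F.IsPar a f) (g : F.Fun U) :
    f * g = F.tw a g * f := by
  rcases parity_cases a with rfl | rfl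
  · exact F.even_comm U f g (hf.trans (by rw [sgn_zero, one_smul]))
  · exact F.odd_comm U f g (hf.trans (by rw [sgn_one, neg_smul, one_smul]))

theorem IsPar.res {a : ZMod 2} {f : F.Fun V} (hf : F.IsPar a f) (h : U ≤ V) :
    F.IsPar a (F.res h f) := by
  unfold IsPar at *
  rw [← res_σ, hf, map_smul]

end SuperSpace

/-! ### Vector fields -/

/-- The space of superderivations of parity `a` of the structure sheaf over `U`. -/
def vfSubmodule (F : SuperSpace.{u}) (U : Opens F.carrier) (a : ZMod 2) :
    Submodule ℝ (∀ W : Set.Iic U, Module.End ℝ (F.Fun W.1)) where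
  carrier := {D |
    (∀ (W W' : Opens F.carrier) (hW : W ≤ U) (h : W' ≤ W) (f : F.Fun W),
      D ⟨W', h.trans hW⟩ (F.res h f) = F.res h (D ⟨W, hW⟩ f)) ∧
    (∀ (W : Opens F.carrier) (hW : W ≤ U) (f : F.Fun W),
      D ⟨W, hW⟩ (F.σ f) = sgn a • F.σ (D ⟨W, hW⟩ f)) ∧
    (∀ (W : Opens F.carrier) (hW : W ≤ U) (f g : F.Fun W),
      D ⟨W, hW⟩ (f * g) = D ⟨W, hW⟩ f * g + F.tw a f * D ⟨W, hW⟩ g)}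
  add_mem' := by
    rintro D D' ⟨h1, h2, h3⟩ ⟨h1', h2', h3'⟩
    refine ⟨fun W W' hW h f => ?_, fun W hW f => ?_, fun W hW f g => ?_⟩
    · simp [h1 W W' hW h, h1' W W' hW h]
    · simp [h2 W hW, h2' W hW]
    · simp only [Pi.add_apply, LinearMap.add_apply, h3 W hW, h3' W hW]
      noncomm_ring
  zero_mem' := ⟨fun _ _ _ _ _ => by simp, fun _ _ _ => by simp, fun _ _ _ _ => by simp⟩
  smul_mem' := by
    rintro r D ⟨h1, h2, h3⟩
    refine ⟨fun W W' hW h f => ?_, fun W hW f => ?_, fun W hW f g => ?_⟩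
    · simp [h1 W W' hW h]
    · simp [h2 W hW, smul_comm r]
    · simp [h3 W hW, smul_add]

/-- Vector fields of parity `a` on `U`. -/
def VF (F : SuperSpace.{u}) (U : Opens F.carrier) (a : ZMod 2) : Type u := vfSubmodule F U a

instance {F : SuperSpace.{u}} {U : Opens F.carrier} {a : ZMod 2} : AddCommGroup (VF F U a) :=
  inferInstanceAs (AddCommGroup (vfSubmodule F U a))

instance {F : SuperSpace.{u}} {U : Opens F.carrier} {a : ZMod 2} : Module ℝ (VF F U a) :=
  inferInstanceAs (Module ℝ (vfSubmodule F U a))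

namespace VF

variable {F : SuperSpace.{u}} {U V W : Opens F.carrier} {a b : ZMod 2}

/-- The action of a vector field on functions over a smaller open set. -/
def app (X : VF F U a) (h : W ≤ U) : F.Fun W →ₗ[ℝ] F.Fun W := X.1 ⟨W, h⟩

theorem app_res (X : VF F U a) (hW : W ≤ U) (h : V ≤ W) (f : F.Fun W) :
    X.app (h.trans hW) (F.res h f) = F.res h (X.app hW f) := X.2.1 W V hW h f

theorem app_σ (X : VF F U a) (hW : W ≤ U) (f : F.Fun W) :
    X.app hW (F.σ f) = sgn a • F.σ (X.app hW f) := X.2.2.1 W hW f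

theorem app_tw (X : VF F U a) (hW : W ≤ U) (f : F.Fun W) :
    X.app hW (F.tw b f) = sgn (a * b) • F.tw b (X.app hW f) := by
  rcases parity_cases b with rfl | rfl
  · simp [SuperSpace.tw_zero, sgn_zero]
  · simp [SuperSpace.tw_one, app_σ]

theorem app_mul (X : VF F U a) (hW : W ≤ U) (f g : F.Fun W) :
    X.app hW (f * g) = X.app hW f * g + F.tw a f * X.app hW g := X.2.2.2 W hW f g

/-- Restriction of vector fields. -/
def res (h : V ≤ U) : VF F U a →ₗ[ℝ] VF F V a where
  toFun X := ⟨fun W => X.1 ⟨W.1, W.2.trans h⟩, fun W W' hW h' f => X.2.1 W W' (hW.trans h) h' f,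
    fun W hW f => X.2.2.1 W (hW.trans h) f, fun W hW f g => X.2.2.2 W (hW.trans h) f g⟩
  map_add' _ _ := rfl
  map_smul' _ _ := rfl

/-- The supercommutator `[X, Y] = XY - (-1)^(|X||Y|) YX`. -/
def bracket (X : VF F U a) (Y : VF F U b) : VF F U (a + b) :=
  ⟨fun W => X.app W.2 ∘ₗ Y.app W.2 - sgn (a * b) • (Y.app W.2 ∘ₗ X.app W.2), by
    refine ⟨fun W W' hW h f => ?_, fun W hW f => ?_, fun W hW f g => ?_⟩
    · change X.app (h.trans hW) (Y.app (h.trans hW) (F.res h f)) -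
        sgn (a * b) • Y.app (h.trans hW) (X.app (h.trans hW) (F.res h f)) =
        F.res h (X.app hW (Y.app hW f) - sgn (a * b) • Y.app hW (X.app hW f))
      rw [app_res Y hW h, app_res X hW h, app_res X hW h, app_res Y hW h, map_sub, map_smul]
    · change X.app hW (Y.app hW (F.σ f)) - sgn (a * b) • Y.app hW (X.app hW (F.σ f)) =
        sgn (a + b) • F.σ (X.app hW (Y.app hW f) - sgn (a * b) • Y.app hW (X.app hW f))
      simp only [app_σ, map_smul, map_sub, sgn_add, smul_sub, smul_smul]
      congr 2 <;> ring
    · change X.app hW (Y.app hW (f * g)) - sgn (a * b) • Y.app hW (X.app hW (f * g)) =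
        (X.app hW (Y.app hW f) - sgn (a * b) • Y.app hW (X.app hW f)) * g +
        F.tw (a + b) f * (X.app hW (Y.app hW g) - sgn (a * b) • Y.app hW (X.app hW g))
      simp only [app_mul, map_add, app_tw]
      rcases parity_cases a with rfl | rfl <;> rcases parity_cases b with rfl | rfl <;>
        simp only [SuperSpace.tw_zero, SuperSpace.tw_one, sgn_zero, sgn_one, one_add_one_parity,
          mul_zero, mul_one, add_zero, zero_add, one_smul, neg_smul, SuperSpace.σ_σ] <;>
        noncomm_ring⟩

/-- The product of a homogeneous function and a vector field. -/
def smul (f : F.Fun U) (hf : F.IsPar b f) (X : VF F U a) : VF F U (b + a) :=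
  ⟨fun W => LinearMap.mulLeft ℝ (F.res W.2 f) ∘ₗ X.app W.2, by
    refine ⟨fun W W' hW h g => ?_, fun W hW g => ?_, fun W hW g k => ?_⟩
    · change F.res (h.trans hW) f * X.app (h.trans hW) (F.res h g) =
        F.res h (F.res hW f * X.app hW g)
      rw [app_res X hW h, map_mul, SuperSpace.res_res]
    · change F.res hW f * X.app hW (F.σ g) = sgn (b + a) • F.σ (F.res hW f * X.app hW g)
      have h : F.σ (F.res hW f) = sgn b • F.res hW f := hf.res hW
      simp only [app_σ, map_mul, h, sgn_add, smul_mul_assoc, mul_smul_comm, smul_smul]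
      rw [mul_right_comm, sgn_mul_self, one_mul]
    · change F.res hW f * X.app hW (g * k) =
        F.res hW f * X.app hW g * k + F.tw (b + a) g * (F.res hW f * X.app hW k)
      have h := SuperSpace.mul_comm_of_isPar (hf.res hW) (F.tw a g)
      have h' : F.tw b (F.tw a g) = F.tw (b + a) g := by
        rcases parity_cases a with rfl | rfl <;> rcases parity_cases b with rfl | rfl <;>
          simp [SuperSpace.tw_zero, SuperSpace.tw_one, one_add_one_parity, SuperSpace.σ_σ]
      simp only [app_mul, mul_add, ← mul_assoc, h, h']⟩

/-- Transport along an equality of parities. -/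
def cast (h : a = b) (X : VF F U a) : VF F U b := h ▸ X

theorem cast_app (h : a = b) (X : VF F U a) (hW : W ≤ U) (f : F.Fun W) :
    (X.cast h).app hW f = X.app hW f := by subst h; rfl

theorem ext {X Y : VF F U a}
    (h : ∀ (W : Opens F.carrier) (hW : W ≤ U) (f : F.Fun W), X.app hW f = Y.app hW f) : X = Y :=
  Subtype.ext (funext fun W => LinearMap.ext fun f => h W.1 W.2 f)

theorem add_app (X Y : VF F U a) (hW : W ≤ U) (f : F.Fun W) :
    (X + Y).app hW f = X.app hW f + Y.app hW f := rfl

theorem smul_app (r : ℝ) (X : VF F U a) (hW : W ≤ U) (f : F.Fun W) :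
    (r • X).app hW f = r • X.app hW f := rfl

theorem bracket_app (X : VF F U a) (Y : VF F U b) (hW : W ≤ U) (f : F.Fun W) :
    (X.bracket Y).app hW f = X.app hW (Y.app hW f) - sgn (a * b) • Y.app hW (X.app hW f) := rfl

theorem fsmul_app (f : F.Fun U) (hf : F.IsPar b f) (X : VF F U a) (hW : W ≤ U) (g : F.Fun W) :
    (X.smul f hf).app hW g = F.res hW f * X.app hW g := rfl

theorem isPar_app {f : F.Fun W} (hf : F.IsPar b f) (X : VF F U a) (hW : W ≤ U) :
    F.IsPar (a + b) (X.app hW f) := by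
  have h := X.app_σ hW f
  rw [hf, map_smul] at h
  unfold SuperSpace.IsPar
  rw [sgn_add, mul_smul, h, smul_smul, sgn_mul_self, one_smul]

theorem tw_of_isPar {f : F.Fun W} (hf : F.IsPar b f) : F.tw a f = sgn (a * b) • f := by
  rcases parity_cases a with rfl | rfl
  · simp [SuperSpace.tw_zero, sgn_zero]
  · rw [SuperSpace.tw_one, one_mul]; exact hf

end VF

/-! ### Differential forms

Forms of degree `1` and `2` are given by their contractions with vector fields; a `2`-form `ω` is
encoded by the functions `ω(X, Y) = ι_X ι_Y ω`. The operator `ι_X` has total parity `|X| + 1`, the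
de Rham differential is odd, and all operators act from the left, so that
`ι_{fX} = f ι_X`, `ι_X ι_Y = (-1)^((|X|+1)(|Y|+1)) ι_Y ι_X` and
`L_X = ι_X δ + (-1)^|X| δ ι_X`. -/

/-- The space of `1`-forms on `U`: compatible families of `𝒪`-linear maps on vector fields. -/
def form1Submodule (F : SuperSpace.{u}) (U : Opens F.carrier) :
    Submodule ℝ (∀ (W : Set.Iic U) (a : ZMod 2), VF F W.1 a →ₗ[ℝ] F.Fun W.1) where
  carrier := {α |
    (∀ (W W' : Opens F.carrier) (hW : W ≤ U) (h : W' ≤ W) (a : ZMod 2) (X : VF F W a),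
      α ⟨W', h.trans hW⟩ a (VF.res h X) = F.res h (α ⟨W, hW⟩ a X)) ∧
    (∀ (W : Opens F.carrier) (hW : W ≤ U) (a b : ZMod 2) (f : F.Fun W) (hf : F.IsPar b f)
      (X : VF F W a), α ⟨W, hW⟩ (b + a) (X.smul f hf) = f * α ⟨W, hW⟩ a X)}
  add_mem' := by
    rintro α β ⟨h1, h2⟩ ⟨h1', h2'⟩
    refine ⟨fun W W' hW h a X => ?_, fun W hW a b f hf X => ?_⟩
    · simp [h1 W W' hW h, h1' W W' hW h]
    · simp [h2 W hW, h2' W hW, mul_add]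
  zero_mem' := ⟨fun _ _ _ _ _ _ => by simp, fun _ _ _ _ _ _ _ => by simp⟩
  smul_mem' := by
    rintro r α ⟨h1, h2⟩
    refine ⟨fun W W' hW h a X => ?_, fun W hW a b f hf X => ?_⟩
    · simp [h1 W W' hW h]
    · simp [h2 W hW]

/-- `1`-forms on `U`. -/
def Form1 (F : SuperSpace.{u}) (U : Opens F.carrier) : Type u := form1Submodule F U

instance {F : SuperSpace.{u}} {U : Opens F.carrier} : AddCommGroup (Form1 F U) :=
  inferInstanceAs (AddCommGroup (form1Submodule F U))

instance {F : SuperSpace.{u}} {U : Opens F.carrier} : Module ℝ (Form1 F U) :=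
  inferInstanceAs (Module ℝ (form1Submodule F U))

/-- The space of `2`-forms on `U`: compatible families of graded symmetric maps on pairs of vector
fields which are `𝒪`-linear in the first argument. -/
def form2Submodule (F : SuperSpace.{u}) (U : Opens F.carrier) :
    Submodule ℝ (∀ (W : Set.Iic U) (a b : ZMod 2),
      VF F W.1 a →ₗ[ℝ] VF F W.1 b →ₗ[ℝ] F.Fun W.1) where
  carrier := {ω |
    (∀ (W W' : Opens F.carrier) (hW : W ≤ U) (h : W' ≤ W) (a b : ZMod 2) (X : VF F W a)
      (Y : VF F W b),
      ω ⟨W', h.trans hW⟩ a b (VF.res h X) (VF.res h Y) = F.res h (ω ⟨W, hW⟩ a b X Y)) ∧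
    (∀ (W : Opens F.carrier) (hW : W ≤ U) (a b c : ZMod 2) (f : F.Fun W) (hf : F.IsPar c f)
      (X : VF F W a) (Y : VF F W b),
      ω ⟨W, hW⟩ (c + a) b (X.smul f hf) Y = f * ω ⟨W, hW⟩ a b X Y) ∧
    (∀ (W : Opens F.carrier) (hW : W ≤ U) (a b : ZMod 2) (X : VF F W a) (Y : VF F W b),
      ω ⟨W, hW⟩ b a Y X = sgn ((a + 1) * (b + 1)) • ω ⟨W, hW⟩ a b X Y)}
  add_mem' := by
    rintro α β ⟨h1, h2, h3⟩ ⟨h1', h2', h3'⟩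
    refine ⟨fun W W' hW h a b X Y => ?_, fun W hW a b c f hf X Y => ?_, fun W hW a b X Y => ?_⟩
    · simp [h1 W W' hW h, h1' W W' hW h]
    · simp [h2 W hW, h2' W hW, mul_add]
    · simp [h3 W hW a b X Y, h3' W hW a b X Y, smul_add]
  zero_mem' := ⟨fun _ _ _ _ _ _ _ _ => by simp, fun _ _ _ _ _ _ _ _ _ => by simp,
    fun _ _ _ _ _ _ => by simp⟩
  smul_mem' := by
    rintro r α ⟨h1, h2, h3⟩
    refine ⟨fun W W' hW h a b X Y => ?_, fun W hW a b c f hf X Y => ?_, fun W hW a b X Y => ?_⟩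
    · simp [h1 W W' hW h]
    · simp [h2 W hW]
    · simp [h3 W hW a b X Y, smul_comm r]

/-- `2`-forms on `U`. -/
def Form2 (F : SuperSpace.{u}) (U : Opens F.carrier) : Type u := form2Submodule F U

instance {F : SuperSpace.{u}} {U : Opens F.carrier} : AddCommGroup (Form2 F U) :=
  Module.addCommMonoidToAddCommGroup ℝ (M := form2Submodule F U)

instance {F : SuperSpace.{u}} {U : Opens F.carrier} : Module ℝ (Form2 F U) :=
  inferInstanceAs (Module ℝ (form2Submodule F U))

section Forms

variable {F : SuperSpace.{u}} {U V W : Opens F.carrier} {a b c : ZMod 2}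

/-- The contraction `ι_X α` over an open subset. -/
def Form1.app (α : Form1 F U) (h : W ≤ U) : VF F W a →ₗ[ℝ] F.Fun W := α.1 ⟨W, h⟩ a

/-- The double contraction `ω(X, Y) = ι_X ι_Y ω` over an open subset. -/
def Form2.app (ω : Form2 F U) (h : W ≤ U) : VF F W a →ₗ[ℝ] VF F W b →ₗ[ℝ] F.Fun W :=
  ω.1 ⟨W, h⟩ a b

theorem Form1.app_res (α : Form1 F U) (hW : W ≤ U) (h : V ≤ W) (X : VF F W a) :
    α.app (h.trans hW) (VF.res h X) = F.res h (α.app hW X) := α.2.1 W V hW h a X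

theorem Form1.app_smul (α : Form1 F U) (hW : W ≤ U) (f : F.Fun W) (hf : F.IsPar b f)
    (X : VF F W a) : α.app hW (X.smul f hf) = f * α.app hW X := α.2.2 W hW a b f hf X

theorem Form1.app_cast (α : Form1 F U) (hW : W ≤ U) (h : a = b) (X : VF F W a) :
    α.app hW (X.cast h) = α.app hW X := by subst h; rfl

/-- Restriction of `1`-forms. -/
def Form1.res (h : V ≤ U) (α : Form1 F U) : Form1 F V :=
  ⟨fun W => α.1 ⟨W.1, W.2.trans h⟩, fun W W' hW => α.2.1 W W' (hW.trans h),
    fun W hW => α.2.2 W (hW.trans h)⟩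

/-- Restriction of `2`-forms. -/
def Form2.res (h : V ≤ U) (ω : Form2 F U) : Form2 F V :=
  ⟨fun W => ω.1 ⟨W.1, W.2.trans h⟩, fun W W' hW => ω.2.1 W W' (hW.trans h),
    fun W hW => ω.2.2.1 W (hW.trans h), fun W hW => ω.2.2.2 W (hW.trans h)⟩

/-- The contraction `ι_X α` of a `1`-form. -/
def contract1 (X : VF F U a) (α : Form1 F U) : F.Fun U := α.app le_rfl X

/-- The contraction `ι_X ω` of a `2`-form, `ι_Z (ι_X ω) = ω(Z, X)`. -/
def contract2 (X : VF F U a) (ω : Form2 F U) : Form1 F U :=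
  ⟨fun W b => (ω.1 W b a).flip (VF.res W.2 X),
    fun W W' hW h b Z => ω.2.1 W W' hW h b a Z (VF.res hW X),
    fun W hW b c f hf Z => ω.2.2.1 W hW b a c f hf Z (VF.res hW X)⟩

/-- The differential of a function, `ι_X δf = X f`. -/
def d0 (f : F.Fun U) : Form1 F U :=
  ⟨fun W a =>
    { toFun := fun X => X.app le_rfl (F.res W.2 f)
      map_add' := fun _ _ => rfl
      map_smul' := fun _ _ => rfl }, by
    refine ⟨fun W W' hW h a X => ?_, fun W hW a b g hg X => ?_⟩
    · change X.app h (F.res (h.trans hW) f) = F.res h (X.app le_rfl (F.res hW f))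
      rw [← X.app_res le_rfl h, SuperSpace.res_res]
    · change F.res le_rfl g * _ = g * _
      congr 1
      exact congrArg (fun t => t.hom g) (F.sheaf.presheaf.map_id (op W))⟩

theorem VF.bracket_smul (Y : VF F U b) (f : F.Fun U) (hf : F.IsPar c f) (X : VF F U a) :
    Y.bracket (X.smul f hf) =
      (X.smul (Y.app le_rfl f) (VF.isPar_app hf Y le_rfl)).cast (add_assoc b c a) +
      (sgn (b * c) • (Y.bracket X).smul f hf).cast (add_left_comm c b a) := by
  refine VF.ext fun W hW g => ?_
  rw [VF.bracket_app, VF.add_app, VF.cast_app, VF.cast_app, VF.smul_app, VF.fsmul_app,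
    VF.fsmul_app, VF.fsmul_app, VF.fsmul_app, VF.bracket_app, VF.app_mul,
    VF.tw_of_isPar (hf.res hW), ← Y.app_res le_rfl hW, mul_add, sgn_add]
  simp only [mul_sub, smul_sub, smul_mul_assoc, mul_smul_comm, smul_smul]
  abel

theorem VF.bracket_comm (X : VF F U a) (Y : VF F U b) :
    X.bracket Y = (-sgn (a * b) • Y.bracket X).cast (add_comm b a) := by
  refine VF.ext fun W hW g => ?_
  rw [VF.cast_app, VF.smul_app, VF.bracket_app, VF.bracket_app, mul_comm b a, smul_sub, smul_smul,
    neg_mul, sgn_mul_self]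
  simp only [neg_smul, one_smul]
  abel

theorem VF.bracket_add (Y : VF F U b) (X X' : VF F U a) :
    Y.bracket (X + X') = Y.bracket X + Y.bracket X' := by
  refine VF.ext fun W hW g => ?_
  simp only [VF.bracket_app, VF.add_app, map_add, smul_add]
  abel

theorem VF.add_bracket (Y Y' : VF F U b) (X : VF F U a) :
    (Y + Y').bracket X = Y.bracket X + Y'.bracket X := by
  refine VF.ext fun W hW g => ?_
  simp only [VF.bracket_app, VF.add_app, map_add, smul_add]
  abel

theorem VF.bracket_rsmul (r : ℝ) (Y : VF F U b) (X : VF F U a) :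
    Y.bracket (r • X) = r • Y.bracket X := by
  refine VF.ext fun W hW g => ?_
  simp only [VF.bracket_app, VF.smul_app, map_smul, smul_sub, smul_comm r]

theorem VF.rsmul_bracket (r : ℝ) (Y : VF F U b) (X : VF F U a) :
    (r • Y).bracket X = r • Y.bracket X := by
  refine VF.ext fun W hW g => ?_
  simp only [VF.bracket_app, VF.smul_app, map_smul, smul_sub, smul_comm r]

/-- The differential of a `1`-form,
`ι_X ι_Y δα = (-1)^(|Y|(|X|+1)) (Y α(X) - α([Y, X])) - (-1)^|Y| X α(Y)`, which is what
`ι_Y δ = L_Y - (-1)^|Y| δ ι_Y` and `[L_Y, ι_X] = ι_[Y, X]` give. -/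
def d1 (α : Form1 F U) : Form2 F U :=
  ⟨fun W a b => LinearMap.mk₂ ℝ
      (fun X Y => sgn (b * (a + 1)) • (Y.app le_rfl (α.app W.2 X) - α.app W.2 (Y.bracket X)) -
        sgn b • X.app le_rfl (α.app W.2 Y))
      (fun X X' Y => by
        simp only [VF.bracket_add, map_add, VF.add_app, smul_sub, smul_add]; abel)
      (fun r X Y => by
        simp only [VF.bracket_rsmul, map_smul, VF.smul_app, smul_sub, smul_comm r])
      (fun X Y Y' => by
        simp only [VF.add_bracket, map_add, VF.add_app, smul_sub, smul_add]; abel)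
      (fun r X Y => by
        simp only [VF.rsmul_bracket, map_smul, VF.smul_app, smul_sub, smul_comm r]), by
    refine ⟨fun W W' hW h a b X Y => ?_, fun W hW a b c f hf X Y => ?_, fun W hW a b X Y => ?_⟩
    · change sgn (b * (a + 1)) • (Y.app h (α.app (h.trans hW) (VF.res h X)) -
          α.app (h.trans hW) (VF.res h (Y.bracket X))) -
          sgn b • X.app h (α.app (h.trans hW) (VF.res h Y)) =
        F.res h (sgn (b * (a + 1)) • (Y.app le_rfl (α.app hW X) - α.app hW (Y.bracket X)) -
          sgn b • X.app le_rfl (α.app hW Y))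
      rw [α.app_res hW h, α.app_res hW h, α.app_res hW h, Y.app_res le_rfl h, X.app_res le_rfl h]
      simp only [map_sub, map_smul]
    · change sgn (b * (c + a + 1)) • (Y.app le_rfl (α.app hW (X.smul f hf)) -
          α.app hW (Y.bracket (X.smul f hf))) -
          sgn b • (F.res le_rfl f * X.app le_rfl (α.app hW Y)) =
        f * (sgn (b * (a + 1)) • (Y.app le_rfl (α.app hW X) - α.app hW (Y.bracket X)) -
          sgn b • X.app le_rfl (α.app hW Y))
      have hid : F.res le_rfl f = f :=
        congrArg (fun t => t.hom f) (F.sheaf.presheaf.map_id (op W))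
      have hs : sgn (b * (c + a + 1)) = sgn (b * (a + 1)) * sgn (b * c) := by
        rw [← sgn_add]; congr 1; ring
      rw [hid, VF.bracket_smul, map_add, α.app_cast, α.app_cast, map_smul, α.app_smul, α.app_smul,
        α.app_smul, VF.app_mul, VF.tw_of_isPar hf, hs]
      simp only [mul_sub, smul_sub, smul_add, smul_mul_assoc, mul_smul_comm, smul_smul]
      rw [mul_assoc, sgn_mul_self, mul_one]
      abel
    · change sgn (a * (b + 1)) • (X.app le_rfl (α.app hW Y) - α.app hW (X.bracket Y)) -
          sgn a • Y.app le_rfl (α.app hW X) =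
        sgn ((a + 1) * (b + 1)) •
          (sgn (b * (a + 1)) • (Y.app le_rfl (α.app hW X) - α.app hW (Y.bracket X)) -
          sgn b • X.app le_rfl (α.app hW Y))
      rw [VF.bracket_comm X Y, α.app_cast, map_smul]
      rcases parity_cases a with rfl | rfl <;> rcases parity_cases b with rfl | rfl <;>
        simp only [sgn_zero, sgn_one, one_add_one_parity, mul_zero, mul_one, zero_add, one_smul,
          neg_smul] <;>
        abel⟩

end Forms

/-! ### Lie derivatives, closed forms and degrees -/

section Lie

variable {F : SuperSpace.{u}} {U W : Opens F.carrier} {a b c : ZMod 2}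

/-- `ω` is homogeneous of parity `e`: `ω(X, Y)` has parity `e + |X| + |Y|`. -/
def Form2.HasParity (e : ZMod 2) (ω : Form2 F U) : Prop :=
  ∀ (W : Opens F.carrier) (h : W ≤ U) (a b : ZMod 2) (X : VF F W a) (Y : VF F W b),
    F.IsPar (e + a + b) (ω.app h X Y)

/-- The Lie derivative of a `2`-form, `ι_X ι_Y L_Z ω`, determined by
`ι_X L_Z = (-1)^(|Z|(|X|+1)) (L_Z ι_X - ι_[Z, X])`. -/
def lie2 (Z : VF F U c) (ω : Form2 F U) (h : W ≤ U) (X : VF F W a) (Y : VF F W b) : F.Fun W :=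
  sgn (c * (a + b)) • (Z.app h (ω.app h X Y) - ω.app h ((VF.res h Z).bracket X) Y) -
    sgn (c * (b + 1)) • ω.app h X ((VF.res h Z).bracket Y)

/-- `δω = 0`, where `ι_Z δω = L_Z ω - (-1)^|Z| δ ι_Z ω`. -/
def Form2.IsClosed (ω : Form2 F U) : Prop :=
  ∀ (W : Opens F.carrier) (h : W ≤ U) (a b c : ZMod 2) (X : VF F W a) (Y : VF F W b)
    (Z : VF F W c),
    lie2 Z (ω.res h) le_rfl X Y = sgn c • (d1 (contract2 Z (ω.res h))).app le_rfl X Y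

/-- A vector field `X` has degree `d` with respect to the Euler vector field `E`. -/
def VFHasDegree (E : VF F ⊤ 0) (d : ℤ) (X : VF F ⊤ a) : Prop :=
  ∀ (W : Opens F.carrier) (f : F.Fun W),
    (E.bracket X).app le_top f = (d : ℝ) • X.app le_top f

/-- A function `f` has degree `d` with respect to the Euler vector field `E`. -/
def FunHasDegree (E : VF F ⊤ 0) (d : ℤ) (f : F.Fun ⊤) : Prop := E.app le_rfl f = (d : ℝ) • f

/-- A `2`-form has degree `d` with respect to the Euler vector field `E`: `L_E ω = d ω`. -/
def Form2.HasDegree (E : VF F ⊤ 0) (d : ℤ) (ω : Form2 F ⊤) : Prop :=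
  ∀ (W : Opens F.carrier) (a b : ZMod 2) (X : VF F W a) (Y : VF F W b),
    lie2 E ω le_top X Y = (d : ℝ) • ω.app le_top X Y

end Lie

/-! ### Symplectic forms and Poisson brackets -/

section Symplectic

variable {F : SuperSpace.{u}}

/-- A symplectic form: a closed `2`-form such that `Y ↦ ι_Y ω` is an isomorphism from vector
fields (sums of an even and an odd one) to `1`-forms. -/
structure IsSymplectic (ω : Form2 F ⊤) : Prop where
  closed : ω.IsClosed
  nondegenerate : ∀ (V : Opens F.carrier) (β : Form1 F V), ∃! Y : VF F V 0 × VF F V 1,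
    contract2 Y.1 (ω.res le_top) + contract2 Y.2 (ω.res le_top) = β

/-- The Hamiltonian vector field `X_f`, with `ι_{X_f} ω = δf`, as the pair of its even and its odd
part. -/
def hamiltonian {ω : Form2 F ⊤} (hω : IsSymplectic ω) (f : F.Fun ⊤) : VF F ⊤ 0 × VF F ⊤ 1 :=
  (hω.nondegenerate ⊤ (d0 f)).exists.choose

/-- The Poisson bracket `{f, g} = X_f g`. -/
def poisson {ω : Form2 F ⊤} (hω : IsSymplectic ω) (f g : F.Fun ⊤) : F.Fun ⊤ :=
  (hamiltonian hω f).1.app le_rfl g + (hamiltonian hω f).2.app le_rfl g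

end Symplectic

/-! ### Graded supermanifolds -/

/-- A `ℤ`-graded supermanifold: a Hausdorff, second countable superspace with an even (Euler)
vector field `E` such that near each point there is a chart whose coordinates are homogeneous,
`E x_k = w_k x_k` and `E θ_l = v_l θ_l` with integers `w_k`, `v_l`. -/
structure GradedSupermanifold extends SuperSpace.{u} where
  [t2 : T2Space carrier]
  [secondCountable : SecondCountableTopology carrier]
  euler : VF toSuperSpace ⊤ 0
  exists_chart : ∀ x : carrier, ∃ (m n : ℕ) (c : Chart toSuperSpace m n), x ∈ c.dom ∧
    (∃ w : Fin m → ℤ, ∀ k, euler.app le_top (c.even k) = (w k : ℝ) • c.even k) ∧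
    (∃ v : Fin n → ℤ, ∀ l, euler.app le_top (c.odd l) = (v l : ℝ) • c.odd l)

/-- Morphisms of graded supermanifolds: continuous maps with a compatible pull-back of
superfunctions which preserves parity and degree. -/
structure Hom (F G : GradedSupermanifold.{u}) where
  base : C(F.carrier, G.carrier)
  comap : ∀ V : Opens G.carrier, G.Fun V →ₐ[ℝ] F.Fun (Opens.comap base V)
  comap_res : ∀ (V V' : Opens G.carrier) (h : V' ≤ V) (g : G.Fun V),
    comap V' (G.res h g) = F.res (Opens.comap_mono base h) (comap V g)
  comap_σ : ∀ (V : Opens G.carrier) (g : G.Fun V), comap V (G.σ g) = F.σ (comap V g)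
  comap_euler : ∀ (V : Opens G.carrier) (g : G.Fun V),
    comap V (G.euler.app le_top g) = F.euler.app le_top (comap V g)

namespace Hom

variable {F G : GradedSupermanifold.{u}} (π : Hom F G)

/-- Pull-back of superfunctions, `g ↦ π^* g`, restricted to `U ⊆ π⁻¹(V)`. -/
def pull {U : Opens F.carrier} {V : Opens G.carrier} (h : U ≤ Opens.comap π.base V) :
    G.Fun V →ₐ[ℝ] F.Fun U := (F.res h).comp (π.comap V)

/-- Pull-back of global superfunctions. -/
def pullTop : G.Fun ⊤ →ₐ[ℝ] F.Fun ⊤ := π.pull (U := ⊤) (V := ⊤) (fun _ _ => trivial)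

/-- `X` is projectable to `Y`: `X (π^* g) = π^* (Y g)` for all local functions `g`. -/
def Related {U : Opens F.carrier} {V : Opens G.carrier} (_h : U ≤ Opens.comap π.base V)
    {a : ZMod 2} (X : VF F.toSuperSpace U a) (Y : VF G.toSuperSpace V a) : Prop :=
  ∀ (U' : Opens F.carrier) (V' : Opens G.carrier) (hU : U' ≤ U) (hV : V' ≤ V)
    (h' : U' ≤ Opens.comap π.base V') (g : G.Fun V'),
    X.app hU (π.pull h' g) = π.pull h' (Y.app hV g)

/-- `X` is vertical: `X (π^* g) = 0` for all local functions `g`. -/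
def IsVertical {U : Opens F.carrier} {a : ZMod 2} (X : VF F.toSuperSpace U a) : Prop :=
  ∀ (U' : Opens F.carrier) (V' : Opens G.carrier) (hU : U' ≤ U)
    (h' : U' ≤ Opens.comap π.base V') (g : G.Fun V'), X.app hU (π.pull h' g) = 0

/-- `α = π^* β` for `1`-forms, along a submersion `π`: `ι_X α = π^* (ι_Y β)` for all local vector
fields `X` which project to `Y`. (Locally these `X` generate all vector fields.) -/
def IsPullback1 (β : Form1 G.toSuperSpace ⊤) (α : Form1 F.toSuperSpace ⊤) : Prop :=
  ∀ (U : Opens F.carrier) (V : Opens G.carrier) (h : U ≤ Opens.comap π.base V) (a : ZMod 2)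
    (X : VF F.toSuperSpace U a) (Y : VF G.toSuperSpace V a), π.Related h X Y →
    α.app le_top X = π.pull h (β.app le_top Y)

/-- `ω = π^* β` for `2`-forms, along a submersion `π`: `ω(X, X') = π^* (β(Y, Y'))` for all local
vector fields `X`, `X'` which project to `Y`, `Y'`. -/
def IsPullback2 (β : Form2 G.toSuperSpace ⊤) (ω : Form2 F.toSuperSpace ⊤) : Prop :=
  ∀ (U : Opens F.carrier) (V : Opens G.carrier) (h : U ≤ Opens.comap π.base V) (a b : ZMod 2)
    (X : VF F.toSuperSpace U a) (X' : VF F.toSuperSpace U b)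
    (Y : VF G.toSuperSpace V a) (Y' : VF G.toSuperSpace V b),
    π.Related h X Y → π.Related h X' Y' →
    ω.app le_top X X' = π.pull h (β.app le_top Y Y')

/-- `π` is a submersion: near each point there are charts in which it is the projection which
keeps some of the even and some of the odd coordinates. -/
def IsSubmersion : Prop :=
  ∀ x : F.carrier, ∃ (m n m' n' : ℕ) (c : Chart F.toSuperSpace m n)
    (c' : Chart G.toSuperSpace m' n') (i : Fin m' → Fin m) (j : Fin n' → Fin n),
    Function.Injective i ∧ Function.Injective j ∧ x ∈ c.dom ∧
    c.dom ≤ Opens.comap π.base c'.dom ∧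
    (∀ y ∈ c.dom, c'.body (π.base y) = c.body y ∘ i) ∧
    ∀ (W : Opens F.carrier) (V : Opens G.carrier) (hW : (W : Set F.carrier) ⊆ c.body.source)
      (hV : (V : Set G.carrier) ⊆ c'.body.source) (h : W ≤ Opens.comap π.base V)
      (hi : ∀ y ∈ chartImage c.body W, y ∘ i ∈ chartImage c'.body V) (g : G.Fun V),
      c.iso W hW (π.pull h g) = Model.proj i j hi (c'.iso V hV g)

end Hom

/-! ### Kernels and leaf spaces -/

/-- The local vector fields `Y` in the kernel of `ω`: `ι_Y ω = 0`. -/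
def kernel {F : SuperSpace.{u}} (ω : Form2 F ⊤) (U : Opens F.carrier) (a : ZMod 2) :
    Set (VF F U a) :=
  {Y | contract2 Y (ω.res le_top) = 0}

/-- `ω` has constant rank, i.e. `ker ω` is a regular distribution: a tangent vector at `x` in the
kernel of the bilinear form `ω_x` is the value at `x` of a local vector field in `ker ω`. -/
def HasConstantRank {F : SuperSpace.{u}} (ω : Form2 F ⊤) : Prop :=
  ∀ (U : Opens F.carrier) (a : ZMod 2) (X : VF F U a) (x : F.carrier), x ∈ U →
    (∀ (W : Opens F.carrier) (h : W ≤ U), x ∈ W → ∀ (b : ZMod 2) (Z : VF F W b),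
      F.VanishesAt (ω.app le_top (VF.res h X) Z) x) →
    ∃ (W : Opens F.carrier) (h : W ≤ U), x ∈ W ∧ ∃ Y ∈ kernel ω W a,
      ∀ (W' : Opens F.carrier) (h' : W' ≤ W), x ∈ W' → ∀ f : F.Fun W',
        F.VanishesAt (X.app (h'.trans h) f - Y.app h' f) x

/-- `π : F → G` is the projection to the (smooth) leaf space of the foliation `ker ω`: a submersion
whose fibres are the leaves, i.e. they are connected and the vertical vector fields are those
in `ker ω`. -/
structure IsLeafSpace {F G : GradedSupermanifold.{u}} (ω : Form2 F.toSuperSpace ⊤)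
    (π : Hom F G) : Prop where
  constantRank : HasConstantRank ω
  submersion : π.IsSubmersion
  connected : ∀ y : G.carrier, IsConnected (π.base ⁻¹' {y})
  mem_kernel_iff : ∀ (U : Opens F.carrier) (a : ZMod 2) (Y : VF F.toSuperSpace U a),
    Y ∈ kernel ω U a ↔ π.IsVertical Y

/-! ### The equivariant data -/

section Boundary

variable {F : SuperSpace.{u}}

/-- `α̲ = ι_Q ω - δS`. -/
def alphaB (ω : Form2 F ⊤) (S : F.Fun ⊤) (Q : VF F ⊤ 1) : Form1 F ⊤ := contract2 Q ω - d0 S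

/-- `ω̲ = δα̲`. -/
def omegaB (ω : Form2 F ⊤) (S : F.Fun ⊤) (Q : VF F ⊤ 1) : Form2 F ⊤ := d1 (alphaB ω S Q)

/-- `T̲ = -L_Q T`. -/
def tB (Q : VF F ⊤ 1) (T : F.Fun ⊤) : F.Fun ⊤ := -Q.app le_rfl T

end Boundary

/-- Boundary-compatible equivariant data of degree `k`: a closed homogeneous `2`-form `ω` of degree
`k - 1`, a function `S` of degree `k`, an odd vector field `Q` of degree `1` and a function `T` of
degree `k + 1` with `½ ι_[Q, Q] ω = -δT`. -/
structure IsEquivariantBV (F : GradedSupermanifold.{u}) (k : ℤ) (ω : Form2 F.toSuperSpace ⊤)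
    (S : F.Fun ⊤) (Q : VF F.toSuperSpace ⊤ 1) (T : F.Fun ⊤) : Prop where
  closed : ω.IsClosed
  parity : ∃ e : ZMod 2, ω.HasParity e
  degree_ω : ω.HasDegree F.euler (k - 1)
  degree_S : FunHasDegree F.euler k S
  degree_Q : VFHasDegree F.euler 1 Q
  degree_T : FunHasDegree F.euler (k + 1) T
  hamiltonian : (1 / 2 : ℝ) • contract2 (Q.bracket Q) ω = -d0 T

end BVBFV

end

open BVBFV

/-! The form ω̲ = δα̲ is exact, hence closed, and part (a) and the formulas are Cartan calculus. For
a closed form, L_Z is δι_Z up to sign, so a field in the kernel preserves the form and therefore its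
kernel; this is involutivity. For odd Q, inserting L_Q ω = -δι_Q ω into [L_Q, ι_Q] = ι_[Q,Q] gives

2 ι_Q δι_Q ω = δι_Q ι_Q ω + ι_[Q,Q] ω (`two_smul_d1_contract2`).

With ½ι_[Q,Q] ω = -δT this yields ι_Q ω̲ = δS̲ for S̲ = ½ι_Q ι_Q ω - T. Uniqueness holds because a
closed function f of degree k + 1 ≠ 0 satisfies (k + 1) f = E f = ι_E δf = 0. Contracting once more
with Q gives L_Q S̲ = -2 L_Q T, so T̲ = ½ L_Q S̲ needs no descent argument of its own. The same
identity on the leaf space, where ι_Q ω∂ = δS∂, gives the formula for ½ι_[Q,Q] ω∂.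

Descent rests on one fact: a function on π⁻¹(V) annihilated by all vertical fields is the pull-back
of a unique function on V (`Hom.exists_comap_eq`, `Hom.comap_injective`). Locally this is a
computation on cubes in adapted charts: vanishing derivatives along the fibre coordinates, even and
odd, mean no dependence on them. Connectedness of the fibres turns the local statement into a global
one. It is applied to S̲, since Z S̲ = ω̲(Z, Q) = 0 for vertical Z; to Q(π^* g), since L_Q ω̲ = 0
makes Q normalize ker ω̲; and to the values of ω̲ on lifts of fields from the base. Identities on
the base are then checked on lifts.

For nondegeneracy of ω∂, a null vector of its matrix of values at a point extends to a field with
constant coefficients. A lift of it is annihilated by ω̲ at that point, so by constant rank it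
agrees there with a vertical field, and the null vector is zero
(`Hom.AdaptedCharts.eq_zero_of_vecMul`). A matrix of superfunctions with invertible body is
invertible, because the remainder is nilpotent (`Model.isUnit_of_body`); thus ι_Y ω∂ = β is solved
in charts, one parity at a time, and the solutions are glued.

The chart computations need vector fields to be determined by their values on coordinates
(`Model.derivation_eq_zero`), which is Hadamard's lemma together with a bump function. -/

noncomputable section

namespace BVBFV

/-! ### Cartan calculus -/

section Cartan

variable {F : SuperSpace.{u}} {U V W : Opens F.carrier} {a b c : ZMod 2}

theorem SuperSpace.res_self (h : U ≤ U) (f : F.Fun U) : F.res h f = f :=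
  congrArg (fun t => t.hom f) (F.sheaf.presheaf.map_id (op U))

theorem VF.res_self (h : U ≤ U) (X : VF F U a) : VF.res h X = X := rfl

theorem VF.res_app (h : V ≤ U) (hW : W ≤ V) (X : VF F U a) (f : F.Fun W) :
    (VF.res h X).app hW f = X.app (hW.trans h) f := rfl

theorem VF.res_bracket (h : V ≤ U) (X : VF F U a) (Y : VF F U b) :
    VF.res h (X.bracket Y) = (VF.res h X).bracket (VF.res h Y) := rfl

theorem VF.res_cast (h : V ≤ U) (e : a = b) (X : VF F U a) :
    VF.res h (X.cast e) = (VF.res h X).cast e := by subst e; rfl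

theorem Form1.ext {α β : Form1 F U} (h : ∀ (W : Opens F.carrier) (hW : W ≤ U) (a : ZMod 2)
    (X : VF F W a), α.app hW X = β.app hW X) : α = β :=
  Subtype.ext (funext fun W => funext fun a => LinearMap.ext fun X => h W.1 W.2 a X)

theorem Form2.ext {ω η : Form2 F U} (h : ∀ (W : Opens F.carrier) (hW : W ≤ U) (a b : ZMod 2)
    (X : VF F W a) (Y : VF F W b), ω.app hW X Y = η.app hW X Y) : ω = η :=
  Subtype.ext (funext fun W => funext fun a => funext fun b => LinearMap.ext fun X =>
    LinearMap.ext fun Y => h W.1 W.2 a b X Y)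

theorem Form2.app_res (ω : Form2 F U) (hW : W ≤ U) (h : V ≤ W) (X : VF F W a) (Y : VF F W b) :
    ω.app (h.trans hW) (VF.res h X) (VF.res h Y) = F.res h (ω.app hW X Y) :=
  ω.2.1 W V hW h a b X Y

theorem Form2.app_smul (ω : Form2 F U) (hW : W ≤ U) (f : F.Fun W) (hf : F.IsPar c f)
    (X : VF F W a) (Y : VF F W b) : ω.app hW (X.smul f hf) Y = f * ω.app hW X Y :=
  ω.2.2.1 W hW a b c f hf X Y

theorem Form2.app_symm (ω : Form2 F U) (hW : W ≤ U) (X : VF F W a) (Y : VF F W b) :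
    ω.app hW Y X = sgn ((a + 1) * (b + 1)) • ω.app hW X Y := ω.2.2.2 W hW a b X Y

theorem Form2.app_cast_left (ω : Form2 F U) (hW : W ≤ U) (h : a = c) (X : VF F W a)
    (Y : VF F W b) : ω.app hW (X.cast h) Y = ω.app hW X Y := by subst h; rfl

theorem Form2.app_cast_right (ω : Form2 F U) (hW : W ≤ U) (h : b = c) (X : VF F W a)
    (Y : VF F W b) : ω.app hW X (Y.cast h) = ω.app hW X Y := by subst h; rfl

theorem Form1.add_app (α β : Form1 F U) (h : W ≤ U) (X : VF F W a) :
    (α + β).app h X = α.app h X + β.app h X := rfl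

theorem Form1.sub_app (α β : Form1 F U) (h : W ≤ U) (X : VF F W a) :
    (α - β).app h X = α.app h X - β.app h X := rfl

theorem Form1.neg_app (α : Form1 F U) (h : W ≤ U) (X : VF F W a) :
    (-α).app h X = -α.app h X := rfl

theorem Form1.smul_app (r : ℝ) (α : Form1 F U) (h : W ≤ U) (X : VF F W a) :
    (r • α).app h X = r • α.app h X := rfl

theorem Form2.sub_app (ω η : Form2 F U) (h : W ≤ U) (X : VF F W a) (Y : VF F W b) :
    (ω - η).app h X Y = ω.app h X Y - η.app h X Y := by
  have e : ω - η = ω + (-1 : ℝ) • η := by rw [neg_one_smul, sub_eq_add_neg]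
  rw [e, sub_eq_add_neg, ← neg_one_smul ℝ (η.app h X Y)]
  rfl

theorem Form1.zero_app (h : W ≤ U) (X : VF F W a) : (0 : Form1 F U).app h X = 0 := rfl

theorem Form2.res_app (h : V ≤ U) (hW : W ≤ V) (ω : Form2 F U) (X : VF F W a) (Y : VF F W b) :
    (ω.res h).app hW X Y = ω.app (hW.trans h) X Y := rfl

theorem contract2_app (X : VF F U a) (ω : Form2 F U) (h : W ≤ U) (Z : VF F W b) :
    (contract2 X ω).app h Z = ω.app h Z (VF.res h X) := rfl

theorem d0_app (f : F.Fun U) (h : W ≤ U) (X : VF F W a) :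
    (d0 f).app h X = X.app le_rfl (F.res h f) := rfl

theorem d1_app (α : Form1 F U) (h : W ≤ U) (X : VF F W a) (Y : VF F W b) :
    (d1 α).app h X Y = sgn (b * (a + 1)) • (Y.app le_rfl (α.app h X) - α.app h (Y.bracket X)) -
      sgn b • X.app le_rfl (α.app h Y) := rfl

theorem d1_d0 (f : F.Fun U) : d1 (d0 f) = 0 := by
  refine Form2.ext fun W hW a b X Y => ?_
  rw [d1_app, d0_app, d0_app, d0_app, VF.bracket_app]
  change _ = (0 : F.Fun W)
  rcases parity_cases a with rfl | rfl <;> rcases parity_cases b with rfl | rfl <;>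
    simp only [sgn_zero, sgn_one, one_add_one_parity, mul_zero, mul_one, zero_add, one_smul,
      neg_smul] <;> abel

theorem d1_sub (α β : Form1 F U) : d1 (α - β) = d1 α - d1 β := by
  refine Form2.ext fun W hW a b X Y => ?_
  rw [Form2.sub_app]
  simp only [d1_app, Form1.sub_app, map_sub, smul_sub]
  abel

theorem VF.jacobi (X : VF F U a) (Y : VF F U b) (Z : VF F U c) :
    X.bracket (Y.bracket Z) = ((X.bracket Y).bracket Z).cast (add_assoc a b c) +
      (sgn (a * b) • Y.bracket (X.bracket Z)).cast (add_left_comm b a c) := by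
  refine VF.ext fun W hW f => ?_
  simp only [VF.add_app, VF.cast_app, VF.smul_app, VF.bracket_app, map_sub, map_smul]
  rcases parity_cases a with rfl | rfl <;> rcases parity_cases b with rfl | rfl <;>
    rcases parity_cases c with rfl | rfl <;>
    simp only [sgn_zero, sgn_one, one_add_one_parity, mul_zero, mul_one, zero_add, add_zero,
      one_smul, neg_smul, smul_sub, smul_neg, neg_neg] <;> abel

theorem Form1.app_jacobi (α : Form1 F U) (h : W ≤ U) (X : VF F W a) (Y : VF F W b)
    (Z : VF F W c) : α.app h (X.bracket (Y.bracket Z)) = α.app h ((X.bracket Y).bracket Z) +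
      sgn (a * b) • α.app h (Y.bracket (X.bracket Z)) := by
  rw [VF.jacobi X Y Z, map_add, α.app_cast, α.app_cast, map_smul]

/-- `δδ = 0` on `1`-forms. -/
theorem d1_isClosed (α : Form1 F U) : (d1 α).IsClosed := by
  intro W h a b c X Y Z
  have e5 := α.app_jacobi h Z Y X
  -- The Jacobi identity for Z, Y, X under α is the only input besides expanding definitions; the
  -- eight parity cases fix the signs.
  simp only [lie2, d1_app, contract2_app, VF.res_self, Form2.res_app, map_sub, map_smul,
    VF.bracket_app] at *
  rw [e5]
  rcases parity_cases a with rfl | rfl <;> rcases parity_cases b with rfl | rfl <;>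
    rcases parity_cases c with rfl | rfl <;>
    simp only [sgn_zero, sgn_one, one_add_one_parity, mul_zero, mul_one, zero_add, add_zero,
      one_smul, neg_smul, smul_sub, smul_neg, neg_neg, smul_add] <;> abel

/-! ### Kernels of closed forms and the boundary action -/

theorem mem_kernel {ω : Form2 F ⊤} {Y : VF F U a} : Y ∈ kernel ω U a ↔
    ∀ (W : Opens F.carrier) (h : W ≤ U) (b : ZMod 2) (Z : VF F W b),
      ω.app le_top Z (VF.res h Y) = 0 :=
  ⟨fun hY _ h _ Z => congrArg (fun β : Form1 F U => β.app h Z) hY, fun hY => Form1.ext hY⟩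

/-- Graded symmetry exchanges the two slots up to an invertible sign, so left and right kernels
coincide. -/
theorem mem_kernel' {ω : Form2 F ⊤} {Y : VF F U a} : Y ∈ kernel ω U a ↔
    ∀ (W : Opens F.carrier) (h : W ≤ U) (b : ZMod 2) (Z : VF F W b),
      ω.app le_top (VF.res h Y) Z = 0 := by
  rw [mem_kernel]
  refine forall₄_congr fun _ h b Z => ?_
  rw [ω.app_symm le_top (VF.res h Y) Z]
  constructor
  · intro e
    rw [← one_smul ℝ (ω.app le_top (VF.res h Y) Z), ← sgn_mul_self ((a + 1) * (b + 1)), mul_smul, e,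
      smul_zero]
  · intro e
    rw [e, smul_zero]

theorem lie2_eq {ω : Form2 F ⊤} (hω : ω.IsClosed) (Z : VF F U c) (h : W ≤ U) (X : VF F W a)
    (Y : VF F W b) : lie2 (VF.res h Z) (ω.res le_top) le_rfl X Y =
      sgn c • (d1 (contract2 Z (ω.res le_top))).app h X Y :=
  hω W le_top a b c X Y (VF.res h Z)

theorem lie2_eq_zero_of_mem_kernel {ω : Form2 F ⊤} (hω : ω.IsClosed) {Z : VF F U c}
    (hZ : Z ∈ kernel ω U c) (h : W ≤ U) (X : VF F W a) (Y : VF F W b) :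
    lie2 (VF.res h Z) (ω.res le_top) le_rfl X Y = 0 := by
  have e : contract2 Z (ω.res le_top) = 0 := hZ
  rw [lie2_eq hω Z h, e, d1_app]
  simp only [Form1.zero_app, map_zero, sub_zero, smul_zero]

/-- A vector field which preserves `ω` preserves its kernel. -/
theorem bracket_mem_kernel_of_lie2 {ω : Form2 F ⊤} {Z : VF F U c}
    (hZ : ∀ (W : Opens F.carrier) (h : W ≤ U) (a b : ZMod 2) (X : VF F W a) (Y : VF F W b),
      lie2 (VF.res h Z) (ω.res le_top) le_rfl X Y = 0)
    {Y : VF F U b} (hY : Y ∈ kernel ω U b) : Z.bracket Y ∈ kernel ω U (c + b) := by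
  refine mem_kernel.2 fun W h a X => ?_
  -- In (L_Z ω)(X, Y) every term with Y itself in a slot vanishes; only ± ω(X, [Z, Y]) is left.
  have e := hZ W h a b X (VF.res h Y)
  simp only [lie2, Form2.res_app, mem_kernel.1 hY, VF.res_self, map_zero, sub_zero, smul_zero,
    zero_sub] at e
  rw [VF.res_bracket, ← one_smul ℝ (ω.app le_top X _), ← sgn_mul_self (c * (b + 1)), mul_smul,
    neg_eq_zero.1 e, smul_zero]

/-- By Cartan's formula L_Z ω = ± δι_Z ω = 0 for Z in the kernel of a closed form, and a symmetry of
ω preserves ker ω. -/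
theorem bracket_mem_kernel {ω : Form2 F ⊤} (hω : ω.IsClosed) {Z : VF F U c}
    (hZ : Z ∈ kernel ω U c) {Y : VF F U b} (hY : Y ∈ kernel ω U b) :
    Z.bracket Y ∈ kernel ω U (c + b) :=
  bracket_mem_kernel_of_lie2 (fun _ h _ _ X Y => lie2_eq_zero_of_mem_kernel hω hZ h X Y) hY

/-- `2 ι_X ι_Q δ ι_Q ω = ι_X (δ ι_Q ι_Q ω + ι_[Q, Q] ω)` for closed `ω` and odd `Q`. -/
theorem two_smul_d1_contract2 {ω : Form2 F ⊤} (hω : ω.IsClosed) (Q : VF F ⊤ 1) (h : W ≤ ⊤)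
    (X : VF F W a) : (2 : ℝ) • (d1 (contract2 Q ω)).app h X (VF.res h Q) =
      X.app le_rfl (F.res h (ω.app le_rfl Q Q)) + ω.app h X (VF.res h (Q.bracket Q)) := by
  -- This is L_Q ω = -δι_Q ω, evaluated on X and Q. Expanding δι_Q ω by its definition gives a
  -- second expression for the same quantity. Adding the two cancels the terms Q ω(X, Q) and ω([Q,
  -- X], Q), which is where the factor 2 arises.
  have e := lie2_eq hω Q h X (VF.res h Q)
  have e' : (d1 (contract2 Q (ω.res le_top))).app h X (VF.res h Q) =
    (d1 (contract2 Q ω)).app h X (VF.res h Q) := rfl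
  rw [e'] at e
  rw [← ω.app_res le_rfl h]
  simp only [lie2, Form2.res_app, d1_app, contract2_app, VF.res_self, VF.res_bracket] at *
  generalize ω.app _ X ((VF.res h Q).bracket (VF.res h Q)) = w at *
  generalize ω.app _ ((VF.res h Q).bracket X) (VF.res h Q) = v at *
  generalize X.app le_rfl (ω.app _ (VF.res h Q) (VF.res h Q)) = x at *
  generalize (VF.res h Q).app _ (ω.app _ X (VF.res h Q)) = q at *
  rcases parity_cases a with rfl | rfl <;>
    simp only [sgn_zero, sgn_one, one_add_one_parity, mul_zero, mul_one, zero_add, one_smul,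
      neg_smul, neg_sub, sub_neg_eq_add, two_smul] at * <;>
    linear_combination (norm := module) e

/-- The term δS of α̲ does not contribute because δδ = 0; the rest is half of
`two_smul_d1_contract2`, with ½ι_[Q,Q] ω replaced by -δT. -/
theorem contract2_omegaB {ω : Form2 F ⊤} (hω : ω.IsClosed) (S T : F.Fun ⊤) {Q : VF F ⊤ 1}
    (hT : (1 / 2 : ℝ) • contract2 (Q.bracket Q) ω = -d0 T) :
    contract2 Q (omegaB ω S Q) = d0 ((1 / 2 : ℝ) • contract1 Q (contract2 Q ω) - T) := by
  refine Form1.ext fun W h a X => ?_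
  have e := two_smul_d1_contract2 hω Q h X
  have e' : (1 / 2 : ℝ) • ω.app h X (VF.res h (Q.bracket Q)) = -X.app le_rfl (F.res h T) :=
    congrArg (fun β : Form1 F ⊤ => β.app h X) hT
  rw [contract2_app, omegaB, alphaB, d1_sub, d1_d0, sub_zero, d0_app, map_sub, map_sub, map_smul,
    map_smul]
  change _ = (1 / 2 : ℝ) • X.app le_rfl (F.res h (ω.app le_rfl Q Q)) - _
  linear_combination (norm := module) (1 / 2 : ℝ) • e + e'

/-- If ι_Q ω = δS, the left side of `two_smul_d1_contract2` vanishes and ι_Q ι_Q ω = Q S. This is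
applied to the reduced form on the leaf space. -/
theorem contract2_bracket_self {ω : Form2 F ⊤} (hω : ω.IsClosed) {S : F.Fun ⊤} {Q : VF F ⊤ 1}
    (hS : contract2 Q ω = d0 S) :
    (1 / 2 : ℝ) • contract2 (Q.bracket Q) ω = -d0 ((1 / 2 : ℝ) • Q.app le_rfl S) := by
  refine Form1.ext fun W h a X => ?_
  have e := two_smul_d1_contract2 hω Q h X
  have e' : ω.app le_rfl Q Q = Q.app le_rfl S := by
    have := congrArg (fun β : Form1 F ⊤ => β.app le_rfl Q) hS
    rwa [d0_app, SuperSpace.res_self] at this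
  have e0 : (0 : Form2 F ⊤).app h X (VF.res h Q) = 0 := rfl
  rw [hS, d1_d0, e0, smul_zero, e'] at e
  rw [Form1.neg_app, d0_app, map_smul, map_smul, Form1.smul_app, contract2_app]
  linear_combination (norm := module) -(1 / 2 : ℝ) • e

theorem lie2_eq_zero_of_contract2 {ω : Form2 F ⊤} (hω : ω.IsClosed) {S : F.Fun ⊤} {Q : VF F ⊤ c}
    (hS : contract2 Q ω = d0 S) (h : W ≤ ⊤) (X : VF F W a) (Y : VF F W b) :
    lie2 (VF.res h Q) (ω.res le_top) le_rfl X Y = 0 := by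
  rw [lie2_eq hω Q h]
  have e : contract2 Q (ω.res le_top) = d0 S := hS
  have e0 : (0 : Form2 F ⊤).app h X Y = 0 := rfl
  rw [e, d1_d0, e0, smul_zero]

/-- `L_Q S̲ = -2 L_Q T`. -/
theorem app_boundary_action {ω : Form2 F ⊤} (hω : ω.IsClosed) (T : F.Fun ⊤) {Q : VF F ⊤ 1}
    (hT : (1 / 2 : ℝ) • contract2 (Q.bracket Q) ω = -d0 T) :
    (1 / 2 : ℝ) • Q.app le_rfl ((1 / 2 : ℝ) • contract1 Q (contract2 Q ω) - T) = tB Q T := by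
  have e := two_smul_d1_contract2 hω Q le_rfl Q
  have e' : (1 / 2 : ℝ) • ω.app le_rfl Q (Q.bracket Q) = -Q.app le_rfl (F.res le_rfl T) :=
    congrArg (fun β : Form1 F ⊤ => β.app le_rfl Q) hT
  have e1 := lie2_eq hω Q le_rfl Q Q
  change _ = sgn 1 • (d1 (contract2 Q ω)).app le_rfl Q Q at e1
  have e2 := ω.app_symm le_rfl Q (Q.bracket Q)
  simp only [VF.res_self, SuperSpace.res_self, lie2, Form2.res_app, one_add_one_parity, mul_zero,
    zero_mul, sgn_zero, sgn_one, one_smul, neg_smul] at *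
  rw [e2] at e1
  change (1 / 2 : ℝ) • Q.app le_rfl ((1 / 2 : ℝ) • ω.app le_rfl Q Q - T) = - _
  rw [map_sub, map_smul]
  -- Put D = (δι_Q ω)(Q, Q), q = Q ω(Q, Q) and w = ω(Q, [Q, Q]). Then `e` says 2D = q + w and `e1`
  -- says q - 2w = -D; eliminating D gives q = w. By `e'` this common value is -2 QT, so ½(½q - QT)
  -- = -QT.
  linear_combination (norm := module) (-1 / 12 : ℝ) • e + (1 / 6 : ℝ) • e1 + (1 / 2 : ℝ) • e'

/-! ### Parity and ghost number -/

theorem SuperSpace.IsPar.congr {f : F.Fun U} (hf : F.IsPar a f) (h : a = b) : F.IsPar b f :=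
  h ▸ hf

theorem SuperSpace.IsPar.smul {f : F.Fun U} (r : ℝ) (hf : F.IsPar a f) : F.IsPar a (r • f) := by
  unfold IsPar at *
  rw [map_smul, hf, smul_comm]

theorem SuperSpace.IsPar.sub {f g : F.Fun U} (hf : F.IsPar a f) (hg : F.IsPar a g) :
    F.IsPar a (f - g) := by
  unfold IsPar at *
  rw [map_sub, hf, hg, smul_sub]

theorem d1_hasParity {e : ZMod 2} {α : Form1 F U}
    (hα : ∀ (W : Opens F.carrier) (h : W ≤ U) (a : ZMod 2) (X : VF F W a),
      F.IsPar (e + a) (α.app h X)) : (d1 α).HasParity e := by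
  intro W h a b X Y
  rw [d1_app]
  refine ((SuperSpace.IsPar.sub ?_ ?_).smul _).sub (SuperSpace.IsPar.smul _ ?_)
  · have := VF.isPar_app (hα W h a X) Y le_rfl
    rwa [add_comm] at this
  · have := hα W h _ (Y.bracket X)
    exact this.congr (by ring)
  · have := VF.isPar_app (hα W h b Y) X le_rfl
    rwa [add_left_comm, ← add_assoc] at this

/-- Homogeneity of ω̲ is what later allows the linear algebra of the reduced form to be split by
parity. -/
theorem omegaB_hasParity {e : ZMod 2} {ω : Form2 F ⊤} (hω : ω.HasParity e) (S : F.Fun ⊤)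
    (Q : VF F ⊤ 1) : (omegaB ω S Q).HasParity (e + 1) := by
  rw [omegaB, alphaB, d1_sub, d1_d0, sub_zero]
  refine d1_hasParity fun W h a X => ?_
  rw [add_right_comm]
  exact hω W h a 1 X (VF.res h Q)

theorem VFHasDegree.bracket_eq {E : VF F ⊤ 0} {d : ℤ} {X : VF F ⊤ a} (hX : VFHasDegree E d X) :
    E.bracket X = ((d : ℝ) • X).cast (zero_add a).symm := by
  refine VF.ext fun W h f => ?_
  rw [VF.cast_app]
  exact hX W f

theorem FunHasDegree.app {E : VF F ⊤ 0} {d d' : ℤ} {X : VF F ⊤ a} (hX : VFHasDegree E d X)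
    {f : F.Fun ⊤} (hf : FunHasDegree E d' f) : FunHasDegree E (d + d') (X.app le_rfl f) := by
  have e : (E.bracket X).app le_rfl f = (d : ℝ) • X.app le_rfl f := hX ⊤ f
  unfold FunHasDegree at *
  rw [VF.bracket_app, hf, zero_mul, sgn_zero, map_smul] at e
  push_cast
  linear_combination (norm := module) e

theorem FunHasDegree.smul {E : VF F ⊤ 0} {d : ℤ} {f : F.Fun ⊤} (r : ℝ)
    (hf : FunHasDegree E d f) : FunHasDegree E d (r • f) := by
  unfold FunHasDegree at *
  rw [map_smul, hf, smul_comm]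

theorem FunHasDegree.sub {E : VF F ⊤ 0} {d : ℤ} {f g : F.Fun ⊤}
    (hf : FunHasDegree E d f) (hg : FunHasDegree E d g) : FunHasDegree E d (f - g) := by
  unfold FunHasDegree at *
  rw [map_sub, hf, hg, smul_sub]

theorem Form2.HasDegree.app_eq {E : VF F ⊤ 0} {d : ℤ} {ω : Form2 F ⊤} (hω : ω.HasDegree E d)
    (X : VF F W a) (Y : VF F W b) : E.app le_top (ω.app le_top X Y) =
      ω.app le_top ((VF.res le_top E).bracket X) Y + ω.app le_top X ((VF.res le_top E).bracket Y) +
        (d : ℝ) • ω.app le_top X Y := by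
  have e := hω W a b X Y
  rw [lie2, zero_mul, zero_mul, sgn_zero] at e
  linear_combination (norm := module) e

/-- L_E commutes with δ. The hypothesis is L_E α = d α written on vector fields; the term α([Y, X])
requires the Jacobi identity for E, Y, X. -/
theorem d1_hasDegree {E : VF F ⊤ 0} {d : ℤ} {α : Form1 F ⊤}
    (hα : ∀ (W : Opens F.carrier) (a : ZMod 2) (X : VF F W a), E.app le_top (α.app le_top X) =
      α.app le_top ((VF.res le_top E).bracket X) + (d : ℝ) • α.app le_top X) :
    (d1 α).HasDegree E d := by
  intro W a b X Y
  have e0 : ∀ f : F.Fun W, E.app le_top f = (VF.res (U := ⊤) (V := W) le_top E).app le_rfl f :=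
    fun _ => rfl
  have e1 := hα W a X
  have e2 := hα W b Y
  have e3 := hα W (b + a) (Y.bracket X)
  have e4 := α.app_jacobi le_top (VF.res le_top E) Y X
  have e5 := congrArg (Y.app le_rfl) e1
  have e6 := congrArg (X.app le_rfl) e2
  rw [lie2]
  simp only [d1_app, VF.bracket_app, map_sub, map_smul, map_add, e0, zero_mul, sgn_zero, one_smul,
    zero_add] at *
  linear_combination (norm := module) sgn (b * (a + 1)) • (e5 - e3 - e4) - sgn b • e6

/-- Since [E, Q] = Q, contraction with Q raises the degree k - 1 of ω by one, and δ preserves it.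
The function S drops out because δδS = 0. -/
theorem omegaB_hasDegree {E : VF F ⊤ 0} {k : ℤ} {ω : Form2 F ⊤} (hω : ω.HasDegree E (k - 1))
    {S : F.Fun ⊤} {Q : VF F ⊤ 1} (hQ : VFHasDegree E 1 Q) :
    (omegaB ω S Q).HasDegree E k := by
  rw [omegaB, alphaB, d1_sub, d1_d0, sub_zero]
  refine d1_hasDegree fun W a X => ?_
  rw [contract2_app, contract2_app, hω.app_eq, ← VF.res_bracket, hQ.bracket_eq, VF.res_cast,
    ω.app_cast_right, map_smul, map_smul]
  push_cast
  module

theorem boundary_action_hasDegree {E : VF F ⊤ 0} {k : ℤ} {ω : Form2 F ⊤}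
    (hω : ω.HasDegree E (k - 1)) {T : F.Fun ⊤} (hT : FunHasDegree E (k + 1) T) {Q : VF F ⊤ 1}
    (hQ : VFHasDegree E 1 Q) :
    FunHasDegree E (k + 1) ((1 / 2 : ℝ) • contract1 Q (contract2 Q ω) - T) := by
  refine (FunHasDegree.smul _ ?_).sub hT
  have e := hω.app_eq Q Q
  rw [VF.res_self, hQ.bracket_eq, ω.app_cast_right, ω.app_cast_left, map_smul, map_smul,
    LinearMap.smul_apply] at e
  change E.app le_rfl (ω.app le_rfl Q Q) = _ • ω.app le_rfl Q Q
  refine e.trans ?_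
  push_cast
  module

/-- A function of nonzero degree is determined by its differential. -/
theorem eq_zero_of_d0_eq_zero {E : VF F ⊤ 0} {k : ℤ} (hk : k ≠ 0) {f : F.Fun ⊤}
    (hf : FunHasDegree E k f) (h0 : d0 f = 0) : f = 0 := by
  -- Contracting δf = 0 with the Euler field turns it into k f = E f = 0.
  have e : E.app le_rfl (F.res le_rfl f) = 0 := congrArg (fun β : Form1 F ⊤ => β.app le_rfl E) h0
  rw [SuperSpace.res_self, hf] at e
  exact (smul_eq_zero.1 e).resolve_left (Int.cast_ne_zero.2 hk)

theorem d0_sub (f g : F.Fun U) : d0 (f - g) = d0 f - d0 g := by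
  refine Form1.ext fun W h a X => ?_
  rw [Form1.sub_app, d0_app, d0_app, d0_app, map_sub, map_sub]

end Cartan

/-! ### Gluing -/

section Gluing

variable {F : SuperSpace.{u}} {U V W : Opens F.carrier} {a b c : ZMod 2}

theorem SuperSpace.fun_ext {f g : F.Fun U}
    (h : ∀ x ∈ U, ∃ (W : Opens F.carrier) (hW : W ≤ U), x ∈ W ∧ F.res hW f = F.res hW g) :
    f = g := by
  choose W hW hx e using h
  refine F.sheaf.eq_of_locally_eq' (fun x : U => W x.1 x.2) U (fun x => homOfLE (hW x.1 x.2)) ?_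
    f g fun x => e x.1 x.2
  intro x hxU
  exact Opens.mem_iSup.2 ⟨⟨x, hxU⟩, hx x hxU⟩

theorem SuperSpace.eq_zero_of_local {f : F.Fun U}
    (h : ∀ x ∈ U, ∃ (W : Opens F.carrier) (hW : W ≤ U), x ∈ W ∧ F.res hW f = 0) : f = 0 :=
  SuperSpace.fun_ext fun x hx => by simpa only [map_zero] using h x hx

/-- Local sections which are characterized by a property stable under restriction glue. -/
theorem SuperSpace.exists_glue (P : ∀ W : Opens F.carrier, F.Fun W → Prop)
    (mono : ∀ (W W' : Opens F.carrier) (h : W' ≤ W) (f : F.Fun W), W ≤ V → P W f →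
      P W' (F.res h f))
    (uniq : ∀ (W : Opens F.carrier) (f g : F.Fun W), W ≤ V → P W f → P W g → f = g)
    (ex : ∀ x ∈ V, ∃ W ≤ V, x ∈ W ∧ ∃ f : F.Fun W, P W f) :
    ∃ f : F.Fun V, ∀ (W : Opens F.carrier) (h : W ≤ V) (g : F.Fun W), P W g → F.res h f = g := by
  choose W hW hx s hs using ex
  obtain ⟨f, hf, -⟩ := F.sheaf.existsUnique_gluing' (fun x : V => W x.1 x.2) V
    (fun x => homOfLE (hW x.1 x.2)) (fun x hxV => Opens.mem_iSup.2 ⟨⟨x, hxV⟩, hx x hxV⟩)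
    (fun x => s x.1 x.2) (fun x y => by
      refine uniq _ _ _ (inf_le_left.trans (hW x.1 x.2)) (mono _ _ inf_le_left _ (hW x.1 x.2)
        (hs x.1 x.2)) (mono _ _ inf_le_right _ (hW y.1 y.2) (hs y.1 y.2)))
  refine ⟨f, fun W' h g hg => SuperSpace.fun_ext fun x hxW => ?_⟩
  refine ⟨W' ⊓ W x (h hxW), inf_le_left, ⟨hxW, hx x (h hxW)⟩, ?_⟩
  refine uniq _ _ _ (inf_le_left.trans h) ?_ (mono _ _ inf_le_left _ h hg)
  rw [SuperSpace.res_res]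
  have e : F.res (hW x (h hxW)) f = s x (h hxW) := hf ⟨x, h hxW⟩
  rw [← SuperSpace.res_res inf_le_right (hW x (h hxW)), e]
  exact mono _ _ inf_le_right _ (hW _ _) (hs _ _)

theorem VF.ext_local {X Y : VF F U a} (h : ∀ x ∈ U, ∃ (W : Opens F.carrier) (hW : W ≤ U),
    x ∈ W ∧ VF.res hW X = VF.res hW Y) : X = Y := by
  refine VF.ext fun W hW f => SuperSpace.fun_ext fun x hx => ?_
  obtain ⟨W', hW', hxW, e⟩ := h x (hW hx)
  refine ⟨W ⊓ W', inf_le_left, ⟨hx, hxW⟩, ?_⟩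
  rw [← VF.app_res, ← VF.app_res]
  exact congrArg (fun Z : VF F W' a => Z.app inf_le_right (F.res inf_le_left f)) e

/-- A vector field is a family of derivations on all smaller open sets, so the sheaf property of
functions is used once for each f: the value of the glued field on f is glued from the local values
Y f. Uniqueness of the local fields makes these values compatible. -/
theorem VF.exists_glue (P : ∀ W : Opens F.carrier, VF F W a → Prop)
    (mono : ∀ (W W' : Opens F.carrier) (h : W' ≤ W) (X : VF F W a), W ≤ V → P W X →
      P W' (VF.res h X))
    (uniq : ∀ (W : Opens F.carrier) (X Y : VF F W a), W ≤ V → P W X → P W Y → X = Y)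
    (ex : ∀ x ∈ V, ∃ W ≤ V, x ∈ W ∧ ∃ X : VF F W a, P W X) :
    ∃ X : VF F V a, ∀ (W : Opens F.carrier) (h : W ≤ V) (Y : VF F W a), P W Y →
      VF.res h X = Y := by
  have glue : ∀ (W : Opens F.carrier) (_ : W ≤ V) (f : F.Fun W), ∃ g : F.Fun W,
      ∀ (W' : Opens F.carrier) (h : W' ≤ W) (Y : VF F W' a), P W' Y →
        F.res h g = Y.app le_rfl (F.res h f) := by
    intro W hW f
    obtain ⟨g, hg⟩ := SuperSpace.exists_glue (V := W)
      (fun W' g => ∃ (h : W' ≤ W) (Y : VF F W' a), P W' Y ∧ g = Y.app le_rfl (F.res h f))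
      (fun W₁ W₂ h g _ ⟨h', Y, hY, e⟩ => ⟨h.trans h', VF.res h Y,
        mono _ _ h Y (h'.trans hW) hY, by
          rw [e, ← Y.app_res le_rfl h, SuperSpace.res_res]; rfl⟩)
      (fun W₁ g g' hW' ⟨h, Y, hY, e⟩ ⟨h', Y', hY', e'⟩ => by
        rw [e, e', uniq _ _ _ (h.trans hW) hY hY'])
      (fun x hx => by
        obtain ⟨W', hW', hxW, Y, hY⟩ := ex x (hW hx)
        exact ⟨W ⊓ W', inf_le_left, ⟨hx, hxW⟩, _, inf_le_left, VF.res inf_le_right Y,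
          mono _ _ _ _ hW' hY, rfl⟩)
    exact ⟨g, fun W' h Y hY => hg W' h _ ⟨h, Y, hY, rfl⟩⟩
  choose G hG using glue
  -- The glued value is characterized by its restrictions to open sets which carry a field
  -- satisfying `P`; linearity, parity and the Leibniz rule are thereby inherited from the local
  -- fields.
  have key : ∀ (W : Opens F.carrier) (hW : W ≤ V) (f g : F.Fun W),
      (∀ (W' : Opens F.carrier) (h : W' ≤ W) (Y : VF F W' a), P W' Y →
        Y.app le_rfl (F.res h f) = F.res h g) → G W hW f = g := by
    intro W hW f g h
    refine SuperSpace.fun_ext fun x hx => ?_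
    obtain ⟨W', hW', hxW, Y, hY⟩ := ex x (hW hx)
    have hY' := mono W' (W ⊓ W') inf_le_right Y hW' hY
    exact ⟨W ⊓ W', inf_le_left, ⟨hx, hxW⟩, by rw [hG _ _ _ _ _ _ hY', h _ _ _ hY']⟩
  refine ⟨⟨fun W =>
    { toFun := G W.1 W.2
      map_add' := fun f g => key _ _ _ _ fun W' h Y hY => by
        rw [map_add, map_add, map_add]
        exact congrArg₂ _ (hG W.1 W.2 f _ _ _ hY).symm (hG W.1 W.2 g _ _ _ hY).symm
      map_smul' := fun r f => key _ _ _ _ fun W' h Y hY => by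
        rw [map_smul, map_smul, RingHom.id_apply, map_smul]
        exact congrArg (r • ·) (hG W.1 W.2 f _ _ _ hY).symm },
    ⟨fun W W' hW h f => ?_, fun W hW f => ?_, fun W hW f g => ?_⟩⟩, fun W h Y hY => ?_⟩
  · exact key _ _ _ _ fun W'' h' Y hY => by
      rw [SuperSpace.res_res, SuperSpace.res_res]; exact (hG _ hW f _ _ _ hY).symm
  · exact key _ _ _ _ fun W'' h' Y hY => by
      rw [SuperSpace.res_σ, VF.app_σ, map_smul, SuperSpace.res_σ]
      congr 2; exact (hG _ hW f _ _ _ hY).symm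
  · exact key _ _ _ _ fun W'' h' Y hY => by
      have e1 : F.res h' (G W hW f) = _ := hG _ hW f _ _ _ hY
      have e2 : F.res h' (G W hW g) = _ := hG _ hW g _ _ _ hY
      have e3 : F.res h' (F.tw a f) = F.tw a (F.res h' f) := by
        rcases parity_cases a with rfl | rfl
        · rfl
        · exact SuperSpace.res_σ h' f
      rw [map_mul, VF.app_mul, map_add, map_mul, map_mul, e3]
      exact congrArg₂ _ (congrArg (· * _) e1.symm) (congrArg (_ * ·) e2.symm)
  · refine VF.ext fun W' h' f => key _ _ _ _ fun W'' h'' Y' hY' => ?_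
    rw [uniq _ Y' (VF.res (h''.trans h') Y) (h''.trans (h'.trans h)) hY' (mono _ _ _ _ h hY),
      ← Y.app_res]
    rfl

end Gluing

/-! ### Hadamard's lemma -/

section Hadamard

open MeasureTheory Filter Topology

/-- Differentiation under the integral sign; the dominating function is a constant because [0, 1]
and a closed ball in a finite-dimensional space are compact. -/
theorem hasFDerivAt_intervalIntegral_of_contDiff {E G : Type} [NormedAddCommGroup E]
    [NormedSpace ℝ E] [FiniteDimensional ℝ E] [NormedAddCommGroup G] [NormedSpace ℝ G]
    [CompleteSpace G] {f : E × ℝ → G} (hf : ContDiff ℝ 1 f) (x : E) :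
    HasFDerivAt (fun x => ∫ t in (0 : ℝ)..1, f (x, t))
      (∫ t in (0 : ℝ)..1, (fderiv ℝ f (x, t)).comp (ContinuousLinearMap.inl ℝ E ℝ)) x := by
  have : ProperSpace E := FiniteDimensional.proper ℝ E
  have hc : Continuous fun q : E × ℝ =>
      (fderiv ℝ f q).comp (ContinuousLinearMap.inl ℝ E ℝ) :=
    (hf.continuous_fderiv one_ne_zero).clm_comp continuous_const
  obtain ⟨C, hC⟩ := ((isCompact_closedBall x 1).prod (isCompact_Icc (a := (0 : ℝ)) (b := 1))
    ).exists_bound_of_continuousOn hc.continuousOn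
  refine intervalIntegral.hasFDerivAt_integral_of_dominated_of_fderiv_le
    (𝕜 := ℝ) (F := fun x t => f (x, t))
    (F' := fun x t => (fderiv ℝ f (x, t)).comp (ContinuousLinearMap.inl ℝ E ℝ))
    (bound := fun _ => C) (s := Metric.closedBall x 1)
    (Metric.closedBall_mem_nhds x one_pos) ?_ ?_ ?_ ?_ ?_ ?_
  · exact Eventually.of_forall fun y =>
      (hf.continuous.comp (Continuous.prodMk_right y)).aestronglyMeasurable
  · exact (hf.continuous.comp (Continuous.prodMk_right x)).intervalIntegrable _ _
  · exact (hc.comp (Continuous.prodMk_right x)).aestronglyMeasurable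
  · refine Eventually.of_forall fun t ht y hy => hC (y, t) ⟨hy, ?_⟩
    rw [Set.uIoc_of_le zero_le_one] at ht
    exact ⟨ht.1.le, ht.2⟩
  · exact intervalIntegrable_const
  · refine Eventually.of_forall fun t ht y hy => ?_
    exact ((hf.differentiable one_ne_zero (y, t)).hasFDerivAt).comp y
      (hasFDerivAt_prodMk_left y t)

/-- The derivative is again an integral of this type, with values in E →L[ℝ] G; for this reason the
induction on n quantifies over the target space. -/
theorem contDiff_intervalIntegral {E : Type} [NormedAddCommGroup E]
    [NormedSpace ℝ E] [FiniteDimensional ℝ E] (n : ℕ) :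
    ∀ {G : Type} [NormedAddCommGroup G] [NormedSpace ℝ G] [CompleteSpace G] {f : E × ℝ → G},
      ContDiff ℝ n f → ContDiff ℝ n fun x => ∫ t in (0 : ℝ)..1, f (x, t) := by
  induction n with
  | zero =>
    intro G _ _ _ f hf
    rw [Nat.cast_zero, contDiff_zero] at *
    exact intervalIntegral.continuous_parametric_intervalIntegral_of_continuous'
      (f := fun x t => f (x, t)) hf 0 1
  | succ n ih =>
    intro G _ _ _ f hf
    have h1 : ContDiff ℝ 1 f := hf.of_le (by exact_mod_cast Nat.le_add_left 1 n)
    push_cast at hf ⊢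
    rw [contDiff_succ_iff_hasFDerivAt]
    refine ⟨_, ih (f := fun q => (fderiv ℝ f q).comp (ContinuousLinearMap.inl ℝ E ℝ)) ?_,
      hasFDerivAt_intervalIntegral_of_contDiff h1⟩
    exact (hf.fderiv_right le_rfl).clm_comp contDiff_const

theorem clm_apply_eq_sum {m : ℕ} (L : (Fin m → ℝ) →L[ℝ] ℝ) (v : Fin m → ℝ) :
    L v = ∑ k, v k * L (Pi.single k 1) := by
  conv_lhs => rw [← Finset.univ_sum_single v, map_sum]
  refine Finset.sum_congr rfl fun k _ => ?_
  rw [← smul_eq_mul (v k), ← map_smul, ← Pi.single_smul, smul_eq_mul, mul_one]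

/-- Hadamard's lemma. -/
theorem exists_hadamard {m : ℕ} {g : (Fin m → ℝ) → ℝ} (hg : ContDiff ℝ (⊤ : ℕ∞) g)
    (p : Fin m → ℝ) : ∃ h : Fin m → (Fin m → ℝ) → ℝ, (∀ k, ContDiff ℝ (⊤ : ℕ∞) (h k)) ∧
      ∀ x, g x = g p + ∑ k, (x k - p k) * h k x := by
  have hd : ContDiff ℝ (⊤ : ℕ∞) (fderiv ℝ g) := hg.fderiv_right (by simp)
  have hc : ∀ k, ContDiff ℝ (⊤ : ℕ∞) fun q : (Fin m → ℝ) × ℝ =>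
      fderiv ℝ g (p + q.2 • (q.1 - p)) (Pi.single k 1) := fun k =>
    ((hd.comp (contDiff_const.add (contDiff_snd.smul (contDiff_fst.sub contDiff_const)))
      ).clm_apply contDiff_const)
  -- The coefficients come from the fundamental theorem of calculus for t ↦ g(p + t(x - p)) on [0,
  -- 1].
  refine ⟨fun k x => ∫ t in (0 : ℝ)..1, fderiv ℝ g (p + t • (x - p)) (Pi.single k 1), fun k => ?_,
    fun x => ?_⟩
  · exact contDiff_infty.2 fun n => contDiff_intervalIntegral n (contDiff_infty.1 (hc k) n)
  · have e : ∀ t ∈ Set.uIcc (0 : ℝ) 1, HasDerivAt (fun t : ℝ => g (p + t • (x - p)))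
        (∑ k, (x k - p k) * fderiv ℝ g (p + t • (x - p)) (Pi.single k 1)) t := by
      intro t _
      have h1 : HasDerivAt (fun t : ℝ => p + t • (x - p)) (x - p) t := by
        simpa using ((hasDerivAt_id t).smul_const (x - p)).const_add p
      have h2 := (hg.differentiable (by simp) (p + t • (x - p))).hasFDerivAt.comp_hasDerivAt t h1
      refine h2.congr_deriv ?_
      rw [clm_apply_eq_sum]
      rfl
    have hi : ∀ k, Continuous fun t : ℝ => fderiv ℝ g (p + t • (x - p)) (Pi.single k 1) :=
      fun k => (hc k).continuous.comp (Continuous.prodMk_right x)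
    have := intervalIntegral.integral_eq_sub_of_hasDerivAt e
      (Continuous.intervalIntegrable (continuous_finsetSum _ fun k _ =>
        continuous_const.mul (hi k)) _ _)
    rw [intervalIntegral.integral_finsetSum (f := fun k t =>
      (x k - p k) * fderiv ℝ g (p + t • (x - p)) (Pi.single k 1)) fun k _ =>
      (continuous_const.mul (hi k)).intervalIntegrable _ _] at this
    simp only [intervalIntegral.integral_const_mul, one_smul, zero_smul, add_zero,
      add_sub_cancel] at this
    rw [this]; ring

end Hadamard

/-! ### Smooth functions on a domain -/

section SmoothFunctions

variable {m m' n n' : ℕ} {D : Opens (Fin m → ℝ)} {D' : Opens (Fin m' → ℝ)}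

namespace Smooth

/-- Extension by zero. -/
def ext (f : Smooth m D) (x : Fin m → ℝ) : ℝ := by
  classical exact if h : x ∈ D then f.1 ⟨x, h⟩ else 0

theorem ext_apply (f : Smooth m D) {x : Fin m → ℝ} (h : x ∈ D) : ext f x = f.1 ⟨x, h⟩ :=
  dif_pos h

theorem contDiffOn_ext (f : Smooth m D) : ContDiffOn ℝ (⊤ : ℕ∞) (ext f) D := by
  obtain ⟨g, hg, e⟩ := f.2
  exact hg.congr fun x hx => (ext_apply f hx).trans (e ⟨x, hx⟩)

theorem differentiableAt_ext (f : Smooth m D) {x : Fin m → ℝ} (h : x ∈ D) :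
    DifferentiableAt ℝ (ext f) x :=
  ((contDiffOn_ext f).contDiffAt (D.2.mem_nhds h)).differentiableAt (by simp)

/-- The smooth function on `D` given by a function which is smooth on `D`. -/
def mk (g : (Fin m → ℝ) → ℝ) (hg : ContDiffOn ℝ (⊤ : ℕ∞) g D) : Smooth m D :=
  ⟨fun x => g x, g, hg, fun _ => rfl⟩

theorem mk_apply (g : (Fin m → ℝ) → ℝ) (hg : ContDiffOn ℝ (⊤ : ℕ∞) g D) (x : D) :
    (mk g hg).1 x = g x := rfl

/-- Partial derivatives. -/
def pd (k : Fin m) : Smooth m D →ₗ[ℝ] Smooth m D where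
  toFun f := mk (fun x => fderiv ℝ (ext f) x (Pi.single k 1))
    (((contDiffOn_ext f).fderiv_of_isOpen D.2 (by simp)).clm_apply contDiffOn_const)
  map_add' f g := Subtype.ext (funext fun x => by
    have e : ext (f + g) =ᶠ[nhds x.1] ext f + ext g :=
      Filter.eventuallyEq_of_mem (D.2.mem_nhds x.2) fun y hy => by
        rw [Pi.add_apply, ext_apply _ hy, ext_apply _ hy, ext_apply _ hy]; rfl
    change fderiv ℝ (ext (f + g)) x (Pi.single k 1) = fderiv ℝ (ext f) x (Pi.single k 1) +
      fderiv ℝ (ext g) x (Pi.single k 1)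
    rw [e.fderiv_eq, fderiv_add (differentiableAt_ext f x.2) (differentiableAt_ext g x.2)]
    rfl)
  map_smul' r f := Subtype.ext (funext fun x => by
    have e : ext (r • f) =ᶠ[nhds x.1] r • ext f :=
      Filter.eventuallyEq_of_mem (D.2.mem_nhds x.2) fun y hy => by
        rw [Pi.smul_apply, ext_apply _ hy, ext_apply _ hy]; rfl
    change fderiv ℝ (ext (r • f)) x (Pi.single k 1) = r • fderiv ℝ (ext f) x (Pi.single k 1)
    rw [e.fderiv_eq, fderiv_const_smul (differentiableAt_ext f x.2)]
    rfl)

theorem pd_apply (k : Fin m) (f : Smooth m D) (x : D) :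
    (pd k f).1 x = fderiv ℝ (ext f) x (Pi.single k 1) := rfl

theorem pd_mul (k : Fin m) (f g : Smooth m D) : pd k (f * g) = pd k f * g + f * pd k g := by
  refine Subtype.ext (funext fun x => ?_)
  have e : ext (f * g) =ᶠ[nhds x.1] ext f * ext g :=
    Filter.eventuallyEq_of_mem (D.2.mem_nhds x.2) fun y hy => by
      rw [Pi.mul_apply, ext_apply _ hy, ext_apply _ hy, ext_apply _ hy]; rfl
  change fderiv ℝ (ext (f * g)) x (Pi.single k 1) = fderiv ℝ (ext f) x (Pi.single k 1) * g.1 x +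
    f.1 x * fderiv ℝ (ext g) x (Pi.single k 1)
  rw [e.fderiv_eq, fderiv_mul (differentiableAt_ext f x.2) (differentiableAt_ext g x.2),
    ext_apply f x.2, ext_apply g x.2, add_apply,
    smul_apply, smul_apply, smul_eq_mul, smul_eq_mul]
  ring

/-- Chain rule for the linear map y ↦ y ∘ i. It treats both kinds of directions at once: the basis
vector e_k composed with i is a basis vector if k is retained, and zero otherwise. -/
theorem pd_proj_aux (i : Fin m' → Fin m) (h : ∀ y ∈ D, y ∘ i ∈ D') (k : Fin m)
    (f : Smooth m' D') (x : D) :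
    (pd k (proj i h f)).1 x = fderiv ℝ (ext f) (x.1 ∘ i) ((Pi.single k 1 : Fin m → ℝ) ∘ i) := by
  have e : ext (proj i h f) =ᶠ[nhds x.1] ext f ∘ fun y => y ∘ i :=
    Filter.eventuallyEq_of_mem (D.2.mem_nhds x.2) fun y hy => by
      rw [Function.comp_apply, ext_apply _ hy, ext_apply _ (h y hy)]; rfl
  let L : (Fin m → ℝ) →L[ℝ] (Fin m' → ℝ) :=
    ContinuousLinearMap.pi fun k' => ContinuousLinearMap.proj (i k')
  have e' : fderiv ℝ (ext f ∘ L) x.1 = _ :=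
    fderiv_comp x.1 (differentiableAt_ext f (h x.1 x.2)) L.differentiableAt
  rw [L.fderiv] at e'
  rw [pd_apply, e.fderiv_eq]
  exact congrArg (fun T : (Fin m → ℝ) →L[ℝ] ℝ => T (Pi.single k 1)) e'

theorem pd_proj {i : Fin m' → Fin m} (hi : Function.Injective i) (h : ∀ y ∈ D, y ∘ i ∈ D')
    (k : Fin m') (f : Smooth m' D') : pd (i k) (proj i h f) = proj i h (pd k f) := by
  refine Subtype.ext (funext fun x => ?_)
  have e : (Pi.single (i k) 1 : Fin m → ℝ) ∘ i = Pi.single k 1 := by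
    funext k'
    simp only [Function.comp_apply, Pi.single_apply, hi.eq_iff]
  rw [pd_proj_aux, e]
  rfl

theorem pd_proj_of_notMem {i : Fin m' → Fin m} (h : ∀ y ∈ D, y ∘ i ∈ D')
    {k : Fin m} (hk : k ∉ Set.range i) (f : Smooth m' D') : pd k (proj i h f) = 0 := by
  refine Subtype.ext (funext fun x => ?_)
  have e : (Pi.single k 1 : Fin m → ℝ) ∘ i = 0 := by
    funext k'
    rw [Function.comp_apply, Pi.single_eq_of_ne fun e => hk ⟨k', e⟩, Pi.zero_apply]
  rw [pd_proj_aux, e, map_zero]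
  rfl

/-- Coordinate functions. -/
def coord (D : Opens (Fin m → ℝ)) (k : Fin m) : Smooth m D :=
  ⟨fun y => y.1 k, fun y => y k, (contDiff_apply ℝ ℝ k).contDiffOn, fun _ => rfl⟩

theorem pd_coord (k l : Fin m) : pd k (coord D l) = algebraMap ℝ _ (if l = k then 1 else 0) := by
  refine Subtype.ext (funext fun x => ?_)
  have e : ext (coord D l) =ᶠ[nhds x.1] ContinuousLinearMap.proj (R := ℝ) l :=
    Filter.eventuallyEq_of_mem (D.2.mem_nhds x.2) fun y hy => ext_apply _ hy
  rw [pd_apply, e.fderiv_eq, ContinuousLinearMap.fderiv, ContinuousLinearMap.proj_apply,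
    Pi.single_apply]
  rfl

/-- The section of a coordinate projection through the point `p`. -/
def slice (i : Fin m' → Fin m) (p : Fin m → ℝ) (y : Fin m' → ℝ) (k : Fin m) : ℝ := by
  classical exact if h : ∃ k', i k' = k then y h.choose else p k

theorem slice_apply {i : Fin m' → Fin m} (hi : Function.Injective i) (p : Fin m → ℝ)
    (y : Fin m' → ℝ) (k' : Fin m') : slice i p y (i k') = y k' := by
  have h : ∃ k, i k = i k' := ⟨k', rfl⟩
  exact (dif_pos h).trans (congrArg y (hi h.choose_spec))

theorem slice_of_notMem {i : Fin m' → Fin m} (p : Fin m → ℝ)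
    (y : Fin m' → ℝ) {k : Fin m} (hk : k ∉ Set.range i) : slice i p y k = p k :=
  dif_neg hk

theorem contDiff_slice (i : Fin m' → Fin m) (p : Fin m → ℝ) :
    ContDiff ℝ (⊤ : ℕ∞) (slice i p) := by
  refine contDiff_pi.2 fun k => ?_
  by_cases h : ∃ k', i k' = k
  · simp only [slice, dif_pos h]
    exact contDiff_apply ℝ ℝ _
  · simp only [slice, dif_neg h]
    exact contDiff_const

/-- Restriction to the image of a section of a coordinate projection. -/
def sec (i : Fin m' → Fin m) (p : Fin m → ℝ) (h : ∀ y ∈ D', slice i p y ∈ D) :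
    Smooth m D →ₐ[ℝ] Smooth m' D' where
  toFun f := ⟨fun y => f.1 ⟨slice i p y.1, h y.1 y.2⟩, by
    obtain ⟨g, hg, hfg⟩ := f.2
    exact ⟨fun y => g (slice i p y), hg.comp (contDiff_slice i p).contDiffOn h,
      fun y => hfg _⟩⟩
  map_one' := rfl
  map_mul' _ _ := rfl
  map_zero' := rfl
  map_add' _ _ := rfl
  commutes' _ := rfl

theorem sec_proj {i : Fin m' → Fin m} (hi : Function.Injective i) (p : Fin m → ℝ)
    (h : ∀ y ∈ D', slice i p y ∈ D) (h' : ∀ y ∈ D, y ∘ i ∈ D') (f : Smooth m' D') :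
    sec i p h (proj i h' f) = f := by
  refine Subtype.ext (funext fun x => congrArg f.1 (Subtype.ext ?_))
  exact funext fun k => slice_apply hi p x.1 k

/-- A function on a ball whose derivatives in the remaining directions vanish is constant along
these directions. -/
theorem proj_sec {i : Fin m' → Fin m} (hi : Function.Injective i) {p : Fin m → ℝ}
    (hD : Convex ℝ (D : Set (Fin m → ℝ)))
    (h : ∀ y ∈ D', slice i p y ∈ D) (h' : ∀ y ∈ D, y ∘ i ∈ D') {f : Smooth m D}
    (hf : ∀ k ∉ Set.range i, pd k f = 0) : proj i h' (sec i p h f) = f := by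
  refine Subtype.ext (funext fun x => ?_)
  set y := slice i p (x.1 ∘ i) with hy
  have hyD : y ∈ D := h _ (h' _ x.2)
  change f.1 ⟨y, hyD⟩ = f.1 x
  have hseg : ∀ t ∈ Set.Icc (0 : ℝ) 1, x.1 + t • (y - x.1) ∈ D := fun t ht =>
    hD.add_smul_sub_mem x.2 hyD ht
  -- The segment runs from x to the point of the slice over the same base point. Its direction has
  -- no component along the retained coordinates, and f has no derivative along the others.
  have hder : ∀ t ∈ Set.Icc (0 : ℝ) 1,
      HasDerivAt (fun t : ℝ => ext f (x.1 + t • (y - x.1))) 0 t := by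
    intro t ht
    have h1 : HasDerivAt (fun t : ℝ => x.1 + t • (y - x.1)) (y - x.1) t := by
      simpa using ((hasDerivAt_id t).smul_const (y - x.1)).const_add x.1
    refine ((differentiableAt_ext f (hseg t ht)).hasFDerivAt.comp_hasDerivAt t h1).congr_deriv ?_
    rw [clm_apply_eq_sum]
    refine Finset.sum_eq_zero fun k _ => ?_
    by_cases hk : k ∈ Set.range i
    · obtain ⟨k', rfl⟩ := hk
      rw [Pi.sub_apply, hy, slice_apply hi, Function.comp_apply, sub_self, zero_mul]
    · have := congrArg (fun g : Smooth m D => g.1 ⟨_, hseg t ht⟩) (hf k hk)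
      rw [pd_apply] at this
      rw [this]
      exact mul_zero _
  have := constant_of_has_deriv_right_zero (fun t ht => (hder t ht).continuousAt.continuousWithinAt)
    (fun t ht => (hder t ⟨ht.1, ht.2.le⟩).hasDerivWithinAt) 1 ⟨zero_le_one, le_rfl⟩
  simp only [one_smul, zero_smul, add_zero, add_sub_cancel] at this
  rwa [ext_apply f hyD, ext_apply f x.2] at this

end Smooth
end SmoothFunctions

/-! ### The exterior algebra of the odd coordinates -/

/-- The exterior algebra on `n` generators. -/
abbrev Ext (n : ℕ) : Type := ExteriorAlgebra ℝ (Fin n → ℝ)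

namespace Ext

variable {n n' : ℕ}

theorem induction {P : Ext n → Prop} (algebraMap : ∀ r : ℝ, P (algebraMap ℝ _ r))
    (add : ∀ x y, P x → P y → P (x + y))
    (ι_mul : ∀ v x, P x → P (ExteriorAlgebra.ι ℝ v * x)) (x : Ext n) : P x :=
  CliffordAlgebra.left_induction (Q := (0 : QuadraticForm ℝ (Fin n → ℝ))) algebraMap add
    (fun x v => ι_mul v x) x

/-- The derivative in the direction of an odd coordinate. -/
def od (l : Fin n) : Ext n →ₗ[ℝ] Ext n := CliffordAlgebra.contractLeft (LinearMap.proj l)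

/-- The parity involution. -/
def inv : Ext n →ₐ[ℝ] Ext n := CliffordAlgebra.involute

/-- The linear map which sends the `l`-th basis vector to the `j l`-th one. -/
def lc (j : Fin n' → Fin n) : (Fin n' → ℝ) →ₗ[ℝ] (Fin n → ℝ) :=
  Fintype.linearCombination ℝ fun l => Pi.single (j l) (1 : ℝ)

/-- The algebra homomorphism which sends the `l`-th generator to the `j l`-th one. -/
def mp (j : Fin n' → Fin n) : Ext n' →ₐ[ℝ] Ext n := ExteriorAlgebra.map (lc j)

theorem inv_ι (v : Fin n → ℝ) :
    inv (ExteriorAlgebra.ι ℝ v) = -ExteriorAlgebra.ι ℝ v :=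
  CliffordAlgebra.involute_ι v

theorem od_ι_mul (l : Fin n) (v : Fin n → ℝ) (x : Ext n) :
    od l (ExteriorAlgebra.ι ℝ v * x) = v l • x - ExteriorAlgebra.ι ℝ v * od l x :=
  CliffordAlgebra.contractLeft_ι_mul (Q := (0 : QuadraticForm ℝ (Fin n → ℝ))) _ v x

theorem od_algebraMap (l : Fin n) (r : ℝ) : od l (algebraMap ℝ _ r) = 0 :=
  CliffordAlgebra.contractLeft_algebraMap _ _ r

theorem od_ι (l : Fin n) (v : Fin n → ℝ) :
    od l (ExteriorAlgebra.ι ℝ v) = algebraMap ℝ _ (v l) :=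
  CliffordAlgebra.contractLeft_ι (Q := (0 : QuadraticForm ℝ (Fin n → ℝ))) _ v

theorem ι_mul_ι_comm (v w : Fin n → ℝ) : ExteriorAlgebra.ι ℝ v * ExteriorAlgebra.ι ℝ w =
    -(ExteriorAlgebra.ι ℝ w * ExteriorAlgebra.ι ℝ v) :=
  eq_neg_of_add_eq_zero_left (ExteriorAlgebra.ι_add_mul_swap v w)

/-- Moving a generator to the left past x costs one sign for every generator in x, which is what the
involution records. -/
theorem mul_ι (x : Ext n) (v : Fin n → ℝ) :
    x * ExteriorAlgebra.ι ℝ v = ExteriorAlgebra.ι ℝ v * inv x := by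
  induction x using Ext.induction with
  | algebraMap r => rw [AlgHom.commutes, Algebra.commutes]
  | add x y hx hy => rw [add_mul, map_add, mul_add, hx, hy]
  | ι_mul w x hx =>
    rw [mul_assoc, hx, ← mul_assoc, ι_mul_ι_comm, map_mul, inv_ι, neg_mul, neg_mul, mul_neg,
      mul_assoc]

theorem od_mul (l : Fin n) (x y : Ext n) : od l (x * y) = od l x * y + inv x * od l y := by
  induction x using Ext.induction with
  | algebraMap r =>
    rw [← Algebra.smul_def, map_smul, od_algebraMap, zero_mul, zero_add, AlgHom.commutes,
      Algebra.smul_def]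
  | add x x' hx hx' => rw [add_mul, map_add, map_add, hx, hx', map_add]; noncomm_ring
  | ι_mul w x hx =>
    rw [mul_assoc, od_ι_mul, hx, od_ι_mul, map_mul, inv_ι, sub_mul, mul_add, smul_mul_assoc]
    noncomm_ring

theorem od_inv (l : Fin n) (x : Ext n) : od l (inv x) = -inv (od l x) := by
  induction x using Ext.induction with
  | algebraMap r => rw [AlgHom.commutes, od_algebraMap, map_zero, neg_zero]
  | add x y hx hy => rw [map_add, map_add, map_add, map_add, hx, hy, neg_add]
  | ι_mul w x hx =>
    rw [map_mul, inv_ι, neg_mul, map_neg, od_ι_mul, od_ι_mul, hx, map_sub, map_smul, map_mul, inv_ι]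
    noncomm_ring

theorem lc_apply (j : Fin n' → Fin n) (v : Fin n' → ℝ) (l : Fin n) :
    lc j v l = ∑ l', if j l' = l then v l' else 0 := by
  rw [lc, Fintype.linearCombination_apply, Finset.sum_apply]
  refine Finset.sum_congr rfl fun l' _ => ?_
  rw [Pi.smul_apply, Pi.single_apply, smul_eq_mul, mul_ite, mul_one, mul_zero]
  simp only [eq_comm]

theorem lc_apply_self {j : Fin n' → Fin n} (hj : Function.Injective j)
    (v : Fin n' → ℝ) (l : Fin n') :
    lc j v (j l) = v l := by
  simp only [lc_apply, hj.eq_iff, Finset.sum_ite_eq', Finset.mem_univ, if_true]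

theorem lc_apply_of_notMem {j : Fin n' → Fin n} (v : Fin n' → ℝ) {l : Fin n}
    (hl : l ∉ Set.range j) :
    lc j v l = 0 := by
  rw [lc_apply]
  exact Finset.sum_eq_zero fun l' _ => if_neg fun e => hl ⟨l', e⟩

theorem mp_ι (j : Fin n' → Fin n) (v : Fin n' → ℝ) : mp j (ExteriorAlgebra.ι ℝ v) =
    ExteriorAlgebra.ι ℝ (lc j v) :=
  ExteriorAlgebra.map_apply_ι _ v

theorem od_mp {j : Fin n' → Fin n} (hj : Function.Injective j) (l : Fin n') (x : Ext n') :
    od (j l) (mp j x) = mp j (od l x) := by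
  induction x using Ext.induction with
  | algebraMap r => rw [AlgHom.commutes, od_algebraMap, od_algebraMap, map_zero]
  | add x y hx hy => rw [map_add, map_add, map_add, map_add, hx, hy]
  | ι_mul w x hx =>
    rw [map_mul, mp_ι, od_ι_mul, od_ι_mul, map_sub, map_smul, map_mul, mp_ι, hx,
      lc_apply_self hj]

theorem od_mp_of_notMem {j : Fin n' → Fin n} {l : Fin n} (hl : l ∉ Set.range j) (x : Ext n') :
    od l (mp j x) = 0 := by
  induction x using Ext.induction with
  | algebraMap r => rw [AlgHom.commutes, od_algebraMap]
  | add x y hx hy => rw [map_add, map_add, hx, hy, zero_add]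
  | ι_mul w x hx =>
    rw [map_mul, mp_ι, od_ι_mul, hx, lc_apply_of_notMem _ hl, zero_smul, mul_zero,
      sub_zero]

/-- The algebra homomorphism which kills the generators outside the range of `j`. -/
def ms (j : Fin n' → Fin n) : Ext n →ₐ[ℝ] Ext n' := ExteriorAlgebra.map (LinearMap.funLeft ℝ ℝ j)

theorem ms_mp {j : Fin n' → Fin n} (hj : Function.Injective j) (x : Ext n') :
    ms j (mp j x) = x := by
  rw [ms, mp, ← AlgHom.comp_apply, ExteriorAlgebra.map_comp_map]
  have e : (LinearMap.funLeft ℝ ℝ j).comp (lc j) = LinearMap.id :=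
    LinearMap.ext fun v => funext fun l => lc_apply_self hj v l
  rw [e, ExteriorAlgebra.map_id]
  rfl

/-- The projection which kills the coordinates in `s`. -/
def kill (s : Finset (Fin n)) : (Fin n → ℝ) →ₗ[ℝ] (Fin n → ℝ) :=
  LinearMap.pi fun l => if l ∈ s then 0 else LinearMap.proj l

theorem kill_apply (s : Finset (Fin n)) (v : Fin n → ℝ) (l : Fin n) :
    kill s v l = if l ∈ s then 0 else v l := by
  rw [kill, LinearMap.pi_apply]
  split_ifs <;> rfl

/-- Taylor's formula in one odd variable, which stops after the linear term because θ² = 0: x =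
x|_(θ=0) + θ ∂x. -/
theorem eq_map_kill_add (l : Fin n) (x : Ext n) : x = ExteriorAlgebra.map (kill {l}) x +
    ExteriorAlgebra.ι ℝ (Pi.single l 1) * od l x := by
  induction x using Ext.induction with
  | algebraMap r => rw [AlgHom.commutes, od_algebraMap, mul_zero, add_zero]
  | add x y hx hy =>
    rw [map_add, map_add, mul_add]
    nth_rw 1 [hx, hy]
    abel
  | ι_mul v x hx =>
    have e : kill {l} v = v - v l • Pi.single l 1 := by
      funext l'
      rw [kill_apply, Pi.sub_apply, Pi.smul_apply, Pi.single_apply]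
      simp only [Finset.mem_singleton]
      split_ifs with h
      · rw [h, smul_eq_mul, mul_one, sub_self]
      · rw [smul_zero, sub_zero]
    have hx' : ExteriorAlgebra.map (kill {l}) x =
      x - ExteriorAlgebra.ι ℝ (Pi.single l 1) * od l x := eq_sub_of_add_eq hx.symm
    rw [map_mul, ExteriorAlgebra.map_apply_ι, e, hx', od_ι_mul, map_sub, map_smul, sub_mul, mul_sub,
      mul_sub, mul_sub, ← mul_assoc, ← mul_assoc (ExteriorAlgebra.ι ℝ (Pi.single l 1)) _ (od l x),
      ι_mul_ι_comm (Pi.single l 1) v, smul_mul_assoc, smul_mul_assoc, ← mul_assoc,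
      ExteriorAlgebra.ι_sq_zero, mul_smul_comm]
    simp only [zero_mul, smul_zero, neg_mul]
    abel

/-- By Taylor's formula, an element with ∂x = 0 does not change when that generator is set to zero;
the generators in s are removed one at a time. -/
theorem map_kill_eq (s : Finset (Fin n)) {x : Ext n} (hx : ∀ l ∈ s, od l x = 0) :
    ExteriorAlgebra.map (kill s) x = x := by
  induction s using Finset.induction_on with
  | empty =>
    have e : kill (∅ : Finset (Fin n)) = LinearMap.id :=
      LinearMap.ext fun v => funext fun l => by
        rw [kill_apply, if_neg (Finset.notMem_empty l)]; rfl
    rw [e, ExteriorAlgebra.map_id]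
    rfl
  | insert l s hl ih =>
    have e : kill (insert l s) = (kill {l}).comp (kill s) :=
      LinearMap.ext fun v => funext fun l' => by
        rw [LinearMap.comp_apply, kill_apply, kill_apply, kill_apply]
        simp only [Finset.mem_insert, Finset.mem_singleton]
        split_ifs <;> simp_all
    rw [e, ← ExteriorAlgebra.map_comp_map, AlgHom.comp_apply,
      ih fun l' h => hx l' (Finset.mem_insert_of_mem h)]
    conv_rhs => rw [eq_map_kill_add l x, hx l (Finset.mem_insert_self l s), mul_zero, add_zero]

theorem mp_ms {j : Fin n' → Fin n} (hj : Function.Injective j) {x : Ext n}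
    (hx : ∀ l ∉ Set.range j, od l x = 0) : mp j (ms j x) = x := by
  classical
  -- Restricting to the generators in the range of j and including them again amounts to setting all
  -- the others to zero.
  have e : (lc j).comp (LinearMap.funLeft ℝ ℝ j) =
      kill (Finset.univ.filter fun l => l ∉ Set.range j) := by
    refine LinearMap.ext fun v => funext fun l => ?_
    rw [LinearMap.comp_apply, kill_apply]
    by_cases h : l ∈ Set.range j
    · obtain ⟨l', rfl⟩ := h
      rw [lc_apply_self hj, if_neg (by simp)]
      rfl
    · rw [lc_apply_of_notMem _ h, if_pos (by simpa using h)]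
  rw [ms, mp, ← AlgHom.comp_apply, ExteriorAlgebra.map_comp_map, e]
  exact map_kill_eq _ fun l hl => hx l (Finset.mem_filter.1 hl).2

theorem mp_id (x : Ext n) : mp id x = x := by
  have := ms_mp (j := (id : Fin n → Fin n)) Function.injective_id x
  have e : LinearMap.funLeft ℝ ℝ (id : Fin n → Fin n) = LinearMap.id := rfl
  rwa [ms, e, ExteriorAlgebra.map_id] at this

/-- The augmentation. -/
def aug : Ext n →ₐ[ℝ] ℝ := ExteriorAlgebra.algebraMapInv

theorem aug_ι (v : Fin n → ℝ) : aug (ExteriorAlgebra.ι ℝ v) = 0 :=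
  ExteriorAlgebra.lift_ι_apply _ _ _ _

theorem aug_mp (j : Fin n' → Fin n) (x : Ext n') : aug (mp j x) = aug x := by
  induction x using Ext.induction with
  | algebraMap r => rw [AlgHom.commutes, AlgHom.commutes, AlgHom.commutes]
  | add x y hx hy => rw [map_add, map_add, map_add, hx, hy]
  | ι_mul w x hx => rw [map_mul, map_mul, map_mul, mp_ι, aug_ι, aug_ι, zero_mul, zero_mul]

theorem aug_inv (x : Ext n) : aug (inv x) = aug x := by
  induction x using Ext.induction with
  | algebraMap r => rw [AlgHom.commutes, AlgHom.commutes]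
  | add x y hx hy => rw [map_add, map_add, map_add, hx, hy]
  | ι_mul w x hx => rw [map_mul, map_mul, map_mul, inv_ι, map_neg, aug_ι, neg_zero, zero_mul,
      zero_mul]

/-- The augmentation ideal, as a subspace. -/
def augIdeal (n : ℕ) : Submodule ℝ (Ext n) := LinearMap.range (ExteriorAlgebra.ι ℝ) * ⊤

theorem sub_aug_mem (x : Ext n) : x - algebraMap ℝ _ (aug x) ∈ augIdeal n := by
  induction x using Ext.induction with
  | algebraMap r => rw [AlgHom.commutes, Algebra.algebraMap_self_apply, sub_self]; exact zero_mem _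
  | add x y hx hy =>
    rw [map_add, map_add, add_sub_add_comm]
    exact add_mem hx hy
  | ι_mul w x hx =>
    rw [map_mul, aug_ι, zero_mul, map_zero, sub_zero]
    exact Submodule.mul_mem_mul ⟨w, rfl⟩ Submodule.mem_top

/-- Generators can be moved to the left, so the k-th power of the augmentation ideal consists of
multiples of products of k generators. -/
theorem augIdeal_pow_le (k : ℕ) :
    augIdeal n ^ k ≤ LinearMap.range (ExteriorAlgebra.ι ℝ (M := Fin n → ℝ)) ^ k * ⊤ := by
  have hc : (⊤ : Submodule ℝ (Ext n)) * LinearMap.range (ExteriorAlgebra.ι ℝ) ≤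
      LinearMap.range (ExteriorAlgebra.ι ℝ) * ⊤ := by
    rw [Submodule.mul_le]
    rintro x - _ ⟨v, rfl⟩
    rw [mul_ι]
    exact Submodule.mul_mem_mul ⟨v, rfl⟩ Submodule.mem_top
  induction k with
  | zero => rw [pow_zero, pow_zero, one_mul]; exact le_top
  | succ k ih =>
    rw [pow_succ, pow_succ]
    refine (mul_le_mul' ih le_rfl).trans ?_
    rw [augIdeal, mul_assoc, ← mul_assoc ⊤, mul_assoc (_ ^ k)]
    refine mul_le_mul' le_rfl ?_
    refine (mul_le_mul' hc le_rfl).trans ?_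
    rw [mul_assoc]
    exact mul_le_mul' le_rfl le_top

/-- The exterior power of degree n + 1 of an n-dimensional space has dimension given by the binomial
coefficient (n choose n + 1) = 0. -/
theorem augIdeal_pow_eq_bot : augIdeal n ^ (n + 1) = ⊥ := by
  have e : LinearMap.range (ExteriorAlgebra.ι ℝ (M := Fin n → ℝ)) ^ (n + 1) = ⊥ := by
    refine Submodule.finrank_eq_zero.1 ?_
    refine (exteriorPower.finrank_eq (R := ℝ) (M := Fin n → ℝ) (n := n + 1)).trans ?_
    rw [Module.finrank_fin_fun, Nat.choose_succ_self]
  have := augIdeal_pow_le (n := n) (n + 1)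
  rwa [e, Submodule.bot_mul, le_bot_iff] at this

end Ext

/-! ### Superdomains -/

namespace Model

variable {m m' n n' : ℕ} {D : Opens (Fin m → ℝ)} {D' : Opens (Fin m' → ℝ)}

instance : Ring (Model m n D) := Algebra.TensorProduct.instRing

instance : Semiring (Model m n D) := Algebra.TensorProduct.instSemiring

instance : Algebra ℝ (Model m n D) := Algebra.TensorProduct.leftAlgebra

instance : AddCommGroup (Model m n D) := TensorProduct.addCommGroup

instance : AddCommMonoid (Model m n D) := TensorProduct.addCommMonoid

instance : Module ℝ (Model m n D) := TensorProduct.instModule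

theorem induction {P : Model m n D → Prop} (zero : P 0)
    (tmul : ∀ (f : Smooth m D) (x : Ext n), P (f ⊗ₜ[ℝ] x))
    (add : ∀ f g, P f → P g → P (f + g)) (f : Model m n D) : P f :=
  TensorProduct.induction_on f zero tmul add

theorem tmul_mul_tmul (f g : Smooth m D) (x y : Ext n) :
    (f ⊗ₜ[ℝ] x * g ⊗ₜ[ℝ] y : Model m n D) = (f * g) ⊗ₜ[ℝ] (x * y) :=
  Algebra.TensorProduct.tmul_mul_tmul f g x y

theorem inv_tmul (f : Smooth m D) (x : Ext n) :
    Model.inv D (f ⊗ₜ[ℝ] x) = f ⊗ₜ[ℝ] Ext.inv x := rfl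

theorem proj_tmul (i : Fin m' → Fin m) (j : Fin n' → Fin n) (h : ∀ y ∈ D, y ∘ i ∈ D')
    (f : Smooth m' D') (x : Ext n') :
    Model.proj i j h (f ⊗ₜ[ℝ] x) = Smooth.proj i h f ⊗ₜ[ℝ] Ext.mp j x := rfl

theorem res_eq_proj {D D' : Opens (Fin m → ℝ)} (h : D ≤ D') (f : Model m n D') :
    Model.res h f = Model.proj id id (fun _ hy => h hy) f := by
  induction f using Model.induction with
  | zero => rw [map_zero, map_zero]
  | tmul f x => rw [proj_tmul, Ext.mp_id]; rfl
  | add f g hf hg => rw [map_add, map_add, hf, hg]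

/-- The derivative in the direction of an even coordinate. -/
def pd (k : Fin m) : Model m n D →ₗ[ℝ] Model m n D := LinearMap.rTensor _ (Smooth.pd k)

/-- The derivative in the direction of an odd coordinate. -/
def od (l : Fin n) : Model m n D →ₗ[ℝ] Model m n D := LinearMap.lTensor _ (Ext.od l)

theorem pd_tmul (k : Fin m) (f : Smooth m D) (x : Ext n) :
    pd k (f ⊗ₜ[ℝ] x : Model m n D) = Smooth.pd k f ⊗ₜ[ℝ] x := rfl

theorem od_tmul (l : Fin n) (f : Smooth m D) (x : Ext n) :
    od l (f ⊗ₜ[ℝ] x : Model m n D) = f ⊗ₜ[ℝ] Ext.od l x := rfl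

theorem pd_mul (k : Fin m) (f g : Model m n D) : pd k (f * g) = pd k f * g + f * pd k g := by
  induction f using Model.induction with
  | zero => rw [zero_mul, map_zero, zero_mul, zero_mul, zero_add]
  | add f f' hf hf' => rw [add_mul, map_add, map_add, hf, hf']; noncomm_ring
  | tmul f x =>
    induction g using Model.induction with
    | zero => rw [mul_zero, map_zero, mul_zero, mul_zero, zero_add]
    | add g g' hg hg' => rw [mul_add, map_add, map_add, hg, hg']; noncomm_ring
    | tmul g y =>
      rw [tmul_mul_tmul, pd_tmul, pd_tmul, pd_tmul, tmul_mul_tmul, tmul_mul_tmul, Smooth.pd_mul,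
        TensorProduct.add_tmul]

theorem od_mul (l : Fin n) (f g : Model m n D) :
    od l (f * g) = od l f * g + Model.inv D f * od l g := by
  induction f using Model.induction with
  | zero => rw [zero_mul, map_zero, zero_mul, map_zero, zero_mul, zero_add]
  | add f f' hf hf' => rw [add_mul, map_add, map_add, map_add, hf, hf']; noncomm_ring
  | tmul f x =>
    induction g using Model.induction with
    | zero => rw [mul_zero, map_zero, mul_zero, mul_zero, zero_add]
    | add g g' hg hg' => rw [mul_add, map_add, map_add, hg, hg']; noncomm_ring
    | tmul g y =>
      rw [tmul_mul_tmul, od_tmul, od_tmul, od_tmul, inv_tmul, tmul_mul_tmul, tmul_mul_tmul,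
        Ext.od_mul, TensorProduct.tmul_add]

theorem pd_inv (k : Fin m) (f : Model m n D) : pd k (Model.inv D f) = Model.inv D (pd k f) := by
  induction f using Model.induction with
  | zero => simp only [map_zero]
  | add f f' hf hf' => simp only [map_add, hf, hf']
  | tmul f x => rfl

theorem od_inv (l : Fin n) (f : Model m n D) :
    od l (Model.inv D f) = -Model.inv D (od l f) := by
  induction f using Model.induction with
  | zero => simp only [map_zero, neg_zero]
  | add f f' hf hf' => simp only [map_add, hf, hf', neg_add]
  | tmul f x =>
    rw [inv_tmul, od_tmul, od_tmul, inv_tmul, Ext.od_inv]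
    exact TensorProduct.tmul_neg _ _

section proj

variable {i : Fin m' → Fin m} {j : Fin n' → Fin n} (h : ∀ y ∈ D, y ∘ i ∈ D')

theorem pd_proj (hi : Function.Injective i) (k : Fin m') (f : Model m' n' D') :
    pd (i k) (Model.proj i j h f) = Model.proj i j h (pd k f) := by
  induction f using Model.induction with
  | zero => simp only [map_zero]
  | add f f' hf hf' => simp only [map_add, hf, hf']
  | tmul f x => rw [proj_tmul, pd_tmul, pd_tmul, proj_tmul, Smooth.pd_proj hi]

theorem pd_proj_of_notMem {k : Fin m} (hk : k ∉ Set.range i) (f : Model m' n' D') :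
    pd k (Model.proj i j h f) = 0 := by
  induction f using Model.induction with
  | zero => simp only [map_zero]
  | add f f' hf hf' => simp only [map_add, hf, hf', add_zero]
  | tmul f x => rw [proj_tmul, pd_tmul, Smooth.pd_proj_of_notMem h hk, TensorProduct.zero_tmul]

theorem od_proj (hj : Function.Injective j) (l : Fin n') (f : Model m' n' D') :
    od (j l) (Model.proj i j h f) = Model.proj i j h (od l f) := by
  induction f using Model.induction with
  | zero => simp only [map_zero]
  | add f f' hf hf' => simp only [map_add, hf, hf']
  | tmul f x => rw [proj_tmul, od_tmul, od_tmul, proj_tmul, Ext.od_mp hj]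

theorem od_proj_of_notMem {l : Fin n} (hl : l ∉ Set.range j) (f : Model m' n' D') :
    od l (Model.proj i j h f) = 0 := by
  induction f using Model.induction with
  | zero => simp only [map_zero]
  | add f f' hf hf' => simp only [map_add, hf, hf', add_zero]
  | tmul f x => rw [proj_tmul, od_tmul, Ext.od_mp_of_notMem hl, TensorProduct.tmul_zero]

end proj

theorem pd_res {D D' : Opens (Fin m → ℝ)} (h : D ≤ D') (k : Fin m) (f : Model m n D') :
    pd k (Model.res h f) = Model.res h (pd k f) := by
  rw [res_eq_proj, res_eq_proj]
  exact pd_proj _ Function.injective_id k f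

theorem od_res {D D' : Opens (Fin m → ℝ)} (h : D ≤ D') (l : Fin n) (f : Model m n D') :
    od l (Model.res h f) = Model.res h (od l f) := by
  rw [res_eq_proj, res_eq_proj]
  exact od_proj _ Function.injective_id l f

theorem pd_even (k k' : Fin m) : pd k (Model.even (n := n) D k') = if k' = k then 1 else 0 := by
  change Smooth.pd k (Smooth.coord D k') ⊗ₜ[ℝ] (1 : Ext n) = _
  rw [Smooth.pd_coord]
  split_ifs
  · rw [map_one]; rfl
  · rw [map_zero, TensorProduct.zero_tmul]

theorem pd_odd (k : Fin m) (l : Fin n) : pd k (Model.odd D l) = 0 := by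
  change Smooth.pd k (1 : Smooth m D) ⊗ₜ[ℝ] _ = _
  have e := Smooth.pd_mul k (1 : Smooth m D) 1
  rw [mul_one, mul_one, one_mul, left_eq_add] at e
  rw [e, TensorProduct.zero_tmul]

theorem od_even (l : Fin n) (k : Fin m) : od l (Model.even D k) = 0 := by
  change _ ⊗ₜ[ℝ] Ext.od l 1 = _
  have e := Ext.od_algebraMap l 1
  rw [map_one] at e
  rw [e, TensorProduct.tmul_zero]

theorem od_odd (l l' : Fin n) : od l (Model.odd (m := m) D l') = if l' = l then 1 else 0 := by
  change (1 : Smooth m D) ⊗ₜ[ℝ] Ext.od l (ExteriorAlgebra.ι ℝ (Pi.single l' 1)) = _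
  rw [Ext.od_ι, Pi.single_apply]
  simp only [eq_comm (a := l)]
  split_ifs
  · rw [map_one]; rfl
  · rw [map_zero, TensorProduct.tmul_zero]

theorem inv_even (k : Fin m) : Model.inv D (Model.even (n := n) D k) = Model.even D k := by
  change _ ⊗ₜ[ℝ] Ext.inv 1 = _
  rw [map_one]; rfl

theorem inv_odd (l : Fin n) : Model.inv D (Model.odd (m := m) D l) = -Model.odd D l := by
  change (1 : Smooth m D) ⊗ₜ[ℝ] Ext.inv (ExteriorAlgebra.ι ℝ (Pi.single l 1)) = _
  rw [Ext.inv_ι]; exact TensorProduct.tmul_neg _ _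

/-- The coefficient of a superfunction with respect to a functional on the exterior algebra. -/
def coef (φ : Ext n →ₗ[ℝ] ℝ) : Model m n D →ₗ[ℝ] Smooth m D :=
  (TensorProduct.rid ℝ (Smooth m D)).toLinearMap ∘ₗ LinearMap.lTensor (Smooth m D) φ

theorem coef_tmul (φ : Ext n →ₗ[ℝ] ℝ) (f : Smooth m D) (x : Ext n) :
    coef φ (f ⊗ₜ[ℝ] x : Model m n D) = φ x • f :=
  TensorProduct.rid_tmul f (φ x)

/-- A superfunction is the finite sum of its coefficients times the elements of a basis of the
exterior algebra. -/
theorem eq_zero_of_coef {f : Model m n D} (hf : ∀ φ : Ext n →ₗ[ℝ] ℝ, coef φ f = 0) : f = 0 := by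
  classical
  let b := (Pi.basisFun ℝ (Fin n)).ExteriorAlgebra
  have e : ∀ g : Model m n D, g = ∑ s, coef (b.coord s) g ⊗ₜ[ℝ] b s := by
    intro g
    induction g using Model.induction with
    | zero => simp only [map_zero, TensorProduct.zero_tmul, Finset.sum_const_zero]
    | add g g' hg hg' =>
      simp only [map_add, TensorProduct.add_tmul, Finset.sum_add_distrib]
      rw [← hg, ← hg']
    | tmul g x =>
      simp only [coef_tmul, TensorProduct.smul_tmul]
      rw [← TensorProduct.tmul_sum]
      congr 1
      exact (b.sum_repr x).symm
  rw [e f]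
  exact Finset.sum_eq_zero fun s _ => by rw [hf, TensorProduct.zero_tmul]

theorem ext_coef {f g : Model m n D} (h : ∀ φ : Ext n →ₗ[ℝ] ℝ, coef φ f = coef φ g) : f = g :=
  sub_eq_zero.1 (eq_zero_of_coef fun φ => by rw [map_sub, h, sub_self])

/-- Evaluation at a point. -/
def ev (p : D) : Model m n D →ₐ[ℝ] Ext n :=
  (Algebra.TensorProduct.lid ℝ (Ext n)).toAlgHom.comp
    (Algebra.TensorProduct.map ((Pi.evalAlgHom ℝ (fun _ : D => ℝ) p).comp (Smooth m D).val)
      (AlgHom.id ℝ _))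

theorem ev_tmul (p : D) (f : Smooth m D) (x : Ext n) :
    ev p (f ⊗ₜ[ℝ] x : Model m n D) = f.1 p • x := TensorProduct.lid_tmul x (f.1 p)

theorem coef_apply (φ : Ext n →ₗ[ℝ] ℝ) (f : Model m n D) (p : D) :
    (coef φ f).1 p = φ (ev p f) := by
  induction f using Model.induction with
  | zero => rw [map_zero, map_zero, map_zero]; rfl
  | add f g hf hg => rw [map_add, map_add, map_add, ← hf, ← hg]; rfl
  | tmul f x =>
    rw [coef_tmul, ev_tmul, map_smul, smul_eq_mul, mul_comm]
    rfl

theorem eq_zero_of_ev {f : Model m n D} (h : ∀ p, ev p f = 0) : f = 0 :=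
  eq_zero_of_coef fun φ => Subtype.ext (funext fun p => by rw [coef_apply, h, map_zero]; rfl)

/-- Restriction to the image of a section of a coordinate projection. -/
def sec (i : Fin m' → Fin m) (j : Fin n' → Fin n) (p : Fin m → ℝ)
    (h : ∀ y ∈ D', Smooth.slice i p y ∈ D) : Model m n D →ₐ[ℝ] Model m' n' D' :=
  Algebra.TensorProduct.map (Smooth.sec i p h) (Ext.ms j)

theorem sec_proj {i : Fin m' → Fin m} (hi : Function.Injective i) {j : Fin n' → Fin n}
    (hj : Function.Injective j) (p : Fin m → ℝ)
    (h : ∀ y ∈ D', Smooth.slice i p y ∈ D) (h' : ∀ y ∈ D, y ∘ i ∈ D') (f : Model m' n' D') :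
    sec i j p h (Model.proj i j h' f) = f := by
  induction f using Model.induction with
  | zero => simp only [map_zero]
  | add f f' hf hf' => simp only [map_add, hf, hf']
  | tmul f x =>
    change Smooth.sec i p h (Smooth.proj i h' f) ⊗ₜ[ℝ] Ext.ms j (Ext.mp j x) = _
    rw [Smooth.sec_proj hi, Ext.ms_mp hj]

theorem coef_rTensor (φ : Ext n →ₗ[ℝ] ℝ) (T : Smooth m D →ₗ[ℝ] Smooth m D) (f : Model m n D) :
    coef φ (LinearMap.rTensor _ T f) = T (coef φ f) := by
  induction f using Model.induction with
  | zero => simp only [map_zero]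
  | add f f' hf hf' => simp only [map_add, hf, hf']
  | tmul f x => rw [LinearMap.rTensor_tmul, coef_tmul, coef_tmul, map_smul]

theorem coef_pd (φ : Ext n →ₗ[ℝ] ℝ) (k : Fin m) (f : Model m n D) :
    coef φ (pd k f) = Smooth.pd k (coef φ f) := coef_rTensor φ _ f

theorem ev_lTensor (p : D) (T : Ext n →ₗ[ℝ] Ext n) (f : Model m n D) :
    ev p (LinearMap.lTensor _ T f) = T (ev p f) := by
  induction f using Model.induction with
  | zero => simp only [map_zero]
  | add f f' hf hf' => simp only [map_add, hf, hf']
  | tmul f x => rw [LinearMap.lTensor_tmul, ev_tmul, ev_tmul, map_smul]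

/-- A superfunction on a convex domain which is annihilated by the derivatives in the directions
of the fibres of a coordinate projection is a pull-back. -/
theorem proj_sec {i : Fin m' → Fin m} (hi : Function.Injective i) {j : Fin n' → Fin n}
    (hj : Function.Injective j) {p : Fin m → ℝ} (hD : Convex ℝ (D : Set (Fin m → ℝ)))
    (h : ∀ y ∈ D', Smooth.slice i p y ∈ D) (h' : ∀ y ∈ D, y ∘ i ∈ D') {f : Model m n D}
    (hf : ∀ k ∉ Set.range i, pd k f = 0) (hf' : ∀ l ∉ Set.range j, od l f = 0) :
    Model.proj i j h' (sec i j p h f) = f := by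
  classical
  -- The composite acts on the two tensor factors separately. The odd factor is handled after
  -- evaluation at points, the even factor by taking coefficients; each of these commutes with the
  -- relevant derivatives.
  have e1 : ∀ f : Model m n D, Model.proj i j h' (sec i j p h f) = LinearMap.rTensor _
      ((Smooth.proj i h').toLinearMap ∘ₗ (Smooth.sec i p h).toLinearMap)
      (LinearMap.lTensor _ ((Ext.mp j).toLinearMap ∘ₗ (Ext.ms j).toLinearMap) f) := by
    intro f
    induction f using Model.induction with
    | zero => simp only [map_zero]
    | add f f' hf hf' => simp only [map_add, hf, hf']
    | tmul f x => rfl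
  have e2 : LinearMap.lTensor _ ((Ext.mp j).toLinearMap ∘ₗ (Ext.ms j).toLinearMap) f = f := by
    refine sub_eq_zero.1 (eq_zero_of_ev fun p => ?_)
    rw [map_sub, ev_lTensor, sub_eq_zero]
    exact Ext.mp_ms hj fun l hl =>
      (ev_lTensor p (Ext.od l) f).symm.trans ((congrArg (ev p) (hf' l hl)).trans (map_zero _))
  rw [e1, e2]
  refine ext_coef fun φ => ?_
  rw [coef_rTensor]
  exact Smooth.proj_sec hi hD h h' fun k hk => by rw [← coef_pd, hf k hk, map_zero]

end Model

/-! ### Invertibility modulo nilpotents, and superderivations in coordinates -/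

namespace Smooth

theorem isUnit_of_ne_zero {m : ℕ} {D : Opens (Fin m → ℝ)} {f : Smooth m D} (hf : ∀ x, f.1 x ≠ 0) :
    IsUnit f := by
  obtain ⟨g, hg, e⟩ := f.2
  have h0 : ∀ x ∈ D, g x ≠ 0 := fun x hx => by rw [← e ⟨x, hx⟩]; exact hf _
  refine IsUnit.of_mul_eq_one (mk (fun x => (g x)⁻¹) (hg.inv h0)) ?_
  refine Subtype.ext (funext fun x => ?_)
  change f.1 x * (g x)⁻¹ = 1
  rw [e]
  exact mul_inv_cancel₀ (h0 x.1 x.2)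

end Smooth

namespace Model

variable {m m' n n' : ℕ} {D : Opens (Fin m → ℝ)} {D' : Opens (Fin m' → ℝ)}

/-- The underlying smooth function of a superfunction. -/
def body : Model m n D →ₐ[ℝ] Smooth m D :=
  (Algebra.TensorProduct.rid ℝ ℝ (Smooth m D)).toAlgHom.comp
    (Algebra.TensorProduct.map (AlgHom.id ℝ _) Ext.aug)

theorem body_tmul (f : Smooth m D) (x : Ext n) :
    body (f ⊗ₜ[ℝ] x : Model m n D) = Ext.aug x • f := TensorProduct.rid_tmul f (Ext.aug x)

theorem body_proj (i : Fin m' → Fin m) (j : Fin n' → Fin n) (h : ∀ y ∈ D, y ∘ i ∈ D')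
    (f : Model m' n' D') : body (Model.proj i j h f) = Smooth.proj i h (body f) := by
  induction f using Model.induction with
  | zero => simp only [map_zero]
  | add f f' hf hf' => simp only [map_add, hf, hf']
  | tmul f x => rw [proj_tmul, body_tmul, body_tmul, map_smul, Ext.aug_mp]

theorem body_res {D D' : Opens (Fin m → ℝ)} (h : D ≤ D') (f : Model m n D') (x : D) :
    (body (Model.res h f)).1 x = (body f).1 ⟨x.1, h x.2⟩ := by
  rw [res_eq_proj, body_proj]
  rfl

theorem body_inv (f : Model m n D) : body (Model.inv D f) = body f := by
  induction f using Model.induction with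
  | zero => simp only [map_zero]
  | add f f' hf hf' => simp only [map_add, hf, hf']
  | tmul f x => rw [inv_tmul, body_tmul, body_tmul, Ext.aug_inv]

/-- The filtration of superfunctions by powers of the augmentation ideal. -/
def fil (m n : ℕ) (D : Opens (Fin m → ℝ)) (k : ℕ) : Submodule ℝ (Model m n D) :=
  Submodule.span ℝ {f | ∃ (g : Smooth m D) (x : Ext n), x ∈ Ext.augIdeal n ^ k ∧ g ⊗ₜ[ℝ] x = f}

theorem mul_mem_fil {k l : ℕ} {f g : Model m n D} (hf : f ∈ fil m n D k) (hg : g ∈ fil m n D l) :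
    f * g ∈ fil m n D (k + l) := by
  have h : fil m n D k * fil m n D l ≤ fil m n D (k + l) := by
    rw [fil, fil, Submodule.span_mul_span, Submodule.span_le]
    rintro _ ⟨_, ⟨f, x, hx, rfl⟩, _, ⟨g, y, hy, rfl⟩, rfl⟩
    refine Submodule.subset_span ⟨f * g, x * y, ?_, (tmul_mul_tmul f g x y).symm⟩
    rw [pow_add]
    exact Submodule.mul_mem_mul hx hy
  exact h (Submodule.mul_mem_mul hf hg)

theorem fil_eq_bot : fil m n D (n + 1) = ⊥ := by
  rw [fil, Submodule.span_eq_bot]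
  rintro _ ⟨f, x, hx, rfl⟩
  rw [Ext.augIdeal_pow_eq_bot, Submodule.mem_bot] at hx
  rw [hx, TensorProduct.tmul_zero]

theorem tmul_one_mem_fil (f : Smooth m D) : (f ⊗ₜ[ℝ] 1 : Model m n D) ∈ fil m n D 0 :=
  Submodule.subset_span ⟨f, 1, by rw [pow_zero]; exact Submodule.one_le.1 le_rfl, rfl⟩

theorem sub_body_mem_fil (f : Model m n D) : f - body f ⊗ₜ[ℝ] 1 ∈ fil m n D 1 := by
  induction f using Model.induction with
  | zero => rw [map_zero, TensorProduct.zero_tmul, sub_zero]; exact zero_mem _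
  | add f f' hf hf' =>
    rw [map_add, TensorProduct.add_tmul, add_sub_add_comm]
    exact add_mem hf hf'
  | tmul f x =>
    refine Submodule.subset_span ⟨f, x - algebraMap ℝ _ (Ext.aug x), ?_, ?_⟩
    · rw [pow_one]
      exact Ext.sub_aug_mem x
    · rw [body_tmul, TensorProduct.tmul_sub, TensorProduct.smul_tmul,
        Algebra.algebraMap_eq_smul_one]

variable {ι : Type} [Fintype ι] [DecidableEq ι]

/-- The entries of the k-th power lie in step k of the filtration, and step n + 1 is zero. -/
theorem isNilpotent_of_mem_fil {N : Matrix ι ι (Model m n D)} (hN : ∀ a b, N a b ∈ fil m n D 1) :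
    IsNilpotent N := by
  refine ⟨n + 1, ?_⟩
  have h : ∀ k, ∀ a b, (N ^ (k + 1)) a b ∈ fil m n D (k + 1) := by
    intro k
    induction k with
    | zero => intro a b; rw [zero_add, pow_one]; exact hN a b
    | succ k ih =>
      intro a b
      rw [pow_succ, Matrix.mul_apply]
      exact sum_mem fun c _ => mul_mem_fil (ih a c) (hN c b)
  refine Matrix.ext fun a b => ?_
  have := h n a b
  rwa [fil_eq_bot, Submodule.mem_bot] at this

/-- A matrix of superfunctions is invertible if its body is. -/
theorem isUnit_of_body {M : Matrix ι ι (Model m n D)} (hM : ∀ x, ((M.map body).det).1 x ≠ 0) :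
    IsUnit M := by
  let c : Smooth m D →+* Model m n D :=
    (Algebra.TensorProduct.includeLeft : Smooth m D →ₐ[ℝ] Model m n D).toRingHom
  have hU : IsUnit (M.map body) :=
    (Matrix.isUnit_iff_isUnit_det _).2 (Smooth.isUnit_of_ne_zero hM)
  obtain ⟨B, hB1, hB2⟩ := isUnit_iff_exists.1 hU
  have hc1 : (M.map body).map c * B.map c = 1 := by
    rw [← Matrix.map_mul, hB1, Matrix.map_one c (map_zero c) (map_one c)]
  have hc2 : B.map c * (M.map body).map c = 1 := by
    rw [← Matrix.map_mul, hB2, Matrix.map_one c (map_zero c) (map_one c)]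
  have hN : ∀ a b, (M - (M.map body).map c) a b ∈ fil m n D 1 := fun a b =>
    sub_body_mem_fil (M a b)
  have hBN : IsNilpotent (B.map c * (M - (M.map body).map c)) := by
    refine isNilpotent_of_mem_fil fun a b => ?_
    rw [Matrix.mul_apply]
    refine sum_mem fun d _ => ?_
    have := mul_mem_fil (tmul_one_mem_fil (n := n) (B a d)) (hN d b)
    rwa [zero_add] at this
  -- M differs from its body by entries in the augmentation ideal, so M is the product of an
  -- invertible matrix of smooth functions and a matrix 1 + N with N nilpotent. No determinant over
  -- the supercommutative ring is needed.
  have e : M = (M.map body).map c * (1 + B.map c * (M - (M.map body).map c)) := by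
    rw [mul_add, mul_one, ← mul_assoc, hc1, one_mul, add_sub_cancel]
  rw [e]
  exact (isUnit_iff_exists.2 ⟨_, hc1, hc2⟩).mul hBN.isUnit_one_add

/-- The `a`-th power of the parity involution. -/
def tw (a : ZMod 2) : Model m n D →ₐ[ℝ] Model m n D :=
  if a = 0 then AlgHom.id ℝ _ else Model.inv D

theorem tw_tmul_one (a : ZMod 2) (f : Smooth m D) :
    tw a (f ⊗ₜ[ℝ] 1 : Model m n D) = f ⊗ₜ[ℝ] 1 := by
  rcases parity_cases a with rfl | rfl
  · rfl
  · change Model.inv D _ = _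
    rw [inv_tmul, map_one]

/-- A superderivation of a superdomain which annihilates the coordinates vanishes. -/
theorem derivation_eq_zero {a : ZMod 2} {X : Model m n D →ₗ[ℝ] Model m n D}
    (hX : ∀ f g, X (f * g) = X f * g + tw a f * X g)
    (heven : ∀ k, X (Model.even D k) = 0) (hodd : ∀ l, X (Model.odd D l) = 0) : X = 0 := by
  have h1 : X 1 = 0 := by
    have := hX 1 1
    rw [mul_one, mul_one, map_one (tw a), one_mul, left_eq_add] at this
    exact this
  have hc : ∀ r : ℝ, X (algebraMap ℝ _ r) = 0 := fun r => by
    rw [Algebra.algebraMap_eq_smul_one, map_smul, h1, smul_zero]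
  -- functions of the odd coordinates
  have hΛ : ∀ x : Ext n, X (1 ⊗ₜ[ℝ] x) = 0 := by
    intro x
    induction x using Ext.induction with
    | algebraMap r =>
      rw [Algebra.algebraMap_eq_smul_one, TensorProduct.tmul_smul, map_smul]
      exact (congrArg (r • ·) h1).trans (smul_zero r)
    | add x y hx hy => rw [TensorProduct.tmul_add, map_add, hx, hy, add_zero]
    | ι_mul v x hx =>
      have e : (1 ⊗ₜ[ℝ] (ExteriorAlgebra.ι ℝ v * x) : Model m n D) =
          1 ⊗ₜ[ℝ] ExteriorAlgebra.ι ℝ v * 1 ⊗ₜ[ℝ] x := by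
        rw [tmul_mul_tmul, mul_one]
      have e' : (1 ⊗ₜ[ℝ] ExteriorAlgebra.ι ℝ v : Model m n D) = ∑ l, v l • Model.odd D l := by
        conv_lhs => rw [← Finset.univ_sum_single v, map_sum, TensorProduct.tmul_sum]
        refine Finset.sum_congr rfl fun l _ => ?_
        have : (Pi.single l (v l) : Fin n → ℝ) = v l • Pi.single l 1 := by
          rw [← Pi.single_smul, smul_eq_mul, mul_one]
        rw [this, map_smul, TensorProduct.tmul_smul]
        rfl
      rw [e, hX, hx, mul_zero, add_zero, e', map_sum]
      simp only [map_smul, hodd, smul_zero, Finset.sum_const_zero, zero_mul]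
  -- restrictions of smooth functions on the whole space
  have hG : ∀ (p : D) (g : (Fin m → ℝ) → ℝ) (hg : ContDiff ℝ (⊤ : ℕ∞) g),
      ev p (X ((Smooth.mk g hg.contDiffOn : Smooth m D) ⊗ₜ[ℝ] 1)) = 0 := by
    intro p g hg
    -- Expanding g at the very point p of evaluation: X annihilates constants and coordinates, so X
    -- g is a sum of terms (x_k - p_k) X h_k, and these vanish at p.
    obtain ⟨h, hh, e⟩ := exists_hadamard hg p.1
    have e' : ((Smooth.mk g hg.contDiffOn : Smooth m D) ⊗ₜ[ℝ] 1 : Model m n D) =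
        algebraMap ℝ _ (g p) + ∑ k, (Model.even D k - algebraMap ℝ _ (p.1 k)) *
          (Smooth.mk (h k) (hh k).contDiffOn : Smooth m D) ⊗ₜ[ℝ] 1 := by
      have : (Smooth.mk g hg.contDiffOn : Smooth m D) = algebraMap ℝ _ (g p) +
          ∑ k, (Smooth.coord D k - algebraMap ℝ _ (p.1 k)) *
            (Smooth.mk (h k) (hh k).contDiffOn : Smooth m D) := by
        refine Subtype.ext (funext fun x => ?_)
        have hs : ∀ (s : Finset (Fin m)) (F : Fin m → Smooth m D),
            (∑ k ∈ s, F k).1 x = ∑ k ∈ s, (F k).1 x := fun s F => by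
          rw [AddSubmonoidClass.coe_finsetSum, Finset.sum_apply]
        change g x = g p + (∑ k, (_ : Smooth m D)).1 x
        rw [hs]
        exact e x
      rw [this, TensorProduct.add_tmul, TensorProduct.sum_tmul]
      congr 1
      refine Finset.sum_congr rfl fun k _ => ?_
      change _ = (_ ⊗ₜ[ℝ] 1 - _ ⊗ₜ[ℝ] 1) * _
      rw [← TensorProduct.sub_tmul, tmul_mul_tmul, mul_one]
      rfl
    rw [e', map_add, hc, zero_add, map_sum, map_sum]
    refine Finset.sum_eq_zero fun k _ => ?_
    have e0 : (Model.even D k - algebraMap ℝ _ (p.1 k) : Model m n D) =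
        (Smooth.coord D k - algebraMap ℝ _ (p.1 k)) ⊗ₜ[ℝ] 1 := by
      rw [TensorProduct.sub_tmul]
      rfl
    rw [hX, map_sub, heven, hc, sub_zero, zero_mul, zero_add, e0, tw_tmul_one, map_mul, ev_tmul]
    have : (Smooth.coord D k - algebraMap ℝ _ (p.1 k) : Smooth m D).1 p = 0 := sub_self (p.1 k)
    rw [this, zero_smul, zero_mul]
  have hA : ∀ f : Smooth m D, X (f ⊗ₜ[ℝ] 1) = 0 := by
    intro f
    refine eq_zero_of_ev fun p => ?_
    obtain ⟨g, hg, e⟩ := f.2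
    obtain ⟨r, hr, hrD⟩ := Metric.isOpen_iff.1 D.2 p.1 p.2
    -- A function on D need not extend to ℝ^m, but χ f does when χ is supported in a ball inside D.
    -- The globally defined χ and χ f both have X-derivative zero at p, and χ(p) = 1, so the Leibniz
    -- rule gives (X f)(p) = 0.
    let χ : ContDiffBump p.1 := ⟨r / 3, r / 2, by positivity, by linarith⟩
    have hχ : ContDiff ℝ (⊤ : ℕ∞) χ := χ.contDiff
    have hχg : ContDiff ℝ (⊤ : ℕ∞) fun x => χ x * g x := by
      rw [contDiff_iff_contDiffAt]
      intro x
      by_cases hx : x ∈ D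
      · exact hχ.contDiffAt.mul (hg.contDiffAt (D.2.mem_nhds hx))
      · have : (fun x => χ x * g x) =ᶠ[nhds x] fun _ => 0 := by
          have hx' : x ∉ tsupport χ := by
            rw [χ.tsupport_eq]
            exact fun h =>
              hx (hrD (Metric.closedBall_subset_ball (by change r / 2 < r; linarith) h))
          filter_upwards [notMem_tsupport_iff_eventuallyEq.1 hx'] with y hy
          rw [hy, Pi.zero_apply, zero_mul]
        exact contDiffAt_const.congr_of_eventuallyEq this
    have e' : ((Smooth.mk (fun x => χ x * g x) hχg.contDiffOn : Smooth m D) ⊗ₜ[ℝ] 1 :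
        Model m n D) = (Smooth.mk χ hχ.contDiffOn : Smooth m D) ⊗ₜ[ℝ] 1 * f ⊗ₜ[ℝ] 1 := by
      rw [tmul_mul_tmul, mul_one]
      congr 1
      refine Subtype.ext (funext fun x => ?_)
      change χ x * g x = χ x * f.1 x
      rw [e]
    have h0 := hG p _ hχg
    rw [e', hX, map_add, map_mul, map_mul, hG p _ hχ, zero_mul, zero_add, tw_tmul_one, ev_tmul,
      Smooth.mk_apply, χ.one_of_mem_closedBall (Metric.mem_closedBall_self (by
        change 0 ≤ r / 3; positivity)), one_smul, one_mul] at h0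
    exact h0
  refine LinearMap.ext fun f => ?_
  induction f using Model.induction with
  | zero => rw [map_zero, map_zero]
  | add f f' hf hf' => rw [map_add, map_add, hf, hf']
  | tmul f x =>
    have e : (f ⊗ₜ[ℝ] x : Model m n D) = f ⊗ₜ[ℝ] 1 * 1 ⊗ₜ[ℝ] x := by
      rw [tmul_mul_tmul, mul_one, one_mul]
    rw [e, hX, hA, hΛ, zero_mul, mul_zero, add_zero]
    rfl

end Model

/-! ### Even and odd coordinates together -/

namespace Model

variable {m m' n n' : ℕ} {D : Opens (Fin m → ℝ)} {D' : Opens (Fin m' → ℝ)}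

/-- The parity of a coordinate. -/
def par : Fin m ⊕ Fin n → ZMod 2 := Sum.elim (fun _ => 0) fun _ => 1

/-- The coordinates. -/
def z (D : Opens (Fin m → ℝ)) : Fin m ⊕ Fin n → Model m n D := Sum.elim (Model.even D) (Model.odd D)

/-- The coordinate derivations. -/
def d : Fin m ⊕ Fin n → Model m n D →ₗ[ℝ] Model m n D := Sum.elim pd od

theorem d_mul (A : Fin m ⊕ Fin n) (f g : Model m n D) :
    d A (f * g) = d A f * g + tw (par A) f * d A g := by
  rcases A with k | l
  · exact pd_mul k f g
  · exact od_mul l f g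

theorem d_inv (A : Fin m ⊕ Fin n) (f : Model m n D) :
    d A (Model.inv D f) = sgn (par A) • Model.inv D (d A f) := by
  rcases A with k | l
  · exact (pd_inv k f).trans (by rw [par, Sum.elim_inl, sgn_zero, one_smul]; rfl)
  · exact (od_inv l f).trans (by rw [par, Sum.elim_inr, sgn_one, neg_one_smul]; rfl)

theorem d_res {D D' : Opens (Fin m → ℝ)} (h : D ≤ D') (A : Fin m ⊕ Fin n) (f : Model m n D') :
    d A (Model.res h f) = Model.res h (d A f) := by
  rcases A with k | l
  · exact pd_res h k f
  · exact od_res h l f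

theorem d_z (A B : Fin m ⊕ Fin n) : d A (z D B) = if B = A then 1 else 0 := by
  rcases A with k | l <;> rcases B with k' | l'
  · exact (pd_even k k').trans (by simp only [Sum.inl.injEq])
  · exact (pd_odd k l').trans (by simp only [reduceCtorEq, if_false])
  · exact (od_even l k').trans (by simp only [reduceCtorEq, if_false])
  · exact (od_odd l l').trans (by simp only [Sum.inr.injEq])

theorem inv_z (A : Fin m ⊕ Fin n) : Model.inv D (z D A) = sgn (par A) • z D A := by
  rcases A with k | l
  · exact (inv_even k).trans (by rw [par, Sum.elim_inl, sgn_zero, one_smul]; rfl)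
  · exact (inv_odd l).trans (by rw [par, Sum.elim_inr, sgn_one, neg_one_smul]; rfl)

section proj

variable {i : Fin m' → Fin m} {j : Fin n' → Fin n} (h : ∀ y ∈ D, y ∘ i ∈ D')

theorem d_proj (hi : Function.Injective i) (hj : Function.Injective j) (A : Fin m' ⊕ Fin n')
    (f : Model m' n' D') : d (Sum.map i j A) (Model.proj i j h f) = Model.proj i j h (d A f) := by
  rcases A with k | l
  · exact pd_proj h hi k f
  · exact od_proj h hj l f

theorem d_proj_of_notMem {A : Fin m ⊕ Fin n} (hA : A ∉ Set.range (Sum.map i j))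
    (f : Model m' n' D') : d A (Model.proj i j h f) = 0 := by
  rcases A with k | l
  · exact pd_proj_of_notMem h (fun ⟨k', e⟩ => hA ⟨Sum.inl k', congrArg Sum.inl e⟩) f
  · exact od_proj_of_notMem h (fun ⟨k', e⟩ => hA ⟨Sum.inr k', congrArg Sum.inr e⟩) f

theorem proj_z (A : Fin m' ⊕ Fin n') : Model.proj i j h (z D' A) = z D (Sum.map i j A) := by
  rcases A with k | l
  · change _ ⊗ₜ[ℝ] Ext.mp j 1 = _
    rw [map_one]
    rfl
  · change Smooth.proj i h 1 ⊗ₜ[ℝ] Ext.mp j (ExteriorAlgebra.ι ℝ (Pi.single l 1)) = _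
    have e : Ext.lc j (Pi.single l 1) = Pi.single (j l) 1 := by
      rw [Ext.lc, Fintype.linearCombination_apply_single, one_smul]
    rw [map_one, Ext.mp_ι, e]
    rfl

end proj

theorem res_z {D D' : Opens (Fin m → ℝ)} (h : D ≤ D') (A : Fin m ⊕ Fin n) :
    Model.res h (z D' A) = z D A := by
  rw [res_eq_proj, proj_z, Sum.map_id_id]
  rfl

end Model

/-! ### Charts -/

namespace Chart

variable {F : SuperSpace.{u}} {m n : ℕ} (c : Chart F m n) {U V W : Opens F.carrier}
  {a b : ZMod 2}

/-- The coordinate expression of a superfunction. -/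
def loc (hW : W ≤ c.dom) : F.Fun W ≃ₐ[ℝ] Model m n (chartImage c.body W) := c.iso W hW

theorem loc_res (hW : W ≤ c.dom) (h : V ≤ W) (f : F.Fun W) : c.loc (h.trans hW) (F.res h f) =
    Model.res (chartImage_mono c.body h) (c.loc hW f) := c.iso_res W V h hW f

theorem loc_tw (hW : W ≤ c.dom) (f : F.Fun W) :
    c.loc hW (F.tw a f) = Model.tw a (c.loc hW f) := by
  rcases parity_cases a with rfl | rfl
  · rfl
  · exact c.iso_inv W hW f

/-- The coordinates of a chart. -/
def z (A : Fin m ⊕ Fin n) : F.Fun c.dom := (c.loc le_rfl).symm (Model.z _ A)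

theorem loc_z (hW : W ≤ c.dom) (A : Fin m ⊕ Fin n) :
    c.loc hW (F.res hW (c.z A)) = Model.z _ A := by
  have := c.loc_res le_rfl hW (c.z A)
  rw [z, AlgEquiv.apply_symm_apply, Model.res_z] at this
  exact this

theorem isPar_z (A : Fin m ⊕ Fin n) : F.IsPar (Model.par A) (c.z A) := by
  refine (c.loc le_rfl).injective ?_
  refine (c.iso_inv c.dom le_rfl (c.z A)).trans ?_
  have e : c.iso c.dom le_rfl (c.z A) = Model.z _ A := AlgEquiv.apply_symm_apply _ _
  rw [map_smul, e, Model.inv_z]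
  exact congrArg (_ • ·) e.symm

/-- The coordinate vector fields of a chart. -/
def fld (A : Fin m ⊕ Fin n) : VF F c.dom (Model.par A) :=
  ⟨fun W => (c.loc W.2).symm.toLinearMap ∘ₗ Model.d A ∘ₗ (c.loc W.2).toLinearMap, by
    refine ⟨fun W W' hW h f => ?_, fun W hW f => ?_, fun W hW f g => ?_⟩
    · change (c.loc (h.trans hW)).symm (Model.d A (c.loc (h.trans hW) (F.res h f))) =
        F.res h ((c.loc hW).symm (Model.d A (c.loc hW f)))
      rw [AlgEquiv.symm_apply_eq, c.loc_res hW h, c.loc_res hW h, AlgEquiv.apply_symm_apply,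
        Model.d_res]
    · change (c.loc hW).symm (Model.d A (c.loc hW (F.tw 1 f))) =
        _ • F.tw 1 ((c.loc hW).symm (Model.d A (c.loc hW f)))
      rw [AlgEquiv.symm_apply_eq, map_smul, loc_tw, loc_tw, AlgEquiv.apply_symm_apply]
      exact Model.d_inv A _
    · change (c.loc hW).symm (Model.d A (c.loc hW (f * g))) =
        (c.loc hW).symm (Model.d A (c.loc hW f)) * g +
          F.tw _ f * (c.loc hW).symm (Model.d A (c.loc hW g))
      rw [AlgEquiv.symm_apply_eq, map_add, map_mul (c.loc hW) f g, map_mul (c.loc hW),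
        map_mul (c.loc hW), loc_tw, AlgEquiv.apply_symm_apply, AlgEquiv.apply_symm_apply,
        Model.d_mul]⟩

theorem loc_fld (hW : W ≤ c.dom) (A : Fin m ⊕ Fin n) (f : F.Fun W) :
    c.loc hW ((c.fld A).app hW f) = Model.d A (c.loc hW f) :=
  AlgEquiv.apply_symm_apply _ _

theorem fld_z (hW : W ≤ c.dom) (A B : Fin m ⊕ Fin n) :
    (c.fld A).app hW (F.res hW (c.z B)) = if B = A then 1 else 0 := by
  refine (c.loc hW).injective ?_
  rw [loc_fld, loc_z, Model.d_z]
  split_ifs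
  · rw [map_one]
  · rw [map_zero]

/-- A vector field which annihilates the coordinates vanishes. -/
theorem vf_eq_zero (hW : W ≤ c.dom) {X : VF F W a}
    (hX : ∀ A, X.app le_rfl (F.res hW (c.z A)) = 0) : X = 0 := by
  refine VF.ext fun V hV f => ?_
  let Y : Model m n (chartImage c.body V) →ₗ[ℝ] Model m n (chartImage c.body V) :=
    (c.loc (hV.trans hW)).toLinearMap ∘ₗ X.app hV ∘ₗ (c.loc (hV.trans hW)).symm.toLinearMap
  have hY : ∀ g, Y g = c.loc (hV.trans hW) (X.app hV ((c.loc (hV.trans hW)).symm g)) :=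
    fun g => rfl
  have hYz : ∀ A, Y (Model.z _ A) = 0 := by
    intro A
    rw [hY, ← c.loc_z (hV.trans hW), AlgEquiv.symm_apply_apply, ← SuperSpace.res_res hV hW,
      X.app_res le_rfl hV, hX, map_zero, map_zero]
  have hY0 : Y = 0 := by
    refine Model.derivation_eq_zero (a := a) (fun g h => ?_) (fun k => hYz (Sum.inl k))
      fun l => hYz (Sum.inr l)
    have e := c.loc_tw (a := a) (hV.trans hW) ((c.loc (hV.trans hW)).symm g)
    rw [AlgEquiv.apply_symm_apply] at e
    rw [hY, hY, hY, map_mul, VF.app_mul, map_add, map_mul, map_mul, AlgEquiv.apply_symm_apply, e]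
  refine (c.loc (hV.trans hW)).injective ?_
  have := congrArg (fun T => T (c.loc (hV.trans hW) f)) hY0
  simp only [hY, AlgEquiv.symm_apply_apply, LinearMap.zero_apply] at this
  rw [this]
  exact (map_zero _).symm

/-- A component of parity a + |A| times the coordinate field of parity |A| has parity a; this cast
assembles fields from components. -/
theorem par_add_par (A : Fin m ⊕ Fin n) : a + Model.par A + Model.par A = a := by
  rcases parity_cases (Model.par A) with h | h <;> rw [h]
  · rw [add_zero, add_zero]
  · rw [add_assoc, one_add_one_parity, add_zero]

theorem isPar_app_z (hW : W ≤ c.dom) (X : VF F W a) (A : Fin m ⊕ Fin n) :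
    F.IsPar (a + Model.par A) (X.app le_rfl (F.res hW (c.z A))) :=
  VF.isPar_app ((c.isPar_z A).res hW) X le_rfl

/-- The vector field with given components. -/
def vf (hW : W ≤ c.dom) (y : Fin m ⊕ Fin n → F.Fun W) (hy : ∀ A, F.IsPar (a + Model.par A) (y A)) :
    VF F W a :=
  ∑ A, ((VF.res hW (c.fld A)).smul (y A) (hy A)).cast (par_add_par A)

theorem _root_.BVBFV.VF.sum_app {ι : Type} (s : Finset ι) (X : ι → VF F W a) (h : V ≤ W)
    (f : F.Fun V) : (∑ A ∈ s, X A).app h f = ∑ A ∈ s, (X A).app h f := by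
  classical
  induction s using Finset.induction_on with
  | empty => rfl
  | insert A s hA ih => rw [Finset.sum_insert hA, Finset.sum_insert hA, VF.add_app, ih]

theorem vf_app (hW : W ≤ c.dom) (y : Fin m ⊕ Fin n → F.Fun W)
    (hy : ∀ A, F.IsPar (a + Model.par A) (y A)) (h : V ≤ W) (f : F.Fun V) :
    (c.vf hW y hy).app h f = ∑ A, F.res h (y A) * (c.fld A).app (h.trans hW) f := by
  rw [vf, VF.sum_app]
  refine Finset.sum_congr rfl fun A _ => ?_
  rw [VF.cast_app, VF.fsmul_app]
  rfl

theorem vf_z (hW : W ≤ c.dom) (y : Fin m ⊕ Fin n → F.Fun W)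
    (hy : ∀ A, F.IsPar (a + Model.par A) (y A)) (A : Fin m ⊕ Fin n) :
    (c.vf hW y hy).app le_rfl (F.res hW (c.z A)) = y A := by
  rw [vf_app]
  simp only [fld_z, SuperSpace.res_self, mul_ite, mul_one, mul_zero, Finset.sum_ite_eq,
    Finset.mem_univ, if_true]

/-- Coordinate expression of a vector field. -/
theorem eq_vf (hW : W ≤ c.dom) (X : VF F W a) : X = c.vf hW _ (c.isPar_app_z hW X) := by
  refine sub_eq_zero.1 (c.vf_eq_zero hW fun A => ?_)
  change X.app le_rfl _ - (c.vf hW _ (c.isPar_app_z hW X)).app le_rfl _ = 0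
  rw [vf_z, sub_self]

theorem vf_app_eq (hW : W ≤ c.dom) (X : VF F W a) (f : F.Fun W) :
    X.app le_rfl f = ∑ A, X.app le_rfl (F.res hW (c.z A)) * (c.fld A).app hW f := by
  conv_lhs => rw [c.eq_vf hW X, vf_app]
  simp only [SuperSpace.res_self]

theorem form1_vf (α : Form1 F U) (h : W ≤ U) (hW : W ≤ c.dom) (y : Fin m ⊕ Fin n → F.Fun W)
    (hy : ∀ A, F.IsPar (a + Model.par A) (y A)) :
    α.app h (c.vf hW y hy) = ∑ A, y A * α.app h (VF.res hW (c.fld A)) := by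
  rw [vf, map_sum]
  refine Finset.sum_congr rfl fun A _ => ?_
  rw [α.app_cast, α.app_smul]

theorem form1_app (α : Form1 F U) (h : W ≤ U) (hW : W ≤ c.dom) (X : VF F W a) : α.app h X =
    ∑ A, X.app le_rfl (F.res hW (c.z A)) * α.app h (VF.res hW (c.fld A)) := by
  conv_lhs => rw [c.eq_vf hW X]
  exact c.form1_vf α h hW _ _

theorem form2_vf (ω : Form2 F U) (h : W ≤ U) (hW : W ≤ c.dom) (y : Fin m ⊕ Fin n → F.Fun W)
    (hy : ∀ A, F.IsPar (a + Model.par A) (y A)) (Y : VF F W b) :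
    ω.app h (c.vf hW y hy) Y = ∑ A, y A * ω.app h (VF.res hW (c.fld A)) Y := by
  rw [vf, map_sum, LinearMap.sum_apply]
  refine Finset.sum_congr rfl fun A _ => ?_
  rw [ω.app_cast_left, ω.app_smul]

theorem form2_app (ω : Form2 F U) (h : W ≤ U) (hW : W ≤ c.dom) (X : VF F W a) (Y : VF F W b) :
    ω.app h X Y = ∑ A, X.app le_rfl (F.res hW (c.z A)) * ω.app h (VF.res hW (c.fld A)) Y := by
  conv_lhs => rw [c.eq_vf hW X]
  exact c.form2_vf ω h hW _ _ _

/-! ### Values and units -/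

theorem mem_chartImage (hW : W ≤ c.dom) {x : F.carrier} (hx : x ∈ W) :
    c.body x ∈ chartImage c.body W :=
  ⟨c.body.map_source (hW hx), by
    change c.body.symm (c.body x) ∈ W
    rwa [c.body.left_inv (hW hx)]⟩

theorem exists_of_mem_chartImage {q : Fin m → ℝ} (hq : q ∈ chartImage c.body W) :
    ∃ x ∈ W, x ∈ c.dom ∧ c.body x = q :=
  ⟨c.body.symm q, hq.2, c.body.map_target hq.1, c.body.right_inv hq.1⟩

/-- The value of a superfunction at a point. -/
def val (hW : W ≤ c.dom) {x : F.carrier} (hx : x ∈ W) : F.Fun W →ₐ[ℝ] ℝ :=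
  ((Pi.evalAlgHom ℝ (fun _ : chartImage c.body W => ℝ) ⟨_, c.mem_chartImage hW hx⟩).comp
    (Smooth m (chartImage c.body W)).val).comp (Model.body.comp (c.loc hW).toAlgHom)

theorem val_apply (hW : W ≤ c.dom) {x : F.carrier} (hx : x ∈ W) (f : F.Fun W) :
    c.val hW hx f = (Model.body (c.loc hW f)).1 ⟨_, c.mem_chartImage hW hx⟩ := rfl

theorem val_res (hW : W ≤ c.dom) (h : V ≤ W) {x : F.carrier} (hx : x ∈ V) (f : F.Fun W) :
    c.val (h.trans hW) hx (F.res h f) = c.val hW (h hx) f := by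
  rw [val_apply, val_apply, loc_res, Model.body_res]

theorem val_tw (hW : W ≤ c.dom) {x : F.carrier} (hx : x ∈ W) (f : F.Fun W) :
    c.val hW hx (F.tw a f) = c.val hW hx f := by
  rcases parity_cases a with rfl | rfl
  · rfl
  · rw [val_apply, loc_tw]
    change (Model.body (Model.inv _ _)).1 _ = _
    rw [Model.body_inv]
    rfl

/-- The value is invariant under the parity involution, which changes the sign of an odd function.
-/
theorem val_eq_zero_of_odd (hW : W ≤ c.dom) {x : F.carrier} (hx : x ∈ W) {f : F.Fun W}
    (hf : F.IsPar 1 f) : c.val hW hx f = 0 := by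
  have h : F.tw 1 f = sgn 1 • f := hf
  have := c.val_tw (a := 1) hW hx f
  rw [h, map_smul, sgn_one, neg_one_smul] at this
  linarith

/-- Invertibility at a point spreads to a neighbourhood: the determinant of the bodies is a smooth
function, and where it does not vanish the matrix is invertible because its body is. -/
theorem exists_isUnit {ι : Type} [Fintype ι] [DecidableEq ι] (hW : W ≤ c.dom) {x : F.carrier}
    (hx : x ∈ W) {M : Matrix ι ι (F.Fun W)} (hM : (M.map (c.val hW hx)).det ≠ 0) :
    ∃ (V : Opens F.carrier) (h : V ≤ W), x ∈ V ∧ IsUnit (M.map (F.res h)) := by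
  let δ : Smooth m (chartImage c.body W) := (M.map fun f => Model.body (c.loc hW f)).det
  have hδ : ∀ (y : F.carrier) (hy : y ∈ W),
      (M.map (c.val hW hy)).det = δ.1 ⟨_, c.mem_chartImage hW hy⟩ := by
    intro y hy
    have := RingHom.map_det (((Pi.evalRingHom (fun _ : chartImage c.body W => ℝ)
      ⟨_, c.mem_chartImage hW hy⟩)).comp (Smooth m (chartImage c.body W)).val.toRingHom)
      (M.map fun f => Model.body (c.loc hW f))
    exact this.symm
  have hO : IsOpen ((chartImage c.body W : Set (Fin m → ℝ)) ∩ Smooth.ext δ ⁻¹' {0}ᶜ) :=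
    (Smooth.contDiffOn_ext δ).continuousOn.isOpen_inter_preimage (chartImage c.body W).2
      isOpen_compl_singleton
  let V : Opens F.carrier := ⟨W ∩ (c.body.source ∩ c.body ⁻¹' _),
    W.2.inter (c.body.isOpen_inter_preimage hO)⟩
  have hVW : V ≤ W := fun y hy => hy.1
  refine ⟨V, hVW, ⟨hx, hW hx, c.mem_chartImage hW hx, ?_⟩, ?_⟩
  · change Smooth.ext δ (c.body x) ≠ 0
    rwa [Smooth.ext_apply δ (c.mem_chartImage hW hx), ← hδ]
  · have hu : IsUnit (M.map fun f => c.loc (hVW.trans hW) (F.res hVW f)) := by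
      refine Model.isUnit_of_body fun q => ?_
      obtain ⟨q, hq⟩ := q
      obtain ⟨y, hyV, hy, rfl⟩ := c.exists_of_mem_chartImage hq
      have h1 := RingHom.map_det (((Pi.evalRingHom (fun _ : chartImage c.body V => ℝ)
        ⟨_, hq⟩)).comp (Smooth m (chartImage c.body V)).val.toRingHom)
        ((M.map fun f => c.loc (hVW.trans hW) (F.res hVW f)).map Model.body)
      have h2 : (((M.map fun f => c.loc (hVW.trans hW) (F.res hVW f)).map Model.body).det).1
          ⟨_, hq⟩ = (M.map (c.val hW hyV.1)).det := by
        refine h1.trans (congrArg Matrix.det (Matrix.ext fun A B => ?_))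
        exact c.val_res hW hVW hyV (M A B)
      rw [h2, hδ]
      have := hyV.2.2.2
      change Smooth.ext δ (c.body y) ≠ 0 at this
      rwa [Smooth.ext_apply δ (c.mem_chartImage hW hyV.1)] at this
    have := hu.map ((c.loc (hVW.trans hW)).symm.toRingEquiv.toRingHom.mapMatrix :
      Matrix ι ι _ →+* Matrix ι ι _)
    convert this using 1
    refine Matrix.ext fun A B => ?_
    exact ((c.loc (hVW.trans hW)).symm_apply_apply (F.res hVW (M A B))).symm

theorem exists_isUnit_of_val_ne_zero (hW : W ≤ c.dom) {x : F.carrier} (hx : x ∈ W) {f : F.Fun W}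
    (hf : c.val hW hx f ≠ 0) :
    ∃ (V : Opens F.carrier) (h : V ≤ W), x ∈ V ∧ IsUnit (F.res h f) := by
  obtain ⟨V, h, hxV, hu⟩ := c.exists_isUnit (ι := Unit) hW hx (M := Matrix.of fun _ _ => f) (by
    rw [Matrix.det_unique]; exact hf)
  refine ⟨V, h, hxV, ?_⟩
  obtain ⟨N, hN1, hN2⟩ := isUnit_iff_exists.1 hu
  refine isUnit_iff_exists.2 ⟨N () (), ?_, ?_⟩
  · have := congrFun (congrFun hN1 ()) ()
    rw [Matrix.mul_apply, Fintype.sum_unique] at this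
    exact this
  · have := congrFun (congrFun hN2 ()) ()
    rw [Matrix.mul_apply, Fintype.sum_unique] at this
    exact this

/-- Translates the chart-free vanishing condition into numbers: a superfunction is invertible near a
point exactly when its value there is nonzero. -/
theorem vanishesAt_iff (hW : W ≤ c.dom) (hU : W ≤ U) {x : F.carrier} (hx : x ∈ W) {f : F.Fun U} :
    F.VanishesAt f x ↔ c.val hW hx (F.res hU f) = 0 := by
  constructor
  · intro hf
    by_contra h0
    obtain ⟨V, h, hxV, hu⟩ := c.exists_isUnit_of_val_ne_zero hW hx h0
    rw [SuperSpace.res_res] at hu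
    exact hf V _ hxV hu
  · intro h0 V h hxV hu
    have hx2 : x ∈ V ⊓ W := ⟨hxV, hx⟩
    have h1 : IsUnit (F.res (inf_le_left : V ⊓ W ≤ V) (F.res h f)) := hu.map _
    have h2 := h1.map (c.val (inf_le_right.trans hW) hx2)
    have h3 := c.val_res hW inf_le_right hx2 (F.res hU f)
    rw [SuperSpace.res_res] at h2 h3
    rw [h3, h0] at h2
    exact not_isUnit_zero h2

/-- Small balls in a chart. -/
theorem exists_ball (hW : W ≤ c.dom) {x : F.carrier} (hx : x ∈ W) : ∃ r > 0, ∀ r' > 0, r' ≤ r →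
    ∃ V ≤ W, x ∈ V ∧ (chartImage c.body V : Set (Fin m → ℝ)) = Metric.ball (c.body x) r' := by
  obtain ⟨r, hr, h⟩ := Metric.isOpen_iff.1 (chartImage c.body W).2 _ (c.mem_chartImage hW hx)
  refine ⟨r, hr, fun r' hr' hle => ?_⟩
  have hb := (Metric.ball_subset_ball hle).trans h
  refine ⟨⟨c.body.source ∩ c.body ⁻¹' Metric.ball (c.body x) r',
    c.body.isOpen_inter_preimage Metric.isOpen_ball⟩, ?_, ⟨hW hx, Metric.mem_ball_self hr'⟩, ?_⟩
  · rintro y ⟨hy, hyb⟩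
    have := (hb hyb).2
    change c.body.symm (c.body y) ∈ W at this
    rwa [c.body.left_inv hy] at this
  · ext q
    constructor
    · rintro ⟨hq, hq'⟩
      have := hq'.2
      change c.body (c.body.symm q) ∈ Metric.ball (c.body x) r' at this
      rwa [c.body.right_inv hq] at this
    · intro hq
      have hqt : q ∈ c.body.target := (hb hq).1
      refine ⟨hqt, c.body.map_target hqt, ?_⟩
      change c.body (c.body.symm q) ∈ Metric.ball (c.body x) r'
      rwa [c.body.right_inv hqt]

end Chart

/-! ### Submersions in charts -/

namespace Hom

section pull

variable {F G : GradedSupermanifold.{u}} (π : Hom F G) {U U' W : Opens F.carrier}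
  {V V' : Opens G.carrier} {a b : ZMod 2}

theorem res_pull (h : U ≤ Opens.comap π.base V) (h' : U' ≤ U) (g : G.Fun V) :
    F.res h' (π.pull h g) = π.pull (h'.trans h) g :=
  SuperSpace.res_res _ _ _

theorem pull_res (h' : V' ≤ V) (h : U ≤ Opens.comap π.base V') (g : G.Fun V) :
    π.pull h (G.res h' g) = π.pull (h.trans (Opens.comap_mono π.base h')) g :=
  (congrArg (F.res h) (π.comap_res V V' h' g)).trans (SuperSpace.res_res _ _ _)

theorem pull_comap (g : G.Fun V) : π.pull le_rfl g = π.comap V g := SuperSpace.res_self _ _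

theorem pull_tw (h : U ≤ Opens.comap π.base V) (g : G.Fun V) :
    π.pull h (G.tw a g) = F.tw a (π.pull h g) := by
  rcases parity_cases a with rfl | rfl
  · rfl
  · exact (congrArg (F.res h) (π.comap_σ V g)).trans (SuperSpace.res_σ _ _)

theorem isPar_pull (h : U ≤ Opens.comap π.base V) {g : G.Fun V} (hg : G.IsPar a g) :
    F.IsPar a (π.pull h g) := by
  have e := π.pull_tw (a := 1) h g
  rw [SuperSpace.tw_one, SuperSpace.tw_one, hg, map_smul] at e
  exact e.symm

variable {π}

theorem Related.res {h : U ≤ Opens.comap π.base V} {X : VF F.toSuperSpace U a}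
    {Y : VF G.toSuperSpace V a} (hX : π.Related h X Y) (hU : U' ≤ U) (hV : V' ≤ V)
    (h' : U' ≤ Opens.comap π.base V') : π.Related h' (VF.res hU X) (VF.res hV Y) :=
  fun _ _ hU' hV' h'' g => hX _ _ (hU'.trans hU) (hV'.trans hV) h'' g

theorem Related.res_left {h : U ≤ Opens.comap π.base V} {X : VF F.toSuperSpace U a}
    {Y : VF G.toSuperSpace V a} (hX : π.Related h X Y) (hU : U' ≤ U) :
    π.Related (hU.trans h) (VF.res hU X) Y := hX.res hU le_rfl _

theorem IsVertical.res {X : VF F.toSuperSpace U a} (hX : π.IsVertical X) (hU : U' ≤ U) :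
    π.IsVertical (VF.res hU X) :=
  fun _ _ hU' h' g => hX _ _ (hU'.trans hU) h' g

theorem Related.app {h : U ≤ Opens.comap π.base V} {X : VF F.toSuperSpace U a}
    {Y : VF G.toSuperSpace V a} (hX : π.Related h X Y) (g : G.Fun V) :
    X.app le_rfl (π.pull h g) = π.pull h (Y.app le_rfl g) := hX _ _ le_rfl le_rfl h g

theorem Related.add {h : U ≤ Opens.comap π.base V} {X X' : VF F.toSuperSpace U a}
    {Y Y' : VF G.toSuperSpace V a} (hX : π.Related h X Y) (hX' : π.Related h X' Y') :
    π.Related h (X + X') (Y + Y') := fun _ _ hU hV h' g => by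
  rw [VF.add_app, VF.add_app, hX _ _ hU hV, hX' _ _ hU hV, map_add]

theorem Related.smul {h : U ≤ Opens.comap π.base V} {X : VF F.toSuperSpace U a}
    {Y : VF G.toSuperSpace V a} (hX : π.Related h X Y) (r : ℝ) :
    π.Related h (r • X) (r • Y) := fun _ _ hU hV h' g => by
  rw [VF.smul_app, VF.smul_app, hX _ _ hU hV, map_smul]

theorem Related.fsmul {h : U ≤ Opens.comap π.base V} {X : VF F.toSuperSpace U a}
    {Y : VF G.toSuperSpace V a} (hX : π.Related h X Y) {f : G.Fun V} (hf : G.IsPar b f) :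
    π.Related h (X.smul (π.pull h f) (π.isPar_pull h hf)) (Y.smul f hf) :=
  fun _ _ hU hV h' g => by
  rw [VF.fsmul_app, VF.fsmul_app, hX _ _ hU hV, map_mul, π.pull_res, π.res_pull]

theorem Related.bracket {h : U ≤ Opens.comap π.base V} {X : VF F.toSuperSpace U a}
    {Y : VF G.toSuperSpace V a} (hX : π.Related h X Y) {X' : VF F.toSuperSpace U b}
    {Y' : VF G.toSuperSpace V b} (hX' : π.Related h X' Y') :
    π.Related h (X.bracket X') (Y.bracket Y') := fun _ _ hU hV h' g => by
  rw [VF.bracket_app, VF.bracket_app, map_sub, map_smul, hX' _ _ hU hV, hX _ _ hU hV,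
    hX _ _ hU hV, hX' _ _ hU hV]

theorem Related.sub_isVertical {h : U ≤ Opens.comap π.base V} {X X' : VF F.toSuperSpace U a}
    {Y : VF G.toSuperSpace V a} (hX : π.Related h X Y) (hX' : π.Related h X' Y) :
    π.IsVertical (X - X') := fun U' V' hU h' g => by
  have h2 : U' ≤ Opens.comap π.base (V' ⊓ V) := fun y hy => ⟨h' hy, h (hU hy)⟩
  rw [← π.pull_res inf_le_left h2]
  change X.app hU _ - X'.app hU _ = 0
  rw [hX _ _ hU inf_le_right, hX' _ _ hU inf_le_right, sub_self]

/-- In [Z, X] π^* g = Z X π^* g ± X Z π^* g, the function X π^* g is itself a pull-back, so Z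
annihilates it too. -/
theorem IsVertical.bracket_related {Z : VF F.toSuperSpace U b} (hZ : π.IsVertical Z)
    {h : U ≤ Opens.comap π.base V} {X : VF F.toSuperSpace U a} {Y : VF G.toSuperSpace V a}
    (hX : π.Related h X Y) : π.IsVertical (Z.bracket X) := fun U' V' hU h' g => by
  have h2 : U' ≤ Opens.comap π.base (V' ⊓ V) := fun y hy => ⟨h' hy, h (hU hy)⟩
  rw [← π.pull_res inf_le_left h2, VF.bracket_app, hX _ _ hU inf_le_right, hZ, hZ, map_zero,
    smul_zero, sub_zero]

variable (π)

theorem euler_related : π.Related (U := ⊤) (V := ⊤) (fun _ _ => trivial) F.euler G.euler :=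
  fun _ V' _ _ h' g => by
  have := congrArg (F.res h') (π.comap_euler V' g)
  rw [← VF.app_res] at this
  exact this.symm

end pull

/-- Charts in which a morphism is the projection which keeps some of the coordinates. -/
structure AdaptedCharts {F G : GradedSupermanifold.{u}} (π : Hom F G) where
  (m n m' n' : ℕ)
  c : Chart F.toSuperSpace m n
  c' : Chart G.toSuperSpace m' n'
  i : Fin m' → Fin m
  j : Fin n' → Fin n
  i_inj : Function.Injective i
  j_inj : Function.Injective j
  dom_le : c.dom ≤ Opens.comap π.base c'.dom
  body_base : ∀ y ∈ c.dom, c'.body (π.base y) = c.body y ∘ i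
  iso_pull : ∀ (W : Opens F.carrier) (V : Opens G.carrier)
      (hW : (W : Set F.carrier) ⊆ c.body.source) (hV : (V : Set G.carrier) ⊆ c'.body.source)
      (h : W ≤ Opens.comap π.base V) (hi : ∀ y ∈ chartImage c.body W, y ∘ i ∈ chartImage c'.body V)
      (g : G.Fun V), c.iso W hW (π.pull h g) = Model.proj i j hi (c'.iso V hV g)

variable {F G : GradedSupermanifold.{u}} {π : Hom F G}

theorem IsSubmersion.exists_adaptedCharts (hπ : π.IsSubmersion) (x : F.carrier) :
    ∃ s : π.AdaptedCharts, x ∈ s.c.dom := by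
  obtain ⟨m, n, m', n', c, c', i, j, hi, hj, hx, hd, hb, hp⟩ := hπ x
  exact ⟨⟨m, n, m', n', c, c', i, j, hi, hj, hd, hb, hp⟩, hx⟩

namespace AdaptedCharts

variable (s : π.AdaptedCharts) {U W : Opens F.carrier} {V : Opens G.carrier} {a b : ZMod 2}

theorem comp_mem_chartImage (hV : V ≤ s.c'.dom)
    (h : W ≤ Opens.comap π.base V) (y : Fin s.m → ℝ) (hy : y ∈ chartImage s.c.body W) :
    y ∘ s.i ∈ chartImage s.c'.body V := by
  obtain ⟨x, hxW, hx, rfl⟩ := s.c.exists_of_mem_chartImage hy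
  rw [← s.body_base x hx]
  exact s.c'.mem_chartImage hV (h hxW)

theorem loc_pull (hW : W ≤ s.c.dom) (hV : V ≤ s.c'.dom) (h : W ≤ Opens.comap π.base V)
    (g : G.Fun V) : s.c.loc hW (π.pull h g) =
      Model.proj s.i s.j (s.comp_mem_chartImage hV h) (s.c'.loc hV g) :=
  s.iso_pull W V hW hV h _ g

/-- The coordinates of the base among the coordinates of the total space. -/
def emb : Fin s.m' ⊕ Fin s.n' → Fin s.m ⊕ Fin s.n := Sum.map s.i s.j

theorem par_emb (A : Fin s.m' ⊕ Fin s.n') : Model.par (s.emb A) = Model.par A := by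
  rcases A with k | l <;> rfl

/-- The coordinate fields of the total space which lift those of the base. -/
def lift (A : Fin s.m' ⊕ Fin s.n') : VF F.toSuperSpace s.c.dom (Model.par A) :=
  (s.c.fld (s.emb A)).cast (s.par_emb A)

theorem lift_related (A : Fin s.m' ⊕ Fin s.n') : π.Related s.dom_le (s.lift A) (s.c'.fld A) := by
  intro U' V' hU hV h' g
  refine (s.c.loc hU).injective ?_
  rw [lift, VF.cast_app, s.c.loc_fld, s.loc_pull hU hV h', s.loc_pull hU hV h', s.c'.loc_fld]
  exact Model.d_proj _ s.i_inj s.j_inj A _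

theorem fld_isVertical {A : Fin s.m ⊕ Fin s.n} (hA : A ∉ Set.range s.emb) :
    π.IsVertical (s.c.fld A) := by
  intro U' V' hU h' g
  have h2 : U' ≤ Opens.comap π.base (V' ⊓ s.c'.dom) := fun y hy => ⟨h' hy, s.dom_le (hU hy)⟩
  rw [← π.pull_res inf_le_left h2]
  refine (s.c.loc hU).injective ?_
  rw [s.c.loc_fld, s.loc_pull hU inf_le_right h2, map_zero]
  exact Model.d_proj_of_notMem _ hA _

/-- Lift of a vector field on the base. -/
def liftVF (hW : W ≤ s.c.dom) (h : W ≤ Opens.comap π.base V) (hV : V ≤ s.c'.dom)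
    (Y : VF G.toSuperSpace V a) : VF F.toSuperSpace W a :=
  ∑ A, ((VF.res hW (s.lift A)).smul (π.pull h (Y.app le_rfl (G.res hV (s.c'.z A))))
    (π.isPar_pull h (s.c'.isPar_app_z hV Y A))).cast (Chart.par_add_par A)

theorem liftVF_related (hW : W ≤ s.c.dom) (h : W ≤ Opens.comap π.base V) (hV : V ≤ s.c'.dom)
    (Y : VF G.toSuperSpace V a) : π.Related h (s.liftVF hW h hV Y) Y := by
  intro U' V' hU hV' h' g
  have e := s.c'.vf_app_eq (hV'.trans hV) (VF.res hV' Y) g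
  rw [VF.res_app] at e
  rw [e, map_sum, liftVF, VF.sum_app]
  refine Finset.sum_congr rfl fun A _ => ?_
  rw [VF.cast_app, VF.fsmul_app, map_mul, VF.res_app, VF.res_app,
    s.lift_related A _ _ (hU.trans hW) (hV'.trans hV) h', π.res_pull, ← SuperSpace.res_res hV' hV,
    Y.app_res le_rfl hV', π.pull_res]

/-- Neighbourhoods which are cubes in adapted charts. -/
theorem exists_cubes {x : F.carrier} (hx : x ∈ s.c.dom) (hxU : x ∈ U) (hxV : π.base x ∈ V) :
    ∃ (W : Opens F.carrier) (V' : Opens G.carrier) (r : ℝ), W ≤ U ∧ V' ≤ V ∧ W ≤ s.c.dom ∧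
      V' ≤ s.c'.dom ∧ x ∈ W ∧ W ≤ Opens.comap π.base V' ∧
      (chartImage s.c.body W : Set (Fin s.m → ℝ)) = Metric.ball (s.c.body x) r ∧
      (∀ y ∈ chartImage s.c'.body V', Smooth.slice s.i (s.c.body x) y ∈ chartImage s.c.body W) := by
  have hU : s.c.dom ⊓ U ≤ s.c.dom := inf_le_left
  have hV : s.c'.dom ⊓ V ≤ s.c'.dom := inf_le_left
  have hx' : x ∈ s.c.dom ⊓ U := ⟨hx, hxU⟩
  have hy' : π.base x ∈ s.c'.dom ⊓ V := ⟨s.dom_le hx, hxV⟩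
  obtain ⟨r, hr, h⟩ := s.c.exists_ball hU hx'
  obtain ⟨r', hr', h'⟩ := s.c'.exists_ball hV hy'
  -- Both cubes get the same radius in the sup metric: then the projection maps the upper cube into
  -- the lower one, and the slice through the centre, constant in the fibre coordinates, maps the
  -- lower cube into the upper one.
  have hm : 0 < min r r' := lt_min hr hr'
  obtain ⟨W, hW, hxW, eW⟩ := h _ hm (min_le_left _ _)
  obtain ⟨V', hV', hxV', eV⟩ := h' _ hm (min_le_right _ _)
  have hWd := hW.trans inf_le_left
  have hVd := hV'.trans inf_le_left
  rw [s.body_base x hx] at eV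
  refine ⟨W, V', min r r', hW.trans inf_le_right, hV'.trans inf_le_right, hWd, hVd, hxW, ?_, eW,
    ?_⟩
  · intro z hz
    have h1 : s.c.body z ∈ Metric.ball (s.c.body x) (min r r') := by
      rw [← eW]; exact s.c.mem_chartImage hWd hz
    have h2 : s.c'.body (π.base z) ∈ (chartImage s.c'.body V' : Set (Fin s.m' → ℝ)) := by
      rw [eV, s.body_base z (hWd hz), Metric.mem_ball, dist_pi_lt_iff hm]
      exact fun k => (dist_pi_lt_iff hm).1 h1 (s.i k)
    have h3 : s.c'.body.symm (s.c'.body (π.base z)) ∈ V' := h2.2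
    rwa [s.c'.body.left_inv (s.dom_le (hWd hz))] at h3
  · intro y hy
    have h1 : y ∈ (chartImage s.c'.body V' : Set (Fin s.m' → ℝ)) := hy
    rw [eV, Metric.mem_ball, dist_pi_lt_iff hm] at h1
    change _ ∈ (chartImage s.c.body W : Set (Fin s.m → ℝ))
    rw [eW, Metric.mem_ball, dist_pi_lt_iff hm]
    intro k
    by_cases hk : k ∈ Set.range s.i
    · obtain ⟨k', rfl⟩ := hk
      rw [Smooth.slice_apply s.i_inj]
      exact h1 k'
    · rw [Smooth.slice_of_notMem _ _ hk, dist_self]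
      exact hm

end AdaptedCharts

variable {U W : Opens F.carrier} {V : Opens G.carrier} {a b : ZMod 2}

/-- Pull-back along a submersion is injective on germs. -/
theorem IsSubmersion.exists_res_eq (hπ : π.IsSubmersion) {h : U ≤ Opens.comap π.base V}
    {g g' : G.Fun V} (hg : π.pull h g = π.pull h g') {x : F.carrier} (hx : x ∈ U) :
    ∃ (V' : Opens G.carrier) (hV : V' ≤ V), π.base x ∈ V' ∧ G.res hV g = G.res hV g' := by
  obtain ⟨s, hxs⟩ := hπ.exists_adaptedCharts x
  obtain ⟨W, V', r, hWU, hV, hW, hV', hxW, h', -, hs⟩ := s.exists_cubes hxs hx (h hx)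
  refine ⟨V', hV, h' hxW, (s.c'.loc hV').injective ?_⟩
  -- Restriction to the slice through x is a left inverse of pull-back on cubes.
  have e := congrArg (fun f => Model.sec s.i s.j (s.c.body x) hs (s.c.loc hW (F.res hWU f))) hg
  simp only [π.res_pull] at e
  rw [← π.pull_res hV h', ← π.pull_res hV h', s.loc_pull hW hV' h', s.loc_pull hW hV' h',
    Model.sec_proj s.i_inj s.j_inj, Model.sec_proj s.i_inj s.j_inj] at e
  exact e

theorem IsSubmersion.eq_of_pull (hπ : π.IsSubmersion) {g g' : G.Fun V}
    (hg : ∀ y ∈ V, ∃ (x : F.carrier) (U : Opens F.carrier) (h : U ≤ Opens.comap π.base V),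
      π.base x = y ∧ x ∈ U ∧ π.pull h g = π.pull h g') : g = g' := by
  refine SuperSpace.fun_ext fun y hy => ?_
  obtain ⟨x, U, h, rfl, hx, e⟩ := hg y hy
  exact hπ.exists_res_eq e hx

/-- A function which is annihilated by the vertical vector fields is locally a pull-back. -/
theorem IsSubmersion.exists_local_pull (hπ : π.IsSubmersion) {f : F.Fun U}
    (hf : ∀ (W : Opens F.carrier) (h : W ≤ U) (a : ZMod 2) (Z : VF F.toSuperSpace W a),
      π.IsVertical Z → Z.app le_rfl (F.res h f) = 0) {x : F.carrier} (hx : x ∈ U)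
    (hxV : π.base x ∈ V) :
    ∃ (W : Opens F.carrier) (V' : Opens G.carrier) (hW : W ≤ U) (h : W ≤ Opens.comap π.base V')
      (g : G.Fun V'), V' ≤ V ∧ x ∈ W ∧ π.pull h g = F.res hW f ∧
      ∀ y ∈ V', ∃ z ∈ W, π.base z = y := by
  obtain ⟨s, hxs⟩ := hπ.exists_adaptedCharts x
  obtain ⟨W, V', r, hWU, hV, hW, hV', hxW, h', hb, hs⟩ := s.exists_cubes hxs hx hxV
  refine ⟨W, V', hWU, h', (s.c'.loc hV').symm (Model.sec s.i s.j (s.c.body x) hs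
    (s.c.loc hW (F.res hWU f))), hV, hxW, (s.c.loc hW).injective ?_, fun y hy => ?_⟩
  · have hd : ∀ A ∉ Set.range s.emb, Model.d A (s.c.loc hW (F.res hWU f)) = 0 := by
      intro A hA
      have := hf W hWU _ (VF.res hW (s.c.fld A)) ((s.fld_isVertical hA).res hW)
      rw [VF.res_app] at this
      rw [← s.c.loc_fld, this, map_zero]
    rw [s.loc_pull hW hV' h', AlgEquiv.apply_symm_apply]
    refine Model.proj_sec s.i_inj s.j_inj ?_ hs _ (fun k hk => hd (Sum.inl k) ?_)
      fun l hl => hd (Sum.inr l) ?_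
    · rw [hb]; exact convex_ball _ _
    · rintro ⟨k' | l', e⟩
      · exact hk ⟨k', Sum.inl_injective e⟩
      · exact Sum.inr_ne_inl e
    · rintro ⟨k' | l', e⟩
      · exact Sum.inl_ne_inr e
      · exact hl ⟨l', Sum.inr_injective e⟩
  -- The slice supplies a point of W over each y in V'. The propagation along connected fibres
  -- starts at such points.
  · obtain ⟨z, hz, hzd, e⟩ := s.c.exists_of_mem_chartImage (hs _ (s.c'.mem_chartImage hV' hy))
    refine ⟨z, hz, s.c'.body.injOn (s.dom_le hzd) (hV' hy) ?_⟩
    rw [s.body_base z hzd, e]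
    exact funext fun k => Smooth.slice_apply s.i_inj _ _ k

theorem IsSubmersion.exists_lift (hπ : π.IsSubmersion) (Y : VF G.toSuperSpace V a) {x : F.carrier}
    (hx : π.base x ∈ V) : ∃ (W : Opens F.carrier) (h : W ≤ Opens.comap π.base V), x ∈ W ∧
      ∃ X : VF F.toSuperSpace W a, π.Related h X Y := by
  obtain ⟨s, hxs⟩ := hπ.exists_adaptedCharts x
  have h : s.c.dom ⊓ Opens.comap π.base V ≤ Opens.comap π.base (V ⊓ s.c'.dom) :=
    fun y hy => ⟨hy.2, s.dom_le hy.1⟩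
  refine ⟨s.c.dom ⊓ Opens.comap π.base V, inf_le_right, ⟨hxs, hx⟩,
    s.liftVF inf_le_left h inf_le_right (VF.res inf_le_left Y), ?_⟩
  intro U' V' hU hV h' g
  have h2 : U' ≤ Opens.comap π.base (V' ⊓ s.c'.dom) := fun y hy => ⟨h' hy, s.dom_le (hU hy).1⟩
  have h3 : V' ⊓ s.c'.dom ≤ V ⊓ s.c'.dom := inf_le_inf_right _ hV
  rw [← π.pull_res inf_le_left h2, s.liftVF_related inf_le_left h inf_le_right _ U' _ hU h3 h2,
    VF.res_app, Y.app_res hV inf_le_left, π.pull_res]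

theorem IsSubmersion.exists_lifts (hπ : π.IsSubmersion) (Y : VF G.toSuperSpace V a)
    (Y' : VF G.toSuperSpace V b) {x : F.carrier} (hx : π.base x ∈ V) :
    ∃ (W : Opens F.carrier) (h : W ≤ Opens.comap π.base V), x ∈ W ∧
      ∃ (X : VF F.toSuperSpace W a) (X' : VF F.toSuperSpace W b),
        π.Related h X Y ∧ π.Related h X' Y' := by
  obtain ⟨W, h, hxW, X, hX⟩ := hπ.exists_lift Y hx
  obtain ⟨W', h', hxW', X', hX'⟩ := hπ.exists_lift Y' hx
  exact ⟨W ⊓ W', inf_le_left.trans h, ⟨hxW, hxW'⟩, _, _, hX.res_left inf_le_left,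
    hX'.res_left inf_le_right⟩

end Hom

/-! ### Descent along submersions with connected fibres -/

/-- If some q in s were outside O, the sets W q for such q would together with O form an open cover
of s. By hypothesis these W q do not meet s ∩ O, contradicting preconnectedness. -/
theorem subset_of_isPreconnected {X : Type*} [TopologicalSpace X] {s O : Set X}
    (hs : IsPreconnected s) (hO : IsOpen O) (hne : (s ∩ O).Nonempty)
    (h : ∀ q ∈ s, ∃ W, IsOpen W ∧ q ∈ W ∧ ((s ∩ (W ∩ O)).Nonempty → q ∈ O)) : s ⊆ O := by
  by_contra hsub
  obtain ⟨q, hq, hqO⟩ := Set.not_subset.1 hsub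
  choose! W hWo hqW hW using h
  obtain ⟨z, hz, hzO, hzW⟩ := hs O (⋃ q ∈ s \ O, W q) hO
    (isOpen_biUnion fun q hq => hWo q hq.1)
    (fun z hz => or_iff_not_imp_left.2 fun hzO => Set.mem_biUnion ⟨hz, hzO⟩ (hqW z hz)) hne
    ⟨q, hq, Set.mem_biUnion ⟨hq, hqO⟩ (hqW q hq)⟩
  obtain ⟨q', hq', hzW'⟩ := Set.mem_iUnion₂.1 hzW
  exact hq'.2 (hW q' hq'.1 ⟨z, hz, hzW', hzO⟩)

namespace Hom

variable {F G : GradedSupermanifold.{u}} {π : Hom F G} {U W : Opens F.carrier}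
  {V V' : Opens G.carrier} {a b : ZMod 2}

theorem comap_injective (hπ : π.IsSubmersion) (hc : ∀ y, IsConnected (π.base ⁻¹' {y})) :
    Function.Injective (π.comap V) := by
  intro g g' e
  refine hπ.eq_of_pull fun y hy => ?_
  obtain ⟨x, hx⟩ := (hc y).nonempty
  have hx' : π.base x = y := hx
  refine ⟨x, Opens.comap π.base V, le_rfl, hx', ?_, ?_⟩
  · change π.base x ∈ V
    rwa [hx']
  · rw [π.pull_comap, π.pull_comap, e]

/-- A function which is annihilated by the vertical vector fields is a pull-back. -/
theorem exists_comap_eq (hπ : π.IsSubmersion) (hc : ∀ y, IsConnected (π.base ⁻¹' {y}))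
    {f : F.Fun (Opens.comap π.base V)}
    (hf : ∀ (W : Opens F.carrier) (h : W ≤ Opens.comap π.base V) (a : ZMod 2)
      (Z : VF F.toSuperSpace W a), π.IsVertical Z → Z.app le_rfl (F.res h f) = 0) :
    ∃ g : G.Fun V, π.comap V g = f := by
  have loc : ∀ y ∈ V, ∃ (V' : Opens G.carrier) (h : V' ≤ V) (g : G.Fun V'), y ∈ V' ∧
      π.comap V' g = F.res (Opens.comap_mono π.base h) f := by
    intro y hy
    obtain ⟨x, rfl⟩ := (hc y).nonempty
    obtain ⟨W, V', hW, h, g, hV, hxW, e, hs⟩ := hπ.exists_local_pull hf (x := x) hy hy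
    refine ⟨V', hV, g, h hxW, ?_⟩
    -- The points over V' near which f is the pull-back of the fixed function g. A priori O contains
    -- only W; connectedness is needed to reach the rest of each fibre.
    let O : Set F.carrier := {z | ∃ (W' : Opens F.carrier) (h' : W' ≤ Opens.comap π.base V'),
      z ∈ W' ∧ π.pull h' g = F.res (h'.trans (Opens.comap_mono π.base hV)) f}
    have hO : IsOpen O := by
      refine isOpen_iff_mem_nhds.2 fun z ⟨W', h', hz, e'⟩ => ?_
      exact Filter.mem_of_superset (W'.2.mem_nhds hz) fun z' hz' => ⟨W', h', hz', e'⟩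
    have key : ∀ z ∈ V', π.base ⁻¹' {z} ⊆ O := by
      intro z hz
      obtain ⟨x', hx', rfl⟩ := hs z hz
      refine subset_of_isPreconnected (hc _).isPreconnected hO ⟨x', rfl, W, h, hx', e⟩
        fun q hq => ?_
      have hq' : π.base q = π.base x' := hq
      have hqV' : π.base q ∈ V' := by rw [hq']; exact hz
      have hqV : π.base q ∈ V := hV hqV'
      obtain ⟨W₁, V₁, hW₁, h₁, g₁, -, hqW₁, e₁, -⟩ := hπ.exists_local_pull hf (x := q) hqV hqV'
      refine ⟨W₁, W₁.2, hqW₁, ?_⟩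
      rintro ⟨q₂, hq₂, hq₂W, W₂, h₂, hq₂W₂, e₂⟩
      have hq₂' : π.base q₂ = π.base x' := hq₂
      have h3 : W₁ ⊓ W₂ ≤ Opens.comap π.base (V₁ ⊓ V') :=
        fun z hz => ⟨h₁ hz.1, h₂ hz.2⟩
      -- Near q₂ the function f is the pull-back of both g₁ and g, so these have the same germ at
      -- the base point. The point q lies over the same base point, so near q the function f, which
      -- is the pull-back of g₁, is also the pull-back of g.
      have e3 : π.pull h3 (G.res inf_le_left g₁) = π.pull h3 (G.res inf_le_right g) := by
        have e4 := congrArg (F.res (inf_le_left : W₁ ⊓ W₂ ≤ W₁)) e₁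
        have e5 := congrArg (F.res (inf_le_right : W₁ ⊓ W₂ ≤ W₂)) e₂
        rw [π.res_pull, SuperSpace.res_res] at e4 e5
        rw [π.pull_res, π.pull_res, e4, e5]
      obtain ⟨V₃, hV₃, hqV₃, e6⟩ := hπ.exists_res_eq e3 (x := q₂) ⟨hq₂W, hq₂W₂⟩
      rw [SuperSpace.res_res, SuperSpace.res_res] at e6
      have h7 : W₁ ⊓ Opens.comap π.base V₃ ≤ Opens.comap π.base V₃ := inf_le_right
      refine ⟨W₁ ⊓ Opens.comap π.base V₃,
        h7.trans (Opens.comap_mono π.base (hV₃.trans inf_le_right)), ⟨hqW₁, ?_⟩, ?_⟩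
      · change π.base q ∈ V₃
        rwa [hq', ← hq₂']
      · have e8 := congrArg (F.res (inf_le_left : W₁ ⊓ Opens.comap π.base V₃ ≤ W₁)) e₁
        rw [π.res_pull, SuperSpace.res_res] at e8
        rw [← e8, ← π.pull_res (hV₃.trans inf_le_right) h7, ← e6, π.pull_res]
    refine SuperSpace.fun_ext fun q hq => ?_
    obtain ⟨W', h', hqW', e'⟩ := key _ hq rfl
    exact ⟨W', h', hqW', by rw [SuperSpace.res_res]; exact e'⟩
  obtain ⟨g, hg⟩ := SuperSpace.exists_glue (F := G.toSuperSpace) (V := V)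
    (fun V' g => ∃ h : V' ≤ V, π.comap V' g = F.res (Opens.comap_mono π.base h) f)
    (fun V₁ V₂ h g _ ⟨h', e⟩ => ⟨h.trans h', by rw [π.comap_res, e, SuperSpace.res_res]⟩)
    (fun V₁ g g' _ ⟨_, e⟩ ⟨_, e'⟩ => comap_injective hπ hc (e.trans e'.symm))
    (fun y hy => by
      obtain ⟨V', h, g, hyV, e⟩ := loc y hy
      exact ⟨V', h, hyV, g, h, e⟩)
  refine ⟨g, SuperSpace.fun_ext fun q hq => ?_⟩
  obtain ⟨V', h, g', hqV, e⟩ := loc _ hq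
  exact ⟨_, Opens.comap_mono π.base h, hqV, by rw [← π.comap_res V V' h, hg V' h g' ⟨h, e⟩, e]⟩

end Hom

/-! ### Descent of vector fields and forms -/

namespace Hom

variable {F G : GradedSupermanifold.{u}} {π : Hom F G} {U W : Opens F.carrier}
  {V V' : Opens G.carrier} {a b c : ZMod 2}

/-- Functions on the base agree if they agree after pull-back to small open sets on which given
vector fields have lifts. -/
theorem eq_of_lifts₃ (hπ : π.IsSubmersion) (hc : ∀ y, IsConnected (π.base ⁻¹' {y}))
    (Y : VF G.toSuperSpace V a) (Y' : VF G.toSuperSpace V b) (Y'' : VF G.toSuperSpace V c)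
    {g g' : G.Fun V} (h : ∀ (U : Opens F.carrier) (h : U ≤ Opens.comap π.base V)
      (X : VF F.toSuperSpace U a) (X' : VF F.toSuperSpace U b) (X'' : VF F.toSuperSpace U c),
      π.Related h X Y → π.Related h X' Y' → π.Related h X'' Y'' →
      π.pull h g = π.pull h g') : g = g' := by
  refine hπ.eq_of_pull fun y hy => ?_
  obtain ⟨x, rfl⟩ := (hc y).nonempty
  obtain ⟨U, hU, hx, X, X', hX, hX'⟩ := hπ.exists_lifts Y Y' (x := x) hy
  obtain ⟨U', hU', hx', X'', hX''⟩ := hπ.exists_lift Y'' (x := x) hy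
  exact ⟨x, U ⊓ U', inf_le_left.trans hU, rfl, ⟨hx, hx'⟩, h _ _ _ _ _ (hX.res_left inf_le_left)
    (hX'.res_left inf_le_left) (hX''.res_left inf_le_right)⟩

theorem eq_of_lifts (hπ : π.IsSubmersion) (hc : ∀ y, IsConnected (π.base ⁻¹' {y}))
    (Y : VF G.toSuperSpace V a) (Y' : VF G.toSuperSpace V b) {g g' : G.Fun V}
    (h : ∀ (U : Opens F.carrier) (h : U ≤ Opens.comap π.base V) (X : VF F.toSuperSpace U a)
      (X' : VF F.toSuperSpace U b), π.Related h X Y → π.Related h X' Y' →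
      π.pull h g = π.pull h g') : g = g' :=
  eq_of_lifts₃ hπ hc Y Y' Y' fun U hU X X' _ hX hX' _ => h U hU X X' hX hX'

theorem Related.unique (hπ : π.IsSubmersion) (hc : ∀ y, IsConnected (π.base ⁻¹' {y}))
    {h : U ≤ Opens.comap π.base V} (hU : Opens.comap π.base V ≤ U) {X : VF F.toSuperSpace U a}
    {Y Y' : VF G.toSuperSpace V a} (hY : π.Related h X Y) (hY' : π.Related h X Y') : Y = Y' := by
  refine VF.ext fun V' hV g => comap_injective hπ hc ?_
  have e := hY _ _ ((Opens.comap_mono π.base hV).trans hU) hV le_rfl g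
  have e' := hY' _ _ ((Opens.comap_mono π.base hV).trans hU) hV le_rfl g
  exact (π.pull_comap _).symm.trans (e.symm.trans (e'.trans (π.pull_comap _)))

/-- A vector field which normalizes the vertical vector fields is projectable. -/
theorem exists_related (hπ : π.IsSubmersion) (hc : ∀ y, IsConnected (π.base ⁻¹' {y}))
    {X : VF F.toSuperSpace ⊤ a} (hX : ∀ (W : Opens F.carrier) (b : ZMod 2)
      (Z : VF F.toSuperSpace W b), π.IsVertical Z → π.IsVertical (Z.bracket (VF.res le_top X))) :
    ∃ Y : VF G.toSuperSpace ⊤ a, π.Related (U := ⊤) (V := ⊤) (fun _ _ => trivial) X Y := by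
  have ex : ∀ (V : Opens G.carrier) (g : G.Fun V), ∃ g' : G.Fun V,
      π.comap V g' = X.app le_top (π.comap V g) := by
    intro V g
    -- For vertical Z, Z X π^* g = [Z, X] π^* g ± X Z π^* g, and both terms vanish; so X π^* g
    -- descends.
    refine exists_comap_eq hπ hc fun W h b Z hZ => ?_
    have e := hX W b Z hZ W V le_rfl h g
    rw [VF.bracket_app, hZ, map_zero, smul_zero, sub_zero, VF.res_app] at e
    rw [← X.app_res le_top h]
    exact e
  choose D hD using ex
  have inj := fun V => comap_injective (V := V) hπ hc
  refine ⟨⟨fun V =>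
    { toFun := D V.1
      map_add' := fun g g' => inj _ (by simp only [map_add, hD])
      map_smul' := fun r g => inj _ (by simp only [map_smul, hD, RingHom.id_apply]) },
    ⟨fun V V' hV h g => inj _ ?_, fun V hV g => inj _ ?_, fun V hV g g' => inj _ ?_⟩⟩,
    fun U' V' hU hV h' g => ?_⟩
  · change π.comap V' (D V' _) = π.comap V' (G.res h (D V g))
    rw [hD, π.comap_res V V' h, π.comap_res V V' h, hD, X.app_res]
  · change π.comap V (D V _) = π.comap V (_ • G.σ (D V g))
    rw [hD, map_smul, π.comap_σ, π.comap_σ, hD, VF.app_σ]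
  · change π.comap V (D V _) = π.comap V (D V g * g' + G.tw a g * D V g')
    have e : ∀ g : G.Fun V, π.comap V (G.tw a g) = F.tw a (π.comap V g) := fun g => by
      rw [← π.pull_comap, ← π.pull_comap, π.pull_tw]
    rw [hD, map_mul (π.comap V), VF.app_mul, map_add, map_mul (π.comap V), map_mul (π.comap V), hD,
      hD, e]
  · change X.app hU (F.res h' (π.comap V' g)) = F.res h' (π.comap V' (D V' g))
    rw [hD]
    exact X.app_res le_top h' _

section forms

variable {ω : Form2 F.toSuperSpace ⊤}

/-- Two lifts of a field differ by a vertical field, which lies in the kernel; values of ω on lifts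
are therefore well defined. -/
theorem app_eq_of_related
    (hk : ∀ (U : Opens F.carrier) (a : ZMod 2) (Y : VF F.toSuperSpace U a), π.IsVertical Y →
      Y ∈ kernel ω U a) {h : U ≤ Opens.comap π.base V} {X₁ X₂ : VF F.toSuperSpace U a}
    {X₁' X₂' : VF F.toSuperSpace U b} {Y : VF G.toSuperSpace V a} {Y' : VF G.toSuperSpace V b}
    (h₁ : π.Related h X₁ Y) (h₂ : π.Related h X₂ Y) (h₁' : π.Related h X₁' Y')
    (h₂' : π.Related h X₂' Y') : ω.app le_top X₁ X₁' = ω.app le_top X₂ X₂' := by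
  have e1 := mem_kernel'.1 (hk _ _ _ (h₁.sub_isVertical h₂)) U le_rfl b X₁'
  have e2 := mem_kernel.1 (hk _ _ _ (h₁'.sub_isVertical h₂')) U le_rfl a X₂
  rw [VF.res_self, map_sub, LinearMap.sub_apply, sub_eq_zero] at e1
  rw [VF.res_self, map_sub, sub_eq_zero] at e2
  exact e1.trans e2

/-- The local values ω(X, X') on lifts glue, being independent of the lifts, to a function on
π⁻¹(V). This function is annihilated by vertical fields and so descends to what will be the value of
the reduced form on Y and Y'. -/
theorem exists_pull_app (hπ : π.IsSubmersion) (hc : ∀ y, IsConnected (π.base ⁻¹' {y}))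
    (hω : ω.IsClosed) (hk : ∀ (U : Opens F.carrier) (a : ZMod 2) (Y : VF F.toSuperSpace U a),
      π.IsVertical Y → Y ∈ kernel ω U a) (Y : VF G.toSuperSpace V a) (Y' : VF G.toSuperSpace V b) :
    ∃ g : G.Fun V, ∀ (U : Opens F.carrier) (h : U ≤ Opens.comap π.base V)
      (X : VF F.toSuperSpace U a) (X' : VF F.toSuperSpace U b), π.Related h X Y →
      π.Related h X' Y' → ω.app le_top X X' = π.pull h g := by
  let P : ∀ W : Opens F.carrier, F.Fun W → Prop := fun W f =>
    ∃ (h : W ≤ Opens.comap π.base V) (X : VF F.toSuperSpace W a) (X' : VF F.toSuperSpace W b),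
      π.Related h X Y ∧ π.Related h X' Y' ∧ f = ω.app le_top X X'
  have ex : ∀ x ∈ Opens.comap π.base V, ∃ W ≤ Opens.comap π.base V, x ∈ W ∧
      ∃ f : F.Fun W, P W f := fun x hx => by
    obtain ⟨U, hU, hxU, X, X', hX, hX'⟩ := hπ.exists_lifts Y Y' hx
    exact ⟨U, hU, hxU, _, hU, X, X', hX, hX', rfl⟩
  obtain ⟨f, hf⟩ := SuperSpace.exists_glue (F := F.toSuperSpace) (V := Opens.comap π.base V) P
    (fun W W' h f _ ⟨hW, X, X', hX, hX', e⟩ => ⟨h.trans hW, _, _, hX.res_left h, hX'.res_left h, by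
      rw [e, ← ω.app_res le_top h]⟩)
    (fun W f f' _ ⟨hW, X, X', hX, hX', e⟩ ⟨hW', X₂, X₂', hX₂, hX₂', e'⟩ => by
      rw [e, e', app_eq_of_related hk hX hX₂ hX' hX₂'])
    ex
  obtain ⟨g, hg⟩ := exists_comap_eq hπ hc (f := f) fun W h c Z hZ => by
    refine SuperSpace.eq_zero_of_local fun x hx => ?_
    obtain ⟨W', hW', hxW, _, hW'', X, X', hX, hX', rfl⟩ := ex x (h hx)
    have hP : P W' (ω.app le_top X X') := ⟨hW'', X, X', hX, hX', rfl⟩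
    refine ⟨W ⊓ W', inf_le_left, ⟨hx, hxW⟩, ?_⟩
    have hZ' := hZ.res (inf_le_left : W ⊓ W' ≤ W)
    have hX₂ := hX.res_left (inf_le_right : W ⊓ W' ≤ W')
    have hX₂' := hX'.res_left (inf_le_right : W ⊓ W' ≤ W')
    -- Here L_Z ω = 0, and the brackets of Z with the lifts are vertical, hence in the kernel. Thus
    -- only Z ω(X, X') remains, and it vanishes.
    have e := lie2_eq_zero_of_mem_kernel hω (hk _ _ _ hZ') le_rfl
      (VF.res inf_le_right X) (VF.res inf_le_right X')
    have e1 := mem_kernel'.1 (hk _ _ _ (hZ'.bracket_related hX₂)) _ le_rfl _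
      (VF.res inf_le_right X')
    have e2 := mem_kernel.1 (hk _ _ _ (hZ'.bracket_related hX₂')) _ le_rfl _
      (VF.res inf_le_right X)
    rw [VF.res_self] at e1 e2
    simp only [lie2, VF.res_self, Form2.res_app] at e
    rw [e1, e2, smul_zero, sub_zero, sub_zero, VF.res_app, ω.app_res le_top inf_le_right,
      ← hf W' hW' _ hP, SuperSpace.res_res] at e
    rw [← Z.app_res, SuperSpace.res_res]
    have e3 := congrArg (sgn (c * (a + b)) • ·) e
    simp only [smul_smul, sgn_mul_self, one_smul, smul_zero] at e3
    exact e3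
  refine ⟨g, fun U h X X' hX hX' => ?_⟩
  rw [← hf U h _ ⟨h, X, X', hX, hX', rfl⟩, ← hg]
  rfl

/-- A closed form whose kernel consists of the vertical vector fields is a pull-back. -/
theorem exists_isPullback2 (hπ : π.IsSubmersion) (hc : ∀ y, IsConnected (π.base ⁻¹' {y}))
    (hω : ω.IsClosed) (hk : ∀ (U : Opens F.carrier) (a : ZMod 2) (Y : VF F.toSuperSpace U a),
      π.IsVertical Y → Y ∈ kernel ω U a) : ∃ η : Form2 G.toSuperSpace ⊤, π.IsPullback2 η ω := by
  have ex := fun (V : Opens G.carrier) (a b : ZMod 2) (Y : VF G.toSuperSpace V a)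
    (Y' : VF G.toSuperSpace V b) => exists_pull_app hπ hc hω hk Y Y'
  choose D hD using ex
  refine ⟨⟨fun V a b => LinearMap.mk₂ ℝ (D V.1 a b)
    (fun Y₁ Y₂ Y' => eq_of_lifts₃ hπ hc Y₁ Y₂ Y' fun U h X₁ X₂ X' h₁ h₂ h' => ?_)
    (fun r Y Y' => eq_of_lifts hπ hc Y Y' fun U h X X' hX hX' => ?_)
    (fun Y Y₁ Y₂ => eq_of_lifts₃ hπ hc Y Y₁ Y₂ fun U h X X₁ X₂ h' h₁ h₂ => ?_)
    (fun r Y Y' => eq_of_lifts hπ hc Y Y' fun U h X X' hX hX' => ?_),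
    fun V V' hV hV' a b Y Y' => ?_,
    fun V hV a b c f hf Y Y' => eq_of_lifts hπ hc Y Y' fun U h X X' hX hX' => ?_,
    fun V hV a b Y Y' => eq_of_lifts hπ hc Y Y' fun U h X X' hX hX' => ?_⟩, ?_⟩
  · rw [map_add, ← hD _ _ _ _ _ U h _ _ (h₁.add h₂) h', ← hD _ _ _ _ _ U h _ _ h₁ h',
      ← hD _ _ _ _ _ U h _ _ h₂ h', map_add, LinearMap.add_apply]
  · rw [map_smul, ← hD _ _ _ _ _ U h _ _ (hX.smul r) hX', ← hD _ _ _ _ _ U h _ _ hX hX',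
      map_smul, LinearMap.smul_apply]
  · rw [map_add, ← hD _ _ _ _ _ U h _ _ h' (h₁.add h₂), ← hD _ _ _ _ _ U h _ _ h' h₁,
      ← hD _ _ _ _ _ U h _ _ h' h₂, map_add]
  · rw [map_smul, ← hD _ _ _ _ _ U h _ _ hX (hX'.smul r), ← hD _ _ _ _ _ U h _ _ hX hX',
      map_smul]
  · change D V' a b (VF.res hV' Y) (VF.res hV' Y') = G.res hV' (D V a b Y Y')
    refine hπ.eq_of_pull fun y hy => ?_
    obtain ⟨x, rfl⟩ := (hc y).nonempty
    obtain ⟨U, hU, hx, X, X', hX, hX'⟩ := hπ.exists_lifts Y Y' (x := x) (hV' hy)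
    have h' : U ⊓ Opens.comap π.base V' ≤ Opens.comap π.base V' := inf_le_right
    refine ⟨x, U ⊓ Opens.comap π.base V', h', rfl, ⟨hx, hy⟩, ?_⟩
    rw [π.pull_res, ← hD _ _ _ _ _ _ h' _ _ (hX.res inf_le_left hV' h')
      (hX'.res inf_le_left hV' h'), ← hD _ _ _ _ _ _ _ _ _ (hX.res_left inf_le_left)
      (hX'.res_left inf_le_left)]
  · change π.pull h (D V _ b (Y.smul f hf) Y') = π.pull h (f * D V a b Y Y')
    rw [map_mul, ← hD _ _ _ _ _ U h _ _ (hX.fsmul hf) hX', ← hD _ _ _ _ _ U h _ _ hX hX',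
      ω.app_smul]
  · change π.pull h (D V b a Y' Y) = π.pull h (_ • D V a b Y Y')
    rw [map_smul, ← hD _ _ _ _ _ U h _ _ hX' hX, ← hD _ _ _ _ _ U h _ _ hX hX']
    exact ω.app_symm le_top X X'
  · exact fun U V h a b X X' Y Y' hX hX' => hD V a b Y Y' U h X X' hX hX'

theorem IsPullback2.unique (hπ : π.IsSubmersion) (hc : ∀ y, IsConnected (π.base ⁻¹' {y}))
    {η η' : Form2 G.toSuperSpace ⊤} (h : π.IsPullback2 η ω) (h' : π.IsPullback2 η' ω) :
    η = η' :=
  Form2.ext fun V hV a b Y Y' => eq_of_lifts hπ hc Y Y' fun U hU X X' hX hX' => by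
    have e := h U V hU a b X X' Y Y' hX hX'
    have e' := h' U V hU a b X X' Y Y' hX hX'
    exact e.symm.trans e'

variable {η : Form2 G.toSuperSpace ⊤}

/-- All terms of the closedness identity are built from values, derivatives and brackets; each of
these commutes with passing to lifts, and pull-back detects equality. -/
theorem IsPullback2.isClosed (hπ : π.IsSubmersion) (hc : ∀ y, IsConnected (π.base ⁻¹' {y}))
    (h : π.IsPullback2 η ω) (hω : ω.IsClosed) : η.IsClosed := by
  intro V hV a b c Y Y' Y''
  refine eq_of_lifts₃ hπ hc Y Y' Y'' fun U hU X X' X'' hX hX' hX'' => ?_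
  have e := hω U le_top a b c X X' X''
  have r1 := h U V hU _ _ _ _ _ _ hX hX'
  have r2 := h U V hU _ _ _ _ _ _ hX hX''
  have r3 := h U V hU _ _ _ _ _ _ hX' hX''
  have r4 := h U V hU _ _ _ _ _ _ (hX''.bracket hX) hX'
  have r5 := h U V hU _ _ _ _ _ _ hX (hX''.bracket hX')
  have r6 := h U V hU _ _ _ _ _ _ (hX'.bracket hX) hX''
  simp only [lie2, d1_app, contract2_app, VF.res_self, Form2.res_app] at e ⊢
  rw [r1, r2, r3, r4, r5, r6, hX.app, hX'.app, hX''.app] at e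
  simp only [map_sub, map_smul]
  exact e

theorem IsPullback2.hasDegree (hπ : π.IsSubmersion) (hc : ∀ y, IsConnected (π.base ⁻¹' {y}))
    (h : π.IsPullback2 η ω) {d : ℤ} (hω : ω.HasDegree F.euler d) : η.HasDegree G.euler d := by
  intro V a b Y Y'
  refine eq_of_lifts hπ hc Y Y' fun U hU X X' hX hX' => ?_
  have e := hω U a b X X'
  have hE : π.Related hU (VF.res le_top F.euler) (VF.res le_top G.euler) :=
    π.euler_related.res le_top le_top hU
  have r1 := h U V hU _ _ _ _ _ _ hX hX'
  have r2 := h U V hU _ _ _ _ _ _ (hE.bracket hX) hX'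
  have r3 := h U V hU _ _ _ _ _ _ hX (hE.bracket hX')
  have r4 := hE.app (η.app le_top Y Y')
  rw [VF.res_app, VF.res_app] at r4
  simp only [lie2] at e ⊢
  rw [r1, r2, r3, r4] at e
  simp only [map_sub, map_smul]
  exact e

theorem IsPullback2.hasParity (hπ : π.IsSubmersion) (hc : ∀ y, IsConnected (π.base ⁻¹' {y}))
    (h : π.IsPullback2 η ω) {e : ZMod 2} (hω : ω.HasParity e) : η.HasParity e := by
  intro V hV a b Y Y'
  refine eq_of_lifts hπ hc Y Y' fun U hU X X' hX hX' => ?_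
  have e1 := hω U le_top a b X X'
  rw [h U V hU _ _ _ _ _ _ hX hX'] at e1
  rw [map_smul]
  exact (π.pull_tw (a := 1) hU _).trans e1

theorem IsPullback1.d1 {α : Form1 F.toSuperSpace ⊤} {β : Form1 G.toSuperSpace ⊤}
    (h : π.IsPullback1 β α) : π.IsPullback2 (d1 β) (d1 α) := by
  intro U V hU a b X X' Y Y' hX hX'
  have r1 := h U V hU _ _ _ hX
  have r2 := h U V hU _ _ _ hX'
  have r3 := h U V hU _ _ _ (hX'.bracket hX)
  rw [d1_app, d1_app, r1, r2, r3, hX.app, hX'.app]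
  simp only [map_sub, map_smul]

theorem IsPullback2.contract2_eq_d0 (hπ : π.IsSubmersion)
    (hc : ∀ y, IsConnected (π.base ⁻¹' {y})) (h : π.IsPullback2 η ω) {Q : VF F.toSuperSpace ⊤ a}
    {R : VF G.toSuperSpace ⊤ a} (hQ : π.Related (U := ⊤) (V := ⊤) (fun _ _ => trivial) Q R)
    {s : F.Fun ⊤} {t : G.Fun ⊤} (hs : s = π.pullTop t) (e : contract2 Q ω = d0 s) :
    contract2 R η = d0 t := by
  refine Form1.ext fun V hV b Y => ?_
  refine eq_of_lifts hπ hc Y Y fun U hU X _ hX _ => ?_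
  have e1 := congrArg (fun β : Form1 F.toSuperSpace ⊤ => β.app le_top X) e
  simp only [contract2_app, d0_app] at e1 ⊢
  have e2 : F.res (le_top : U ≤ ⊤) (π.pullTop t) = π.pull hU (G.res (le_top : V ≤ ⊤) t) := by
    rw [π.pull_res]; exact SuperSpace.res_res _ _ _
  rw [h U V hU _ _ _ _ _ _ hX (hQ.res le_top le_top hU), hs, e2, hX.app] at e1
  exact e1

end forms

end Hom

/-! ### Parity components -/

section ParityComponents

variable {F : SuperSpace.{u}} {U V W : Opens F.carrier} {a b c e p q : ZMod 2}

/-- The component of parity `q` of a superfunction. -/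
def SuperSpace.comp (F : SuperSpace.{u}) {U : Opens F.carrier} (q : ZMod 2) :
    F.Fun U →ₗ[ℝ] F.Fun U := (1 / 2 : ℝ) • (LinearMap.id + sgn q • F.σ.toLinearMap)

theorem SuperSpace.comp_apply (f : F.Fun U) :
    F.comp q f = (1 / 2 : ℝ) • (f + sgn q • F.σ f) := rfl

theorem SuperSpace.comp_add_comp (f : F.Fun U) : F.comp q f + F.comp (q + 1) f = f := by
  rw [comp_apply, comp_apply, sgn_add, sgn_one]
  module

theorem SuperSpace.isPar_comp (f : F.Fun U) : F.IsPar q (F.comp q f) := by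
  unfold IsPar
  rw [comp_apply, map_smul, map_add, map_smul, σ_σ]
  rcases parity_cases q with rfl | rfl
  · rw [sgn_zero]
    module
  · rw [sgn_one]
    module

theorem SuperSpace.IsPar.comp_eq {f : F.Fun U} (hf : F.IsPar q f) : F.comp q f = f := by
  rw [comp_apply, hf, smul_smul, sgn_mul_self]
  module

theorem SuperSpace.IsPar.comp_eq_zero {f : F.Fun U} (hf : F.IsPar q f) : F.comp (q + 1) f = 0 := by
  have := comp_add_comp (q := q) f
  rwa [hf.comp_eq, add_eq_left] at this

theorem SuperSpace.res_comp (h : V ≤ U) (f : F.Fun U) :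
    F.res h (F.comp q f) = F.comp q (F.res h f) := by
  rw [comp_apply, comp_apply, map_smul, map_add, map_smul, res_σ]

theorem SuperSpace.IsPar.comp_mul {f : F.Fun U} (hf : F.IsPar b f) (g : F.Fun U) :
    F.comp (b + q) (f * g) = f * F.comp q g := by
  rw [comp_apply, comp_apply, map_mul, hf, sgn_add, smul_mul_assoc, smul_smul, mul_smul_comm,
    mul_add, mul_smul_comm, mul_right_comm, sgn_mul_self, one_mul]

theorem SuperSpace.IsPar.mul_comp {g : F.Fun U} (hg : F.IsPar b g) (f : F.Fun U) :
    F.comp (q + b) (f * g) = F.comp q f * g := by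
  rw [comp_apply, comp_apply, map_mul, hg, sgn_add, mul_smul_comm, smul_smul, smul_mul_assoc,
    add_mul, smul_mul_assoc, mul_assoc, sgn_mul_self, mul_one]

/-- The component of parity `q` of a `1`-form. -/
def Form1.comp (q : ZMod 2) (β : Form1 F U) : Form1 F U :=
  ⟨fun W a => F.comp (a + q) ∘ₗ β.1 W a, fun W W' hW h a X => by
    change F.comp (a + q) (β.app (h.trans hW) (VF.res h X)) = F.res h (F.comp (a + q) (β.app hW X))
    rw [SuperSpace.res_comp, β.app_res], fun W hW a b f hf X => by
    change F.comp (b + a + q) (β.app hW (X.smul f hf)) = f * F.comp (a + q) (β.app hW X)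
    rw [β.app_smul, add_assoc, hf.comp_mul]⟩

theorem Form1.comp_app (β : Form1 F U) (h : W ≤ U) (X : VF F W a) :
    (β.comp q).app h X = F.comp (a + q) (β.app h X) := rfl

theorem Form1.comp_add_comp (β : Form1 F U) : β.comp q + β.comp (q + 1) = β := by
  refine Form1.ext fun W h a X => ?_
  rw [Form1.add_app, comp_app, comp_app, ← add_assoc, SuperSpace.comp_add_comp]

/-- For ω of parity e, contraction with a field of parity p produces only the component of parity e
+ p. Solving ι_Y ω = β thus decouples into one equation for each parity of Y. -/
theorem contract2_comp {ω : Form2 F U} (hω : ω.HasParity e) (Y : VF F U p) :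
    (contract2 Y ω).comp (e + p) = contract2 Y ω := by
  refine Form1.ext fun W h a X => ?_
  rw [Form1.comp_app]
  exact ((hω W h a p X (VF.res h Y)).congr (by ring)).comp_eq

theorem contract2_comp_succ {ω : Form2 F U} (hω : ω.HasParity e) (Y : VF F U p) :
    (contract2 Y ω).comp (e + p + 1) = 0 := by
  refine Form1.ext fun W h a X => ?_
  rw [Form1.comp_app, ← add_assoc]
  exact ((hω W h a p X (VF.res h Y)).congr (by ring)).comp_eq_zero

theorem Form1.comp_add (β γ : Form1 F U) : (β + γ).comp q = β.comp q + γ.comp q :=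
  Form1.ext fun W h a X => by
    rw [Form1.add_app, comp_app, comp_app, comp_app, Form1.add_app, map_add]

end ParityComponents

/-! ### Nondegenerate forms in charts -/

section Nondegenerate

variable {F : SuperSpace.{u}} {U V W : Opens F.carrier} {a b e p : ZMod 2}

namespace Chart

variable {m n : ℕ} (c : Chart F m n)

/-- The matrix of a `2`-form in a chart. -/
def gram (ω : Form2 F ⊤) (hW : W ≤ c.dom) : Matrix (Fin m ⊕ Fin n) (Fin m ⊕ Fin n) (F.Fun W) :=
  Matrix.of fun A B => ω.app le_top (VF.res hW (c.fld A)) (VF.res hW (c.fld B))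

theorem gram_res (ω : Form2 F ⊤) (hW : W ≤ c.dom) (h : V ≤ W) :
    (c.gram ω hW).map (F.res h) = c.gram ω (h.trans hW) :=
  Matrix.ext fun _ _ => (ω.app_res le_top h _ _).symm

theorem form1_eq {β γ : Form1 F W} (hW : W ≤ c.dom)
    (h : ∀ A, β.app le_rfl (VF.res hW (c.fld A)) = γ.app le_rfl (VF.res hW (c.fld A))) : β = γ := by
  refine Form1.ext fun V hV a X => ?_
  rw [c.form1_app β hV (hV.trans hW), c.form1_app γ hV (hV.trans hW)]
  refine Finset.sum_congr rfl fun A _ => ?_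
  have := congrArg (F.res hV) (h A)
  rw [← β.app_res, ← γ.app_res] at this
  exact congrArg (_ * ·) this

/-- Linearity in the first slot expresses the hypothesis as (row of components of Y) · (Gram matrix)
= 0, and the matrix is invertible. -/
theorem eq_zero_of_contract2 {ω : Form2 F ⊤} (hW : W ≤ c.dom) (hu : IsUnit (c.gram ω hW))
    {Y : VF F W p} (hY : contract2 Y (ω.res le_top) = 0) : Y = 0 := by
  obtain ⟨N, hN, -⟩ := isUnit_iff_exists.1 hu
  have h0 : Matrix.vecMul (fun A => Y.app le_rfl (F.res hW (c.z A))) (c.gram ω hW) = 0 := by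
    funext B
    have := c.form2_app ω le_top hW Y (VF.res hW (c.fld B))
    rw [ω.app_symm le_top (VF.res hW (c.fld B)) Y] at this
    have h1 : ω.app le_top (VF.res hW (c.fld B)) Y = 0 :=
      congrArg (fun β : Form1 F W => β.app le_rfl (VF.res hW (c.fld B))) hY
    rw [h1, smul_zero] at this
    exact this.symm
  have h1 := congrArg (fun v => Matrix.vecMul v N) h0
  rw [Matrix.vecMul_vecMul, hN, Matrix.vecMul_one, Matrix.zero_vecMul] at h1
  exact c.vf_eq_zero hW fun A => congrFun h1 A

/-- The components of Y are found by multiplying with the inverse Gram matrix and then projecting to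
the parity which a field of parity p requires. -/
theorem exists_contract2_eq {ω : Form2 F ⊤} (hω : ω.HasParity e) (hW : W ≤ c.dom)
    (hu : IsUnit (c.gram ω hW)) {β : Form1 F W} (hβ : β.comp (e + p) = β) :
    ∃ Y : VF F W p, contract2 Y (ω.res le_top) = β := by
  obtain ⟨N, -, hN⟩ := isUnit_iff_exists.1 hu
  -- The sign comes from exchanging the slots, ω(∂_A, Y) = ± ω(Y, ∂_A), so that the components of Y
  -- multiply the Gram matrix from the left.
  let γ : Fin m ⊕ Fin n → F.Fun W := fun A =>
    sgn ((p + 1) * (Model.par A + 1)) • β.app le_rfl (VF.res hW (c.fld A))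
  let y := Matrix.vecMul γ N
  have hy : Matrix.vecMul y (c.gram ω hW) = γ := by
    rw [Matrix.vecMul_vecMul, hN, Matrix.vecMul_one]
  refine ⟨c.vf hW (fun A => F.comp (p + Model.par A) (y A)) fun A => SuperSpace.isPar_comp _,
    c.form1_eq hW fun A => ?_⟩
  rw [contract2_app, VF.res_self, Form2.res_app, ω.app_symm le_top (c.vf hW _ _), c.form2_vf]
  -- The Gram entries are homogeneous, so projecting the components amounts to projecting the
  -- equation; the right-hand side has the correct parity already by `hβ`.
  have e1 : ∀ B, F.comp (p + Model.par B) (y B) *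
      ω.app le_top (VF.res hW (c.fld B)) (VF.res hW (c.fld A)) =
        F.comp (e + p + Model.par A) (y B * c.gram ω hW B A) := by
    intro B
    have := (hω W le_top _ _ (VF.res hW (c.fld B)) (VF.res hW (c.fld A))).mul_comp
      (q := p + Model.par B) (y B)
    rw [← this]
    congr 2
    have e2 := par_add_par (a := p) B
    linear_combination e2
  have e3 : ∑ B, y B * c.gram ω hW B A = γ A := congrFun hy A
  have e4 : F.comp (e + p + Model.par A) (β.app le_rfl (VF.res hW (c.fld A))) =
      β.app le_rfl (VF.res hW (c.fld A)) := by
    have := congrArg (fun β : Form1 F W => β.app le_rfl (VF.res hW (c.fld A))) hβ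
    rw [Form1.comp_app, add_comm] at this
    exact this
  simp only [e1]
  rw [← map_sum, e3, map_smul, e4, smul_smul, sgn_mul_self, one_smul]

end Chart

/-- A form with invertible matrices in charts is nondegenerate. -/
theorem Form2.existsUnique_contract2 {ω : Form2 F ⊤} (hω : ω.HasParity e)
    (hu : ∀ x : F.carrier, ∃ (m n : ℕ) (c : Chart F m n) (W : Opens F.carrier) (hW : W ≤ c.dom),
      x ∈ W ∧ IsUnit (c.gram ω hW)) (β : Form1 F V) :
    ∃! Y : VF F V 0 × VF F V 1,
      contract2 Y.1 (ω.res le_top) + contract2 Y.2 (ω.res le_top) = β := by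
  have uniq : ∀ (p : ZMod 2) (W : Opens F.carrier) (Y Y' : VF F W p),
      contract2 Y (ω.res le_top) = contract2 Y' (ω.res le_top) → Y = Y' := by
    intro p W Y Y' h
    refine VF.ext_local fun x hx => ?_
    obtain ⟨m, n, c, W', hW', hxW', hu'⟩ := hu x
    refine ⟨W ⊓ W', inf_le_left, ⟨hx, hxW'⟩, ?_⟩
    have hu2 : IsUnit (c.gram ω ((inf_le_right : W ⊓ W' ≤ W').trans hW')) := by
      rw [← c.gram_res]
      exact hu'.map (F.res (inf_le_right : W ⊓ W' ≤ W')).toRingHom.mapMatrix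
    refine sub_eq_zero.1 (c.eq_zero_of_contract2 _ hu2 (Form1.ext fun W₂ h₂ a X => ?_))
    have := congrArg (fun β : Form1 F W => β.app (h₂.trans inf_le_left) X) h
    rw [contract2_app, contract2_app] at this
    exact (map_sub ((ω.res le_top).app h₂ X) _ _).trans (sub_eq_zero.2 this)
  have ex : ∀ p : ZMod 2, ∃ Y : VF F V p, contract2 Y (ω.res le_top) = β.comp (e + p) := by
    intro p
    -- Local solutions exist in charts and are unique, so they glue.
    let P : ∀ W : Opens F.carrier, VF F W p → Prop := fun W Y => ∃ h : W ≤ V,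
      contract2 Y (ω.res le_top) = (β.comp (e + p)).res h
    have mono : ∀ (W W' : Opens F.carrier) (h : W' ≤ W) (Y : VF F W p), P W Y →
        P W' (VF.res h Y) := fun W W' h Y ⟨hW, hY⟩ => ⟨h.trans hW, Form1.ext fun W₂ h₂ a X =>
      congrArg (fun β : Form1 F W => β.app (h₂.trans h) X) hY⟩
    have ex' : ∀ x ∈ V, ∃ W ≤ V, x ∈ W ∧ ∃ Y : VF F W p, P W Y := by
      intro x hx
      obtain ⟨m, n, c, W', hW', hxW', hu'⟩ := hu x
      have hu2 : IsUnit (c.gram ω ((inf_le_right : V ⊓ W' ≤ W').trans hW')) := by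
        rw [← c.gram_res]
        exact hu'.map (F.res (inf_le_right : V ⊓ W' ≤ W')).toRingHom.mapMatrix
      obtain ⟨Y, hY⟩ := c.exists_contract2_eq hω _ hu2
        (β := (β.comp (e + p)).res inf_le_left) (p := p)
        (Form1.ext fun W₂ h₂ a X => (SuperSpace.isPar_comp _).comp_eq)
      exact ⟨V ⊓ W', inf_le_left, ⟨hx, hxW'⟩, Y, inf_le_left, hY⟩
    obtain ⟨Y, hY⟩ := VF.exists_glue (V := V) P (fun W W' h Y _ => mono W W' h Y)
      (fun W Y Y' _ ⟨_, h⟩ ⟨_, h'⟩ => uniq p W Y Y' (h.trans h'.symm)) ex'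
    refine ⟨Y, Form1.ext fun W hW a X => ?_⟩
    refine SuperSpace.fun_ext fun x hx => ?_
    obtain ⟨W', hW', hxW', Y', hP⟩ := ex' x (hW hx)
    have e1 := hY W' hW' Y' hP
    obtain ⟨hW₂, e2⟩ := hP
    refine ⟨W ⊓ W', inf_le_left, ⟨hx, hxW'⟩, ?_⟩
    rw [← Form1.app_res _ hW, ← Form1.app_res _ hW, contract2_app]
    have e3 := congrArg (fun β : Form1 F W' => β.app (inf_le_right : W ⊓ W' ≤ W')
      (VF.res inf_le_left X)) e2
    rw [← e1] at e3
    exact e3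
  obtain ⟨Y₀, h₀⟩ := ex 0
  obtain ⟨Y₁, h₁⟩ := ex 1
  have hω' : (ω.res (le_top : V ≤ ⊤)).HasParity e := fun W h a b X Y => hω W le_top a b X Y
  refine ⟨(Y₀, Y₁), ?_, ?_⟩
  · change contract2 Y₀ _ + contract2 Y₁ _ = β
    rw [h₀, h₁, add_zero, Form1.comp_add_comp]
  · rintro ⟨Z₀, Z₁⟩ (hZ : contract2 Z₀ _ + contract2 Z₁ _ = β)
    refine Prod.ext (uniq _ _ _ _ ?_) (uniq _ _ _ _ ?_)
    · rw [h₀, ← hZ, Form1.comp_add, contract2_comp hω']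
      have := contract2_comp_succ hω' Z₁
      rw [add_assoc, one_add_one_parity] at this
      rw [this, add_zero]
    · rw [h₁, ← hZ, Form1.comp_add, contract2_comp hω']
      have := contract2_comp_succ hω' Z₀
      rw [add_zero] at this
      rw [this, zero_add]

end Nondegenerate

/-! ### The reduced form is symplectic -/

namespace Hom

variable {F G : GradedSupermanifold.{u}} {π : Hom F G} {a b e p : ZMod 2}

theorem AdaptedCharts.val_pull (s : π.AdaptedCharts) {W : Opens F.carrier} {V : Opens G.carrier}
    (hW : W ≤ s.c.dom) (hV : V ≤ s.c'.dom) (h : W ≤ Opens.comap π.base V) {x : F.carrier}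
    (hx : x ∈ W) (g : G.Fun V) : s.c.val hW hx (π.pull h g) = s.c'.val hV (h hx) g := by
  have hx' : π.base x ∈ V := h hx
  refine Eq.trans ?_ (s.c'.val_apply hV hx' g).symm
  rw [Chart.val_apply, s.loc_pull hW hV h, Model.body_proj]
  exact congrArg (Model.body (s.c'.loc hV g)).1 (Subtype.ext (s.body_base x (hW hx)).symm)

variable {ω : Form2 F.toSuperSpace ⊤} {η : Form2 G.toSuperSpace ⊤}

/-- The components of a vector of definite parity in the kernel of the reduced form vanish. -/
theorem AdaptedCharts.eq_zero_of_vecMul (s : π.AdaptedCharts) (hπ : π.IsSubmersion)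
    (hk : ∀ (U : Opens F.carrier) (a : ZMod 2) (Y : VF F.toSuperSpace U a),
      Y ∈ kernel ω U a ↔ π.IsVertical Y) (hr : HasConstantRank ω) (h : π.IsPullback2 η ω)
    {x : F.carrier} (hx : x ∈ s.c.dom) {v : Fin s.m' ⊕ Fin s.n' → ℝ}
    (hv : ∀ A, Model.par A ≠ p → v A = 0)
    (h0 : Matrix.vecMul v ((s.c'.gram η le_rfl).map (s.c'.val le_rfl (s.dom_le hx))) = 0) :
    v = 0 := by
  -- The extension with constant coefficients is homogeneous: constants are even, and the components
  -- of the wrong parity are zero by `hv`.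
  let Y : VF G.toSuperSpace s.c'.dom p := s.c'.vf le_rfl (fun A => algebraMap ℝ _ (v A)) fun A => by
    unfold SuperSpace.IsPar
    by_cases hA : Model.par A = p
    · have e0 : p + p = 0 := CharTwo.add_self_eq_zero p
      rw [AlgHom.commutes, hA, e0, sgn_zero, one_smul]
    · rw [hv A hA, map_zero, map_zero, smul_zero]
  have hYz : ∀ A, Y.app le_rfl (G.res le_rfl (s.c'.z A)) = algebraMap ℝ _ (v A) :=
    fun A => s.c'.vf_z le_rfl _ _ A
  have hηY : ∀ B, s.c'.val le_rfl (s.dom_le hx) (η.app le_top (s.c'.fld B) Y) = 0 := by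
    intro B
    have e1 := congrFun h0 B
    rw [η.app_symm le_top Y (s.c'.fld B), s.c'.form2_vf, map_smul, map_sum]
    simp only [map_mul, AlgHom.commutes]
    exact (congrArg (_ • ·) e1).trans (smul_zero _)
  obtain ⟨W₀, hW₀, hxW₀, X₀, hX₀⟩ := hπ.exists_lift Y (x := x) (s.dom_le hx)
  have hW : W₀ ⊓ s.c.dom ≤ s.c.dom := inf_le_right
  have hWV : W₀ ⊓ s.c.dom ≤ Opens.comap π.base s.c'.dom := inf_le_left.trans hW₀
  have hxW : x ∈ W₀ ⊓ s.c.dom := ⟨hxW₀, hx⟩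
  have hX := hX₀.res_left (inf_le_left : W₀ ⊓ s.c.dom ≤ W₀)
  set X := VF.res (inf_le_left : W₀ ⊓ s.c.dom ≤ W₀) X₀
  -- Coordinate fields upstairs are of two kinds. Those lifting base coordinates reduce to `hηY`;
  -- the remaining ones are vertical and pair to zero with everything.
  have hfld : ∀ A, s.c.val hW hxW (ω.app le_top (VF.res hW (s.c.fld A)) X) = 0 := by
    intro A
    by_cases hA : A ∈ Set.range s.emb
    · obtain ⟨B, rfl⟩ := hA
      have e1 := h _ _ hWV _ _ _ _ _ _ ((s.lift_related B).res_left hW) hX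
      rw [AdaptedCharts.lift, VF.res_cast, ω.app_cast_left] at e1
      rw [e1, s.val_pull hW le_rfl]
      exact hηY B
    · have e1 := mem_kernel'.1 ((hk _ _ _).2 ((s.fld_isVertical hA).res hW)) _ le_rfl _ X
      rw [VF.res_self] at e1
      rw [e1, map_zero]
  -- The lift X is annihilated by ω at x, so constant rank provides a field Z in ker ω with the same
  -- value at x.
  obtain ⟨W', hW', hxW', Z, hZ, hXZ⟩ := hr _ p X x hxW fun W' hW' hxW' b Z => by
    rw [(s.c.vanishesAt_iff (hW'.trans hW) le_rfl hxW'), SuperSpace.res_self,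
      ω.app_symm le_top Z (VF.res hW' X), s.c.form2_app ω le_top (hW'.trans hW), map_smul, map_sum]
    refine (congrArg (_ • ·) (Finset.sum_eq_zero fun A _ => ?_)).trans (smul_zero _)
    have e1 := hfld A
    rw [← s.c.val_res hW hW' hxW', ← ω.app_res le_top hW'] at e1
    rw [map_mul]
    exact (congrArg (_ * ·) e1).trans (mul_zero _)
  funext A
  -- Compare X and Z on the pulled-back coordinate: Z is vertical and gives 0, while X gives the
  -- constant v A, which must therefore vanish.
  have e1 := hXZ W' le_rfl hxW' (π.pull (hW'.trans hWV) (s.c'.z A))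
  have hZv := (hk _ _ _).1 hZ
  have e2 := hYz A
  rw [SuperSpace.res_self] at e2
  rw [hZv, sub_zero, hX _ _ hW' le_rfl (hW'.trans hWV), e2,
    s.c.vanishesAt_iff (hW'.trans hW) le_rfl hxW', SuperSpace.res_self, AlgHom.commutes,
    AlgHom.commutes] at e1
  exact e1

/-- If the matrix of values at the point were singular, it would have a null vector. Its even and
odd parts are null vectors separately, since entries of odd parity have value 0, and both parts
vanish by `eq_zero_of_vecMul`. -/
theorem AdaptedCharts.exists_isUnit_gram (s : π.AdaptedCharts) (hπ : π.IsSubmersion)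
    (hk : ∀ (U : Opens F.carrier) (a : ZMod 2) (Y : VF F.toSuperSpace U a),
      Y ∈ kernel ω U a ↔ π.IsVertical Y) (hr : HasConstantRank ω) (h : π.IsPullback2 η ω)
    (hη : η.HasParity e) {x : F.carrier} (hx : x ∈ s.c.dom) :
    ∃ (W : Opens G.carrier) (hW : W ≤ s.c'.dom), π.base x ∈ W ∧ IsUnit (s.c'.gram η hW) := by
  obtain ⟨V, hV, hxV, hu⟩ := s.c'.exists_isUnit le_rfl (s.dom_le hx) (M := s.c'.gram η le_rfl) (by
    intro hdet
    obtain ⟨v, hv, h0⟩ := Matrix.exists_vecMul_eq_zero_iff.2 hdet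
    have hodd : ∀ A B, Model.par A + Model.par B ≠ e →
        s.c'.val le_rfl (s.dom_le hx) (s.c'.gram η le_rfl A B) = 0 := by
      intro A B hAB
      refine s.c'.val_eq_zero_of_odd _ _ ((hη _ le_top _ _ _ _).congr ?_)
      rcases parity_cases (e + Model.par A + Model.par B) with h1 | h1
      · refine absurd ?_ hAB
        have e2 : e + e = 0 := CharTwo.add_self_eq_zero e
        linear_combination h1 - e2
      · exact h1
    -- In a column B only the rows A with |A| + |B| = e contribute. So the part of v of parity p
    -- either gives the whole column sum of v or gives nothing.
    have key : ∀ p : ZMod 2, (fun A => if Model.par A = p then v A else 0) = 0 := by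
      intro p
      refine s.eq_zero_of_vecMul hπ hk hr h hx (p := p) (fun A hA => if_neg hA) (funext fun B => ?_)
      have hsum : ∀ w : Fin s.m' ⊕ Fin s.n' → ℝ, Matrix.vecMul w ((s.c'.gram η le_rfl).map
          (s.c'.val le_rfl (s.dom_le hx))) B = ∑ A, w A *
            s.c'.val le_rfl (s.dom_le hx) (s.c'.gram η le_rfl A B) := fun w => rfl
      by_cases hB : p + Model.par B = e
      · refine Eq.trans ?_ (congrFun h0 B)
        rw [hsum, hsum]
        refine Finset.sum_congr rfl fun A _ => ?_
        split_ifs with hA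
        · rfl
        · rw [hodd A B fun h1 => hA (add_right_cancel (h1.trans hB.symm)), mul_zero, mul_zero]
      · rw [hsum]
        refine Finset.sum_eq_zero fun A _ => ?_
        split_ifs with hA
        · rw [hodd A B (by rwa [hA]), mul_zero]
        · rw [zero_mul]
    refine hv (funext fun A => ?_)
    have := congrFun (key (Model.par A)) A
    rwa [if_pos rfl] at this)
  refine ⟨V, hV, hxV, ?_⟩
  rwa [s.c'.gram_res] at hu

theorem IsPullback2.isSymplectic (hπ : π.IsSubmersion) (hc : ∀ y, IsConnected (π.base ⁻¹' {y}))
    (hk : ∀ (U : Opens F.carrier) (a : ZMod 2) (Y : VF F.toSuperSpace U a),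
      Y ∈ kernel ω U a ↔ π.IsVertical Y) (hr : HasConstantRank ω) (h : π.IsPullback2 η ω)
    (hω : ω.IsClosed) (hp : ω.HasParity e) : IsSymplectic η where
  closed := h.isClosed hπ hc hω
  nondegenerate V β := by
    have hη := h.hasParity hπ hc hp
    refine Form2.existsUnique_contract2 hη (fun y => ?_) β
    obtain ⟨x, rfl⟩ := (hc y).nonempty
    obtain ⟨s, hxs⟩ := hπ.exists_adaptedCharts x
    obtain ⟨W, hW, hxW, hu⟩ := s.exists_isUnit_gram hπ hk hr h hη hxs
    exact ⟨_, _, s.c', W, hW, hxW, hu⟩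

end Hom

/-! ### Reduction -/

theorem contract2_zero {F : SuperSpace.{u}} {U : Opens F.carrier} (a : ZMod 2) (ω : Form2 F U) :
    contract2 (0 : VF F U a) ω = 0 :=
  Form1.ext fun _ h _ X => map_zero (ω.app h X)

namespace Hom

variable {F G : GradedSupermanifold.{u}} {π : Hom F G} {U W : Opens F.carrier}
  {V : Opens G.carrier} {a b : ZMod 2}

theorem pullTop_injective (hπ : π.IsSubmersion) (hc : ∀ y, IsConnected (π.base ⁻¹' {y})) :
    Function.Injective π.pullTop := fun g g' e => hπ.eq_of_pull fun y _ => by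
  obtain ⟨x, hx⟩ := (hc y).nonempty
  exact ⟨x, ⊤, fun _ _ => trivial, hx, trivial, e⟩

theorem exists_pullTop_eq (hπ : π.IsSubmersion) (hc : ∀ y, IsConnected (π.base ⁻¹' {y}))
    {f : F.Fun ⊤} (hf : ∀ (W : Opens F.carrier) (a : ZMod 2) (Z : VF F.toSuperSpace W a),
      π.IsVertical Z → Z.app le_rfl (F.res le_top f) = 0) : ∃ g : G.Fun ⊤, π.pullTop g = f := by
  obtain ⟨g, hg⟩ := exists_comap_eq hπ hc (V := ⊤) (f := F.res le_top f) fun W h a Z hZ => by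
    rw [SuperSpace.res_res]
    exact hf W a Z hZ
  exact ⟨g, (congrArg (F.res _) hg).trans
    ((SuperSpace.res_res _ _ _).trans (SuperSpace.res_self _ _))⟩

theorem IsVertical.bracket_swap {Z : VF F.toSuperSpace U a} (hZ : π.IsVertical Z)
    {X : VF F.toSuperSpace U b} (h : π.IsVertical (X.bracket Z)) : π.IsVertical (Z.bracket X) := by
  intro U' V' hU h' g
  have e := h U' V' hU h' g
  rw [VF.bracket_app, hZ, map_zero, zero_sub, neg_eq_zero] at e
  have e1 := congrArg (sgn (b * a) • ·) e
  simp only [smul_smul, sgn_mul_self, one_smul, smul_zero] at e1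
  rw [VF.bracket_app, e1, hZ, map_zero, smul_zero, sub_zero]

variable {X : VF F.toSuperSpace ⊤ a} {Y : VF G.toSuperSpace ⊤ a}

theorem Related.hasDegree (hπ : π.IsSubmersion) (hc : ∀ y, IsConnected (π.base ⁻¹' {y}))
    (h : π.Related (U := ⊤) (V := ⊤) (fun _ _ => trivial) X Y) {d : ℤ}
    (hX : VFHasDegree F.euler d X) : VFHasDegree G.euler d Y := by
  intro V g
  refine comap_injective hπ hc ?_
  have e := (π.euler_related.bracket h) _ V le_top le_top le_rfl g
  rw [hX, h _ V le_top le_top le_rfl g, π.pull_comap, π.pull_comap] at e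
  rw [map_smul]
  exact e.symm

theorem Related.app_pullTop (h : π.Related (U := ⊤) (V := ⊤) (fun _ _ => trivial) X Y)
    (g : G.Fun ⊤) : X.app le_rfl (π.pullTop g) = π.pullTop (Y.app le_rfl g) :=
  h.app g

theorem hasDegree_of_pullTop (hπ : π.IsSubmersion) (hc : ∀ y, IsConnected (π.base ⁻¹' {y}))
    {g : G.Fun ⊤} {d : ℤ} (hg : FunHasDegree F.euler d (π.pullTop g)) :
    FunHasDegree G.euler d g := by
  refine pullTop_injective hπ hc ?_
  rw [← π.euler_related.app_pullTop, map_smul]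
  exact hg

end Hom

end BVBFV

end

/-! ### The theorem -/

open BVBFV
theorem mainTheorem4 (F : GradedSupermanifold.{u}) (k : ℤ) (hk : k ≠ -1)
    (ω : Form2 F.toSuperSpace ⊤) (S : F.Fun ⊤) (Q : VF F.toSuperSpace ⊤ 1) (T : F.Fun ⊤)
    (hBV : IsEquivariantBV F k ω S Q T) :
    (∀ (U : Opens F.carrier) (a b : ZMod 2) (Y : VF F.toSuperSpace U a)
      (Z : VF F.toSuperSpace U b), Y ∈ kernel (omegaB ω S Q) U a →
      Z ∈ kernel (omegaB ω S Q) U b → Y.bracket Z ∈ kernel (omegaB ω S Q) U (a + b)) ∧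
    ∃ SB : F.Fun ⊤,
      (∀ s : F.Fun ⊤, (FunHasDegree F.euler (k + 1) s ∧ contract2 Q (omegaB ω S Q) = d0 s) ↔
        s = SB) ∧
      ∀ (G : GradedSupermanifold.{u}) (π : Hom F G), IsLeafSpace (omegaB ω S Q) π →
        ∃ (ω' : Form2 G.toSuperSpace ⊤) (hω' : IsSymplectic ω')
          (Q' : VF G.toSuperSpace ⊤ 1) (S' T' : G.Fun ⊤),
          (∀ β : Form2 G.toSuperSpace ⊤, π.IsPullback2 β (omegaB ω S Q) ↔ β = ω') ∧
          (∀ R : VF G.toSuperSpace ⊤ 1,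
            π.Related (U := ⊤) (V := ⊤) (fun _ _ => trivial) Q R ↔ R = Q') ∧
          (∀ s : G.Fun ⊤, SB = π.pullTop s ↔ s = S') ∧
          (∀ t : G.Fun ⊤, tB Q T = π.pullTop t ↔ t = T') ∧
          ω'.HasDegree G.euler k ∧ VFHasDegree G.euler 1 Q' ∧
          FunHasDegree G.euler (k + 1) S' ∧ FunHasDegree G.euler (k + 2) T' ∧
          contract2 Q' ω' = d0 S' ∧
          (1 / 2 : ℝ) • poisson hω' S' S' = T' ∧
          (1 / 2 : ℝ) • Q'.app le_rfl S' = T' ∧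
          (1 / 2 : ℝ) • contract2 (Q'.bracket Q') ω' = -d0 T' ∧
          (1 / 2 : ℝ) • contract1 Q (contract2 Q ω) - T = π.pullTop S' ∧
          Q.app le_rfl T = -π.pullTop T' ∧
          ∀ α' : Form1 G.toSuperSpace ⊤, π.IsPullback1 α' (alphaB ω S Q) →
            ω' = d1 α' ∧
            (1 / 2 : ℝ) • Q.app le_rfl S =
              T + π.pullTop (S' - (1 / 2 : ℝ) • contract1 Q' α') := by
  obtain ⟨e, he⟩ := hBV.parity
  have hcl : (omegaB ω S Q).IsClosed := d1_isClosed _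
  have hSB := contract2_omegaB hBV.closed S T hBV.hamiltonian
  have hdeg := boundary_action_hasDegree hBV.degree_ω hBV.degree_T hBV.degree_Q
  refine ⟨fun U a b Y Z hY hZ => bracket_mem_kernel hcl hY hZ,
    (1 / 2 : ℝ) • contract1 Q (contract2 Q ω) - T, fun s => ⟨fun hs => ?_, fun hs => ?_⟩,
    fun G π hL => ?_⟩
  -- Two candidates differ by a function of degree k + 1 ≠ 0 with zero differential.
  · refine sub_eq_zero.1 (eq_zero_of_d0_eq_zero (E := F.euler) (k := k + 1)
      (fun h => hk (by linarith)) (hs.1.sub hdeg) ?_)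
    rw [d0_sub, ← hs.2, ← hSB, sub_self]
  · rw [hs]
    exact ⟨hdeg, hSB⟩
  · generalize hSB' : (1 / 2 : ℝ) • contract1 Q (contract2 Q ω) - T = SB at hSB hdeg ⊢
    have hπ := hL.submersion
    have hc := hL.connected
    have hker := hL.mem_kernel_iff
    obtain ⟨ω', h'⟩ := Hom.exists_isPullback2 hπ hc hcl fun U a Y => (hker U a Y).2
    -- From ι_Q ω̲ = δS̲ and closedness, L_Q ω̲ = 0; hence Q normalizes ker ω̲, that is, the
    -- vertical fields.
    obtain ⟨Q', hQ'⟩ := Hom.exists_related hπ hc (X := Q) fun W b Z hZ =>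
      hZ.bracket_swap ((hker _ _ _).1 (bracket_mem_kernel_of_lie2 (U := W) (Z := VF.res le_top Q)
        (fun W' h a b X Y => lie2_eq_zero_of_contract2 hcl hSB le_top X Y) ((hker _ _ _).2 hZ)))
    -- For vertical Z, Z S̲ = ι_Z ι_Q ω̲ = 0 since Z lies in ker ω̲.
    obtain ⟨S', hS'⟩ := Hom.exists_pullTop_eq hπ hc (f := SB) fun W a Z hZ => by
      have e1 := congrArg (fun β : Form1 F.toSuperSpace ⊤ => β.app le_top Z) hSB
      have e2 := mem_kernel'.1 ((hker _ _ _).2 hZ) W le_rfl 1 (VF.res le_top Q)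
      exact e1.symm.trans e2
    have hω' := h'.isSymplectic hπ hc hker hL.constantRank hcl (omegaB_hasParity he S Q)
    have hQS := h'.contract2_eq_d0 hπ hc hQ' hS'.symm hSB
    have hQdeg := hQ'.hasDegree hπ hc hBV.degree_Q
    have hSdeg : FunHasDegree G.euler (k + 1) S' :=
      Hom.hasDegree_of_pullTop hπ hc (by rw [hS']; exact hdeg)
    -- T̲ = ½ Q S̲ is the pull-back of ½ Q∂ S∂, which serves as the definition of T∂.
    have hT : tB Q T = π.pullTop ((1 / 2 : ℝ) • Q'.app le_rfl S') := by
      rw [map_smul, ← hQ'.app_pullTop, hS', ← hSB']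
      exact (app_boundary_action hBV.closed T hBV.hamiltonian).symm
    have hinj := Hom.pullTop_injective hπ hc
    refine ⟨ω', hω', Q', S', (1 / 2 : ℝ) • Q'.app le_rfl S', fun β => ⟨fun h => h.unique hπ hc h',
      fun h => h ▸ h'⟩, fun R => ⟨fun h => h.unique hπ hc le_top hQ', fun h => h ▸ hQ'⟩,
      fun s => ⟨fun h => hinj (h.symm.trans hS'.symm), fun h => h ▸ hS'.symm⟩,
      fun t => ⟨fun h => hinj (h.symm.trans hT), fun h => h ▸ hT⟩,
      h'.hasDegree hπ hc (omegaB_hasDegree hBV.degree_ω hBV.degree_Q), hQdeg, hSdeg, ?_, hQS, ?_,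
      rfl, contract2_bracket_self hω'.closed hQS, hS'.symm, ?_, fun α' hα' => ⟨?_, ?_⟩⟩
    · have := (FunHasDegree.app hQdeg hSdeg).smul (1 / 2)
      rwa [show 1 + (k + 1) = k + 2 by ring] at this
    -- Q∂ solves the equation defining the Hamiltonian field of S∂, so by nondegeneracy that field
    -- has even part 0 and odd part Q∂.
    · have e1 : hamiltonian hω' S' = (0, Q') :=
        (hω'.nondegenerate ⊤ (d0 S')).unique
          (hω'.nondegenerate ⊤ (d0 S')).exists.choose_spec (by
            rw [contract2_zero, zero_add]
            exact hQS)
      rw [poisson, e1]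
      exact congrArg (_ • ·) (zero_add _)
    · rw [← hT, tB, neg_neg]
    · exact (h'.unique hπ hc hα'.d1)
    -- Contracting α̲ = ι_Q ω - δS with Q gives ι_Q ι_Q ω - Q S = π^*(ι_{Q∂} α∂). Halving and
    -- substituting ½ι_Q ι_Q ω = T + π^* S∂ yields the formula.
    · have e1 : contract1 Q (contract2 Q ω) - Q.app le_rfl S = π.pullTop (contract1 Q' α') := by
        have e2 := hα' ⊤ ⊤ (fun _ _ => trivial) 1 Q Q' hQ'
        rw [alphaB, Form1.sub_app, d0_app, SuperSpace.res_self] at e2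
        exact e2
      rw [map_sub, map_smul, ← e1, hS', ← hSB']
      module
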